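/- **Theorem.** Let $M$ be a finite-dimensional smooth manifold and $E\to M$ a smooth real vector bundle of finite rank, with first jet bundle $JE\to M$ (again a vector bundle). A connection of $E$ is a smooth section $\kappa:E\to JE$; it is linear if it is a linear morphism over $M$. In a chart $(x^a)$ of $M$ and linear fibre coordinates $(y^i)$ of $E$ it has components $\kappa_a{}^i{}_j$, defined by $y^i_a\circ\kappa=\kappa_a{}^i{}_j\,y^j$, so that its covariant derivative is $\nabla_a\phi^i=\partial_a\phi^i-\kappa_a{}^i{}_j\phi^j$; its curvature $R$ has components $R_{ab}{}^i{}_j=\partial_b\kappa_a{}^i{}_j-\partial_a\kappa_b{}^i{}_j+\kappa_a{}^i{}_h\kappa_b{}^h{}_j-\kappa_b{}^i{}_h\kappa_a{}^h{}_j$, i.e. $R(X,Y)s=\nabla_X\nabla_Ys-\nabla_Y\nabla_Xs-\nabla_{[X,Y]}s$. Let $\kappa$ be a linear connection of $E$ and $\Gamma$ a linear connection of $TM$, with components $\Gamma_a{}^c{}_b$ (same convention). Let $\kappa'=s_\Gamma\circ J\kappa:JE\to JJE$, where $s_\Gamma:JJE\to JJE$ is the exchange map $$(x^a,y^i,\underline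 y^i_a;\,y^i_a,y^i_{ab})\mapsto(x^a,y^i,y^i_a;\,\underline y^i_a,\;y^i_{ba}+\Gamma_b{}^c{}_a(\underline y^i_c-y^i_c)),$$ and let $\kappa^*$ be the dual connection of $E^*$. Then $\kappa'$ is a linear connection of $JE$, $\kappa^*$ is a linear connection of $E^*$, and $\kappa^\uparrow=\kappa'\otimes\kappa^*$ is a linear connection of $JE\otimes E^*$. Let $C\subset JE\otimes E^*$ be the bundle of linear connections of $E$, i.e. the affine subbundle of the elements that project to the identity in $E\otimes E^*$, with fibre coordinates $y^i_{aj}$. Then: 1. $\kappa^\uparrow$ restricts to an affine connection of $C\to M$, that is, to a smooth section $C\to JC$ that is an affine morphism over $M$. 2. In all charts of $M$ and linear fibre coordinates of $E$, the coefficients of this restriction are $$(\kappa^\uparrow_a)^i_{bj}=\partial_b\kappa_a{}^i{}_j-\kappa_a{}^h{}_j\,y^i_{bh}+y^h_{bj}\,\kappa_a{}^i{}_h+\Gamma_a{}^c{}_b\,(\kappa_c{}^i{}_j-y^i_{cj}).$$ 3. The covariant derivative of $\kappa$, regarded as a section $M\to C$, with respect to $\kappa^\uparrow$ is a section of $T^*M\otimes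 T^*M\otimes\operatorname{End}E$ equal to minus the curvature of $\kappa$; in components, $$\nabla_a\kappa_b{}^i{}_j=\partial_a\kappa_b{}^i{}_j-\partial_b\kappa_a{}^i{}_j+\kappa_b{}^i{}_h\kappa_a{}^h{}_j-\kappa_a{}^i{}_h\kappa_b{}^h{}_j=-R_{ab}{}^i{}_j .$$ In particular it does not depend on $\Gamma$. -/

import Mathlib

open Bundle Set Filter
open scoped Manifold ContDiff Topology

set_option linter.unusedSectionVars false

noncomputable section JetBundle

variable (E : Type*) [NormedAddCommGroup E] [NormedSpace ℝ E]
  {M : Type*} [TopologicalSpace M] [ChartedSpace E M]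
  (F : Type*) [NormedAddCommGroup F] [NormedSpace ℝ F]
  (V : M → Type*) [TopologicalSpace (TotalSpace F V)]
  [∀ x, AddCommGroup (V x)] [∀ x, Module ℝ (V x)] [∀ x, TopologicalSpace (V x)]
  [FiberBundle F V] [VectorBundle ℝ F V]

/-- The domain on which both the preferred chart of `M` and the preferred trivialization of `V` at
`i` are defined. -/
def jetBaseSet (i : M) : Set M :=
  (chartAt E i).source ∩ (trivializationAt F V i).baseSet

/-- The transition function of `V` from the preferred trivialization at `i` to the one at `j`. -/
def fiberTransition (i j x : M) : F →L[ℝ] F :=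
  ((trivializationAt F V i).coordChangeL ℝ (trivializationAt F V j) x : F →L[ℝ] F)

/-- The derivative of `fiberTransition F V i j` at `x`, read in the preferred chart at `j`. -/
def fiberTransitionDeriv (i j x : M) : E →L[ℝ] F →L[ℝ] F :=
  fderiv ℝ (fun y : E ↦ fiberTransition F V i j ((chartAt E j).symm y)) (chartAt E j x)

variable [IsManifold 𝓘(ℝ, E) ∞ M]

/-- The transition function of the first jet bundle of `V`: in the coordinates at `i` a section
reads `u`, in those at `j` it reads `z ↦ g (z) (u (τ z))`, where `g` is the transition function of
`V` and `τ` the change of charts from `j` to `i`; hence the pair (value, derivative) changes from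
`(u, L)` to `(g u, (D g) u + g ∘ L ∘ Dτ)`. -/
def jetTransition (i j x : M) : (F × (E →L[ℝ] F)) →L[ℝ] (F × (E →L[ℝ] F)) :=
  ((fiberTransition F V i j x).comp (ContinuousLinearMap.fst ℝ F (E →L[ℝ] F))).prod
    ((fiberTransitionDeriv E F V i j x).flip.comp (ContinuousLinearMap.fst ℝ F (E →L[ℝ] F)) +
      (((fiberTransition F V i j x).postcomp E).comp
        ((tangentCoordChange 𝓘(ℝ, E) j i x).precomp F)).comp
          (ContinuousLinearMap.snd ℝ F (E →L[ℝ] F)))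

variable {E F V}

theorem jetTransition_apply (i j x : M) (u : F) (L : E →L[ℝ] F) :
    jetTransition E F V i j x (u, L) =
      (fiberTransition F V i j x u,
        (fiberTransitionDeriv E F V i j x).flip u +
          (fiberTransition F V i j x).comp (L.comp (tangentCoordChange 𝓘(ℝ, E) j i x))) := rfl

variable [ContMDiffVectorBundle ∞ F V 𝓘(ℝ, E)]

theorem contMDiffOn_fiberTransition (i j : M) :
    ContMDiffOn 𝓘(ℝ, E) 𝓘(ℝ, F →L[ℝ] F) ∞ (fiberTransition F V i j)
      (jetBaseSet E F V i ∩ jetBaseSet E F V j) :=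
  (contMDiffOn_coordChangeL (IB := 𝓘(ℝ, E)) (n := ∞) (trivializationAt F V i)
    (trivializationAt F V j)).mono fun _ hx ↦ ⟨hx.1.2, hx.2.2⟩

theorem isOpen_jetBaseSet (i : M) : IsOpen (jetBaseSet E F V i) :=
  (chartAt E i).open_source.inter (trivializationAt F V i).open_baseSet

theorem contDiffAt_fiberTransition_chart {i j k x : M}
    (hi : x ∈ jetBaseSet E F V i) (hj : x ∈ jetBaseSet E F V j) (hk : x ∈ jetBaseSet E F V k) :
    ContDiffAt ℝ ∞ (fun y : E ↦ fiberTransition F V i j ((chartAt E k).symm y))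
      (chartAt E k x) := by
  rw [← contMDiffAt_iff_contDiffAt]
  have h1 : ContMDiffAt 𝓘(ℝ, E) 𝓘(ℝ, F →L[ℝ] F) ∞ (fiberTransition F V i j)
      ((chartAt E k).symm (chartAt E k x)) := by
    rw [(chartAt E k).left_inv hk.1]
    exact (contMDiffOn_fiberTransition i j).contMDiffAt
      (((isOpen_jetBaseSet i).inter (isOpen_jetBaseSet j)).mem_nhds ⟨hi, hj⟩)
  have h2 : ContMDiffAt 𝓘(ℝ, E) 𝓘(ℝ, E) ∞ (chartAt E k).symm (chartAt E k x) :=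
    (contMDiffOn_chart_symm (I := 𝓘(ℝ, E)) (n := ∞) (x := k)).contMDiffAt
      ((chartAt E k).open_target.mem_nhds ((chartAt E k).map_source hk.1))
  exact h1.comp _ h2

theorem contMDiffOn_fiberTransitionDeriv (i j : M) :
    ContMDiffOn 𝓘(ℝ, E) 𝓘(ℝ, E →L[ℝ] F →L[ℝ] F) ∞ (fiberTransitionDeriv E F V i j)
      (jetBaseSet E F V i ∩ jetBaseSet E F V j) := by
  rintro x ⟨hi, hj⟩
  refine ContMDiffAt.contMDiffWithinAt ?_
  have h1 : ContDiffAt ℝ ∞ (fderiv ℝ fun y : E ↦ fiberTransition F V i j ((chartAt E j).symm y))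
      (chartAt E j x) := (contDiffAt_fiberTransition_chart hi hj hj).fderiv_right le_rfl
  have h2 : ContMDiffAt 𝓘(ℝ, E) 𝓘(ℝ, E) ∞ (chartAt E j) x :=
    (contMDiffOn_chart (I := 𝓘(ℝ, E)) (n := ∞) (x := j)).contMDiffAt
      ((chartAt E j).open_source.mem_nhds hj.1)
  exact h1.contMDiffAt.comp x h2

set_option synthInstance.maxHeartbeats 200000 in
theorem contMDiffOn_jetTransition (i j : M) :
    ContMDiffOn 𝓘(ℝ, E) 𝓘(ℝ, (F × (E →L[ℝ] F)) →L[ℝ] (F × (E →L[ℝ] F))) ∞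
      (jetTransition E F V i j) (jetBaseSet E F V i ∩ jetBaseSet E F V j) := by
  have hg := contMDiffOn_fiberTransition (E := E) (F := F) (V := V) i j
  have hD := contMDiffOn_fiberTransitionDeriv (E := E) (F := F) (V := V) i j
  have hT : ContMDiffOn 𝓘(ℝ, E) 𝓘(ℝ, E →L[ℝ] E) ∞ (tangentCoordChange 𝓘(ℝ, E) j i)
      (jetBaseSet E F V i ∩ jetBaseSet E F V j) := by
    have : (tangentBundleCore 𝓘(ℝ, E) M).IsContMDiff 𝓘(ℝ, E) ∞ :=
      tangentBundleCore.isContMDiff (h := (inferInstance : IsManifold 𝓘(ℝ, E) ∞ M))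
    exact ((tangentBundleCore 𝓘(ℝ, E) M).contMDiffOn_coordChange 𝓘(ℝ, E)
      (achart E j) (achart E i)).mono fun x hx ↦ ⟨hx.2.1, hx.1.1⟩
  have c1 : ContMDiffOn 𝓘(ℝ, E) 𝓘(ℝ, (F × (E →L[ℝ] F)) →L[ℝ] F) ∞
      (fun x ↦ (fiberTransition F V i j x).comp (ContinuousLinearMap.fst ℝ F (E →L[ℝ] F)))
      (jetBaseSet E F V i ∩ jetBaseSet E F V j) := hg.clm_comp contMDiffOn_const
  have c2 : ContMDiffOn 𝓘(ℝ, E) 𝓘(ℝ, (F × (E →L[ℝ] F)) →L[ℝ] E →L[ℝ] F) ∞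
      (fun x ↦ (fiberTransitionDeriv E F V i j x).flip.comp
        (ContinuousLinearMap.fst ℝ F (E →L[ℝ] F)))
      (jetBaseSet E F V i ∩ jetBaseSet E F V j) := by
    refine ContMDiffOn.clm_comp ?_ contMDiffOn_const
    have hf : ContDiff ℝ ∞ (fun L : E →L[ℝ] F →L[ℝ] F ↦ L.flip) := by
      apply IsBoundedLinearMap.contDiff
      refine IsLinearMap.with_bound ⟨fun _ _ ↦ rfl, fun _ _ ↦ rfl⟩ 1 fun L ↦ ?_
      simp
    exact hf.contMDiff.comp_contMDiffOn hD
  have c3 : ContMDiffOn 𝓘(ℝ, E) 𝓘(ℝ, (F × (E →L[ℝ] F)) →L[ℝ] E →L[ℝ] F) ∞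
      (fun x ↦ (((fiberTransition F V i j x).postcomp E).comp
        ((tangentCoordChange 𝓘(ℝ, E) j i x).precomp F)).comp
          (ContinuousLinearMap.snd ℝ F (E →L[ℝ] F)))
      (jetBaseSet E F V i ∩ jetBaseSet E F V j) := by
    refine ContMDiffOn.clm_comp (ContMDiffOn.clm_comp ?_ ?_) contMDiffOn_const
    · exact hg.clm_postcomp
    · exact hT.clm_precomp
  have c := (contMDiffOn_const (c := ContinuousLinearMap.inl ℝ F (E →L[ℝ] F))).clm_comp c1 |>.add
    ((contMDiffOn_const (c := ContinuousLinearMap.inr ℝ F (E →L[ℝ] F))).clm_comp (c2.add c3))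
  refine c.congr fun x _ ↦ ?_
  ext v <;> simp [jetTransition]

theorem fiberTransition_comp {i j k x : M} (hi : x ∈ jetBaseSet E F V i)
    (hj : x ∈ jetBaseSet E F V j) (hk : x ∈ jetBaseSet E F V k) :
    (fiberTransition F V j k x).comp (fiberTransition F V i j x) = fiberTransition F V i k x := by
  ext v
  simp only [fiberTransition, ContinuousLinearMap.comp_apply, ContinuousLinearEquiv.coe_coe]
  rw [Trivialization.coordChangeL_apply _ _ ⟨hi.2, hj.2⟩,
    Trivialization.coordChangeL_apply _ _ ⟨hj.2, hk.2⟩,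
    Trivialization.coordChangeL_apply _ _ ⟨hi.2, hk.2⟩,
    Trivialization.symm_apply_apply_mk _ hj.2]

theorem fiberTransition_self {i x : M} (hi : x ∈ jetBaseSet E F V i) :
    fiberTransition F V i i x = ContinuousLinearMap.id ℝ F := by
  ext v
  simp only [fiberTransition, ContinuousLinearEquiv.coe_coe]
  rw [Trivialization.coordChangeL_apply _ _ ⟨hi.2, hi.2⟩, Trivialization.apply_mk_symm _ hi.2]
  rfl

variable (E F V) in
/-- The first jet bundle of the vector bundle `V`, as a vector bundle over `M`. -/
def jetBundleCore : VectorBundleCore ℝ M (F × (E →L[ℝ] F)) M where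
  baseSet := jetBaseSet E F V
  isOpen_baseSet := isOpen_jetBaseSet
  indexAt x := x
  mem_baseSet_at x := ⟨mem_chart_source E x, mem_baseSet_trivializationAt F V x⟩
  coordChange := jetTransition E F V
  coordChange_self i x hx v := by
    obtain ⟨u, L⟩ := v
    have h1 : fiberTransitionDeriv E F V i i x = 0 := by
      have : (fun y : E ↦ fiberTransition F V i i ((chartAt E i).symm y))
          =ᶠ[𝓝 (chartAt E i x)] fun _ ↦ ContinuousLinearMap.id ℝ F := by
        have hc : ContinuousAt (chartAt E i).symm (chartAt E i x) :=
          (chartAt E i).continuousAt_symm ((chartAt E i).map_source hx.1)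
        have := hc.preimage_mem_nhds (t := jetBaseSet E F V i) (by
          rw [(chartAt E i).left_inv hx.1]; exact (isOpen_jetBaseSet i).mem_nhds hx)
        filter_upwards [this] with y hy
        exact fiberTransition_self hy
      rw [fiberTransitionDeriv, this.fderiv_eq]
      simp
    have h2 : tangentCoordChange 𝓘(ℝ, E) i i x = ContinuousLinearMap.id ℝ E := by
      ext v
      exact tangentCoordChange_self (by simpa using hx.1)
    rw [jetTransition_apply, h1, h2, fiberTransition_self hx]
    ext <;> simp
  continuousOn_coordChange i j := (contMDiffOn_jetTransition i j).continuousOn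
  coordChange_comp := by
    rintro i j k x ⟨⟨hi, hj⟩, hk⟩ ⟨u, L⟩
    have hτ : HasFDerivAt (chartAt E j ∘ (chartAt E k).symm) (tangentCoordChange 𝓘(ℝ, E) k j x)
        (chartAt E k x) := by
      have := hasFDerivWithinAt_tangentCoordChange (I := 𝓘(ℝ, E)) (x := k) (y := j) (z := x)
        (by simpa using ⟨hk.1, hj.1⟩)
      simpa using this
    have hττ : (tangentCoordChange 𝓘(ℝ, E) j i x).comp (tangentCoordChange 𝓘(ℝ, E) k j x) =
        tangentCoordChange 𝓘(ℝ, E) k i x := by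
      ext v
      exact tangentCoordChange_comp (by simpa using ⟨⟨hk.1, hj.1⟩, hi.1⟩)
    have hc : ContinuousAt (chartAt E k).symm (chartAt E k x) :=
      (chartAt E k).continuousAt_symm ((chartAt E k).map_source hk.1)
    have hn := hc.preimage_mem_nhds
      (t := jetBaseSet E F V i ∩ jetBaseSet E F V j ∩ jetBaseSet E F V k) (by
        rw [(chartAt E k).left_inv hk.1]
        exact (((isOpen_jetBaseSet i).inter (isOpen_jetBaseSet j)).inter
          (isOpen_jetBaseSet k)).mem_nhds ⟨⟨hi, hj⟩, hk⟩)
    have hD : fiberTransitionDeriv E F V i k x =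
        ((ContinuousLinearMap.compL ℝ F F F).flip (fiberTransition F V i j x)).comp
          (fiberTransitionDeriv E F V j k x) +
        (ContinuousLinearMap.compL ℝ F F F (fiberTransition F V j k x)).comp
          ((fiberTransitionDeriv E F V i j x).comp (tangentCoordChange 𝓘(ℝ, E) k j x)) := by
      have hA : HasFDerivAt (fun y : E ↦ fiberTransition F V j k ((chartAt E k).symm y))
          (fiberTransitionDeriv E F V j k x) (chartAt E k x) :=
        ((contDiffAt_fiberTransition_chart hj hk hk).differentiableAt (by simp)).hasFDerivAt
      have hB0 : HasFDerivAt (fun y : E ↦ fiberTransition F V i j ((chartAt E j).symm y))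
          (fiberTransitionDeriv E F V i j x) ((chartAt E j ∘ (chartAt E k).symm) (chartAt E k x)) := by
        rw [Function.comp_apply, (chartAt E k).left_inv hk.1]
        exact ((contDiffAt_fiberTransition_chart hi hj hj).differentiableAt (by simp)).hasFDerivAt
      have hB := hB0.comp _ hτ
      have hC := hA.clm_comp hB
      rw [fiberTransitionDeriv]
      have hE : (fun y : E ↦ fiberTransition F V i k ((chartAt E k).symm y)) =ᶠ[𝓝 (chartAt E k x)]
          fun y ↦ (fiberTransition F V j k ((chartAt E k).symm y)).comp
            (((fun y : E ↦ fiberTransition F V i j ((chartAt E j).symm y)) ∘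
              (chartAt E j ∘ (chartAt E k).symm)) y) := by
        filter_upwards [hn] with y hy
        simp only [Function.comp_apply]
        rw [(chartAt E j).left_inv hy.1.2.1, fiberTransition_comp hy.1.1 hy.1.2 hy.2]
      rw [hE.fderiv_eq, hC.fderiv]
      simp only [Function.comp_apply, (chartAt E k).left_inv hk.1, (chartAt E j).left_inv hj.1]
      rw [add_comm]
    rw [jetTransition_apply, jetTransition_apply, jetTransition_apply, ← hττ, hD,
      ← fiberTransition_comp hi hj hk]
    ext <;> simp [add_assoc]


instance jetBundleCore_isContMDiff : (jetBundleCore E F V).IsContMDiff 𝓘(ℝ, E) ∞ :=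
  ⟨contMDiffOn_jetTransition⟩

end JetBundle

noncomputable section JetSpace

/-- The fibre at `x` of the first jet bundle `JV → M` of a vector bundle `V → M`. As for
`TangentSpace`, the fibre is identified with its model by means of the preferred chart and the
preferred trivialization at `x`; the bundle structure is that of `jetBundleCore`. -/
def JetSpace (E : Type*) [NormedAddCommGroup E] [NormedSpace ℝ E] {M : Type*}
    (F : Type*) [NormedAddCommGroup F] [NormedSpace ℝ F] (_V : M → Type*) (_x : M) : Type _ :=
  F × (E →L[ℝ] F)

section FiberInstances

variable {E : Type*} [NormedAddCommGroup E] [NormedSpace ℝ E] {M : Type*}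
  {F : Type*} [NormedAddCommGroup F] [NormedSpace ℝ F] {V : M → Type*} {x : M}

instance JetSpace.addCommGroup : AddCommGroup (JetSpace E F V x) :=
  inferInstanceAs (AddCommGroup (F × (E →L[ℝ] F)))

instance JetSpace.module : Module ℝ (JetSpace E F V x) :=
  inferInstanceAs (Module ℝ (F × (E →L[ℝ] F)))

instance JetSpace.topologicalSpace : TopologicalSpace (JetSpace E F V x) :=
  inferInstanceAs (TopologicalSpace (F × (E →L[ℝ] F)))

instance JetSpace.isTopologicalAddGroup : IsTopologicalAddGroup (JetSpace E F V x) :=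
  inferInstanceAs (IsTopologicalAddGroup (F × (E →L[ℝ] F)))

instance JetSpace.continuousSMul : ContinuousSMul ℝ (JetSpace E F V x) :=
  inferInstanceAs (ContinuousSMul ℝ (F × (E →L[ℝ] F)))

end FiberInstances

variable {E : Type*} [NormedAddCommGroup E] [NormedSpace ℝ E]
  {M : Type*} [TopologicalSpace M] [ChartedSpace E M] [IsManifold 𝓘(ℝ, E) ∞ M]
  {F : Type*} [NormedAddCommGroup F] [NormedSpace ℝ F]
  {V : M → Type*} [TopologicalSpace (TotalSpace F V)]
  [∀ x, AddCommGroup (V x)] [∀ x, Module ℝ (V x)] [∀ x, TopologicalSpace (V x)]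
  [FiberBundle F V] [VectorBundle ℝ F V] [ContMDiffVectorBundle ∞ F V 𝓘(ℝ, E)]

instance JetSpace.topologicalSpaceTotalSpace :
    TopologicalSpace (TotalSpace (F × (E →L[ℝ] F)) (JetSpace E F V)) :=
  inferInstanceAs (TopologicalSpace (jetBundleCore E F V).TotalSpace)

instance JetSpace.fiberBundle : FiberBundle (F × (E →L[ℝ] F)) (JetSpace E F V) :=
  inferInstanceAs (FiberBundle (F × (E →L[ℝ] F)) (jetBundleCore E F V).Fiber)

instance JetSpace.vectorBundle : VectorBundle ℝ (F × (E →L[ℝ] F)) (JetSpace E F V) :=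
  inferInstanceAs (VectorBundle ℝ (F × (E →L[ℝ] F)) (jetBundleCore E F V).Fiber)

instance JetSpace.contMDiffVectorBundle :
    ContMDiffVectorBundle ∞ (F × (E →L[ℝ] F)) (JetSpace E F V) 𝓘(ℝ, E) :=
  inferInstanceAs (ContMDiffVectorBundle ∞ (F × (E →L[ℝ] F)) (jetBundleCore E F V).Fiber 𝓘(ℝ, E))

end JetSpace

noncomputable section Jets

variable {E : Type*} [NormedAddCommGroup E] [NormedSpace ℝ E]
  {M : Type*} [TopologicalSpace M] [ChartedSpace E M] [IsManifold 𝓘(ℝ, E) ∞ M]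
  {F : Type*} [NormedAddCommGroup F] [NormedSpace ℝ F]
  {V : M → Type*} [TopologicalSpace (TotalSpace F V)]
  [∀ x, AddCommGroup (V x)] [∀ x, Module ℝ (V x)] [∀ x, TopologicalSpace (V x)]
  [FiberBundle F V] [VectorBundle ℝ F V] [ContMDiffVectorBundle ∞ F V 𝓘(ℝ, E)]
  {F' : Type*} [NormedAddCommGroup F'] [NormedSpace ℝ F']
  {W : M → Type*} [TopologicalSpace (TotalSpace F' W)]
  [∀ x, AddCommGroup (W x)] [∀ x, Module ℝ (W x)] [∀ x, TopologicalSpace (W x)]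
  [FiberBundle F' W] [VectorBundle ℝ F' W] [ContMDiffVectorBundle ∞ F' W 𝓘(ℝ, E)]

variable (E F) in
/-- The first jet at `x` of a section `s`: its value and its derivative at `x`. -/
def jet (s : ∀ y, V y) (x : M) : JetSpace E F V x :=
  let f : E → F := fun z ↦
    (trivializationAt F V x ⟨(chartAt E x).symm z, s ((chartAt E x).symm z)⟩).2
  (f (chartAt E x x), fderiv ℝ f (chartAt E x x))

/-- A local section near `x` whose first jet at `x` is `j`, see `jet_rep`. -/
def JetSpace.rep {x : M} (j : JetSpace E F V x) (y : M) : V y :=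
  (trivializationAt F V x).symmL ℝ y (j.1 + j.2 (chartAt E x y - chartAt E x x))

/-- The projection `JV → V`, which takes the jet of a section to the value of the section. -/
def JetSpace.proj {x : M} (j : JetSpace E F V x) : V x :=
  (trivializationAt F V x).symmL ℝ x j.1

/-- The identification of the jets that project to `0` with `T*M ⊗ V`
(used only for jets that project to `0`). -/
def JetSpace.vert {x : M} (j : JetSpace E F V x) : TangentSpace 𝓘(ℝ, E) x →L[ℝ] V x :=
  ((trivializationAt F V x).symmL ℝ x).comp j.2

theorem jet_rep {x : M} (j : JetSpace E F V x) : jet E F j.rep x = j := by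
  have hx := mem_baseSet_trivializationAt F V x
  have hc : ContinuousAt (chartAt E x).symm (chartAt E x x) :=
    (chartAt E x).continuousAt_symm ((chartAt E x).map_source (mem_chart_source E x))
  have h : (fun z ↦ (trivializationAt F V x ⟨(chartAt E x).symm z, j.rep ((chartAt E x).symm z)⟩).2)
      =ᶠ[𝓝 (chartAt E x x)] fun z ↦ j.1 + j.2 (z - chartAt E x x) := by
    filter_upwards [hc.preimage_mem_nhds (t := (trivializationAt F V x).baseSet) (by
      rw [(chartAt E x).left_inv (mem_chart_source E x)]
      exact (trivializationAt F V x).open_baseSet.mem_nhds hx),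
      (chartAt E x).open_target.mem_nhds ((chartAt E x).map_source (mem_chart_source E x))]
      with z hz hz'
    rw [JetSpace.rep, Trivialization.symmL_apply _ hz, Trivialization.apply_mk_symm _ hz, (chartAt E x).right_inv hz']
  have h' : HasFDerivAt (fun z ↦ j.1 + j.2 (z - chartAt E x x)) j.2 (chartAt E x x) :=
    (j.2.hasFDerivAt.comp _ ((hasFDerivAt_id _).sub_const _)).const_add _
  refine Prod.ext ?_ ?_
  · exact h.eq_of_nhds.trans (by simp)
  · exact h.fderiv_eq.trans h'.fderiv

theorem jet_proj (s : ∀ y, V y) (x : M) : (jet E F s x).proj = s x := by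
  simp only [JetSpace.proj, jet]
  rw [Trivialization.symmL_apply _ (mem_baseSet_trivializationAt F V x), (chartAt E x).left_inv (mem_chart_source E x)]
  exact Trivialization.symm_apply_apply_mk _ (mem_baseSet_trivializationAt F V x) _

/-- The first jet prolongation `JΦ : JV → JW` of a fibre bundle morphism `Φ : V → W` over `M`. -/
def jetMap (Φ : ∀ x, V x → W x) {x : M} (j : JetSpace E F V x) : JetSpace E F' W x :=
  jet E F' (fun y ↦ Φ y (j.rep y)) x

/-- The jets of the sections of the subbundle `C` of `V`. -/
def jetsIn (C : ∀ x, Set (V x)) (x : M) : Set (JetSpace E F V x) :=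
  {j | ∃ s : ∀ y, V y, ContMDiffAt 𝓘(ℝ, E) (𝓘(ℝ, E).prod 𝓘(ℝ, F)) ∞
      (fun y ↦ TotalSpace.mk' F y (s y)) x ∧ (∀ᶠ y in 𝓝 x, s y ∈ C y) ∧ jet E F s x = j}

/-- A connection of `V → M`: a smooth section `V → JV`. -/
structure IsConnection (k : ∀ x, V x → JetSpace E F V x) : Prop where
  proj : ∀ x v, (k x v).proj = v
  smooth : ContMDiff (𝓘(ℝ, E).prod 𝓘(ℝ, F)) (𝓘(ℝ, E).prod 𝓘(ℝ, F × (E →L[ℝ] F))) ∞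
    fun v : TotalSpace F V ↦ TotalSpace.mk' (F × (E →L[ℝ] F)) v.proj (k v.proj v.snd)

/-- A linear connection of `V → M`: a connection that is a linear morphism over `M`. -/
structure IsLinearConnection (k : ∀ x, V x → JetSpace E F V x) : Prop extends IsConnection k where
  linear : ∀ x, IsLinearMap ℝ (k x)

/-- The restriction of `k` to the affine subbundle `C` of `V` is an affine connection of `C`: it
is a smooth section `C → JC` of the projection `JC → C` which is an affine morphism over `M`. -/
structure IsReducibleToAffineConnection (C : ∀ x, AffineSubspace ℝ (V x))
    (k : ∀ x, V x → JetSpace E F V x) : Prop where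
  proj : ∀ x, ∀ v ∈ C x, (k x v).proj = v
  mem_jetsIn : ∀ x, ∀ v ∈ C x, k x v ∈ jetsIn (fun y ↦ (C y : Set (V y))) x
  smoothOn : ContMDiffOn (𝓘(ℝ, E).prod 𝓘(ℝ, F)) (𝓘(ℝ, E).prod 𝓘(ℝ, F × (E →L[ℝ] F))) ∞
    (fun v : TotalSpace F V ↦ TotalSpace.mk' (F × (E →L[ℝ] F)) v.proj (k v.proj v.snd))
    {v | v.snd ∈ C v.proj}
  affine : ∀ x, ∀ v ∈ C x, ∀ w ∈ C x, ∀ t : ℝ,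
    k x (AffineMap.lineMap v w t) = AffineMap.lineMap (k x v) (k x w) t

/-- The covariant derivative `∇s = js - k ∘ s` of a section `s`, a section of `T*M ⊗ V`. -/
def covDeriv (k : ∀ x, V x → JetSpace E F V x) (s : ∀ y, V y) (x : M) :
    TangentSpace 𝓘(ℝ, E) x →L[ℝ] V x :=
  (jet E F s x - k x (s x)).vert

/-- The curvature `R(X, Y) s = ∇_X ∇_Y s - ∇_Y ∇_X s - ∇_[X, Y] s` of a linear connection. -/
def curvature (k : ∀ x, V x → JetSpace E F V x) (X Y : ∀ y : M, TangentSpace 𝓘(ℝ, E) y)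
    (s : ∀ y, V y) (x : M) : V x :=
  covDeriv k (fun y ↦ covDeriv k s y (Y y)) x (X x)
    - covDeriv k (fun y ↦ covDeriv k s y (X y)) x (Y x)
    - covDeriv k s x (VectorField.mlieBracket 𝓘(ℝ, E) X Y x)

/-- The exchange map `s_Γ : JJV → JJV`. In the coordinates `(y^i, y₁^i_a ; y₂^i_a, y₁₂^i_ab)` of
`JJV`, where `y₁^i_a` are the coordinates of the point of `JV` and `(y₂^i_b, y₁₂^i_ab)` the
derivatives of `(y^i, y₁^i_a)` in the direction `b`, it is
`(y, y₁ ; y₂, y₁₂) ↦ (y, y₂ ; y₁, y₁₂^i_ba + Γ_b^c_a (y₁^i_c - y₂^i_c))`,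
where `Γ_b^c_a` is the derivative coordinate in the direction `b` of the `c`-th component of
`Γ (∂_a)`. -/
def jetExchange
    (Γ : ∀ x : M, TangentSpace 𝓘(ℝ, E) x →L[ℝ] JetSpace E E (TangentSpace 𝓘(ℝ, E) : M → Type _) x)
    {x : M} (j : JetSpace E (F × (E →L[ℝ] F)) (JetSpace E F V) x) :
    JetSpace E (F × (E →L[ℝ] F)) (JetSpace E F V) x :=
  let y : F := j.1.1
  let y₁ : E →L[ℝ] F := j.1.2
  let y₂ : E →L[ℝ] F := (ContinuousLinearMap.fst ℝ F (E →L[ℝ] F)).comp j.2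
  let y₁₂ : E →L[ℝ] E →L[ℝ] F := (ContinuousLinearMap.snd ℝ F (E →L[ℝ] F)).comp j.2
  let G : E →L[ℝ] E →L[ℝ] E := (ContinuousLinearMap.snd ℝ E (E →L[ℝ] E)).comp (Γ x)
  ((y, y₂), y₁.prod (y₁₂.flip + ((y₁ - y₂).postcomp E).comp G.flip))

/-- The prolongation `κ' = s_Γ ∘ Jκ : JV → JJV` of a connection `κ` of `V`. -/
def prolongConnection
    (Γ : ∀ x : M, TangentSpace 𝓘(ℝ, E) x →L[ℝ] JetSpace E E (TangentSpace 𝓘(ℝ, E) : M → Type _) x)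
    (κ : ∀ x, V x → JetSpace E F V x) (x : M) (j : JetSpace E F V x) :
    JetSpace E (F × (E →L[ℝ] F)) (JetSpace E F V) x :=
  jetExchange Γ (jetMap κ j)

/-- The dual connection `κ*` of the dual bundle `V* = Hom (V, ℝ)`: a section of `V*` with value `α`
at `x` is parallel at `x` if the derivative of its pairing with each section of `V` that is parallel
at `x` vanishes. In coordinates, `κ*_aj^i = - κ_a^i_j`. -/
def dualConnection (κ : ∀ x, V x →L[ℝ] JetSpace E F V x) (x : M) (α : V x →L[ℝ] Trivial M ℝ x) :
    JetSpace E (F →L[ℝ] ℝ) (fun y ↦ V y →L[ℝ] Trivial M ℝ y) x :=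
  let a : F →L[ℝ] ℝ := α.comp ((trivializationAt F V x).symmL ℝ x)
  let K : F →L[ℝ] E →L[ℝ] F :=
    (ContinuousLinearMap.snd ℝ F (E →L[ℝ] F)).comp ((κ x).comp ((trivializationAt F V x).symmL ℝ x))
  (a, -((a.postcomp F).comp K.flip))

variable [FiniteDimensional ℝ F] [∀ x, IsTopologicalAddGroup (W x)] [∀ x, ContinuousSMul ℝ (W x)]

/-- The jet of `t ⊗ α` for (the jets of) sections `t` of `W` and `α` of `V*`;
here `W ⊗ V*` is `Hom (V, W)`, and `t ⊗ α` is `v ↦ α (v) t`. -/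
def jetTensor {x : M} (t : JetSpace E F' W x)
    (α : JetSpace E (F →L[ℝ] ℝ) (fun y ↦ V y →L[ℝ] Trivial M ℝ y) x) :
    JetSpace E (F →L[ℝ] F') (fun y ↦ V y →L[ℝ] W y) x :=
  jet E (F →L[ℝ] F') (fun y ↦ (α.rep y).smulRight (t.rep y)) x

/-- The tensor product connection `l ⊗ m` of `W ⊗ V* = Hom (V, W)` of linear connections `l` of `W`
and `m` of `V*`: the linear extension of `t ⊗ α ↦ l (t) ⊗ m (α)`, where `A : V_x → W_x` is expanded
as the sum of `A (b_i) ⊗ b^i` for a basis `b` of `V_x` with dual basis `b^i`. -/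
def tensorConnection (l : ∀ x, W x → JetSpace E F' W x)
    (m : ∀ x, (V x →L[ℝ] Trivial M ℝ x) →
      JetSpace E (F →L[ℝ] ℝ) (fun y ↦ V y →L[ℝ] Trivial M ℝ y) x)
    (x : M) (A : V x →L[ℝ] W x) : JetSpace E (F →L[ℝ] F') (fun y ↦ V y →L[ℝ] W y) x :=
  let b := Module.finBasis ℝ F
  let e := trivializationAt F V x
  ∑ i, jetTensor (l x (A (e.symmL ℝ x (b i))))
    (m x ((LinearMap.toContinuousLinearMap (b.coord i)).comp (e.continuousLinearMapAt ℝ x)))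

/-- The connection `κ' ⊗ κ*` of `JV ⊗ V* = Hom (V, JV)`. -/
def overconnection
    (Γ : ∀ x : M, TangentSpace 𝓘(ℝ, E) x →L[ℝ] JetSpace E E (TangentSpace 𝓘(ℝ, E) : M → Type _) x)
    (κ : ∀ x, V x →L[ℝ] JetSpace E F V x) (x : M) (A : V x →L[ℝ] JetSpace E F V x) :
    JetSpace E (F →L[ℝ] F × (E →L[ℝ] F)) (fun y ↦ V y →L[ℝ] JetSpace E F V y) x :=
  tensorConnection (prolongConnection Γ (fun y v ↦ κ y v)) (dualConnection κ) x A

variable (E F V) in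
/-- The bundle of linear connections `C ⊂ JV ⊗ V* = Hom (V, JV)` of `V`: the affine subbundle of
the elements that project to the identity of `V`. Its smooth sections are the linear connections. -/
def connectionBundle (x : M) : AffineSubspace ℝ (V x →L[ℝ] JetSpace E F V x) where
  carrier := {A | ∀ v, (A v).proj = v}
  smul_vsub_vadd_mem' := by
    intro c A B C hA hB hC v
    have h : (trivializationAt F V x).symmL ℝ x (c • ((A v).1 - (B v).1) + (C v).1) = v := by
      have hA' : (trivializationAt F V x).symmL ℝ x (A v).1 = v := hA v
      have hB' : (trivializationAt F V x).symmL ℝ x (B v).1 = v := hB v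
      have hC' : (trivializationAt F V x).symmL ℝ x (C v).1 = v := hC v
      rw [map_add, map_smul, map_sub, hA', hB', hC']
      simp
    exact h

end Jets

noncomputable section Coordinates

variable {E : Type*} [NormedAddCommGroup E] [NormedSpace ℝ E]
  {M : Type*} [TopologicalSpace M] [ChartedSpace E M] [IsManifold 𝓘(ℝ, E) ∞ M]
  {F : Type*} [NormedAddCommGroup F] [NormedSpace ℝ F]
  {V : M → Type*} [TopologicalSpace (TotalSpace F V)]
  [∀ x, AddCommGroup (V x)] [∀ x, Module ℝ (V x)] [∀ x, TopologicalSpace (V x)]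
  [FiberBundle F V] [VectorBundle ℝ F V] [ContMDiffVectorBundle ∞ F V 𝓘(ℝ, E)]

/-- The partial derivative of `f` at `x` in the chart `φ`, in the direction `e` of the model
space; for `e = e_a` in a basis of the model space, this is `∂_a f (x)`. -/
def coordDeriv (φ : OpenPartialHomeomorph M E) (e : E) (f : M → ℝ) (x : M) : ℝ :=
  fderiv ℝ (fun z ↦ f (φ.symm z)) (φ x) e

/-- The coordinate vector field with components `e` in the chart `φ`. -/
def coordVector (φ : OpenPartialHomeomorph M E) (e : E) (x : M) : TangentSpace 𝓘(ℝ, E) x :=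
  (mfderiv 𝓘(ℝ, E) 𝓘(ℝ, E) φ x).inverse e

/-- The coordinate of `JV` induced by a coordinate function `f` on the fibres of `V`: it takes
the jet of a section `s` at `x` to `∂_a (f ∘ s) (x)`, where `e = e_a`. -/
def jetCoord (φ : OpenPartialHomeomorph M E) (e : E) (f : ∀ y, V y → ℝ) {x : M}
    (j : JetSpace E F V x) : ℝ :=
  coordDeriv φ e (fun y ↦ f y (j.rep y)) x

/-- The coordinate `y^i_aj` on `JV ⊗ V* = Hom (V, JV)`, where `e = e_a`, induced by the chart `φ`
and the linear fibre coordinates of the local frame `s`. For a linear connection `κ`, regarded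
as a section of `JV ⊗ V*`, its value at `κ (x)` is the component `κ_a^i_j (x)`. -/
def connCoord (φ : OpenPartialHomeomorph M E) (e : E) {ι : Type*} {s : ι → ∀ y, V y} {u : Set M}
    (hs : IsLocalFrameOn 𝓘(ℝ, E) F ∞ s u) (i j : ι) {x : M} (A : V x →L[ℝ] JetSpace E F V x) : ℝ :=
  jetCoord φ e (fun y v ↦ hs.coeff i y v) (A (s j x))

/-- The component `Γ_a^c_b (x)` of a linear connection `Γ` of `TM`. -/
def tangentConnCoeff (φ : OpenPartialHomeomorph M E) {β : Type*} (e : Module.Basis β ℝ E)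
    (Γ : ∀ x : M, TangentSpace 𝓘(ℝ, E) x →L[ℝ] JetSpace E E (TangentSpace 𝓘(ℝ, E) : M → Type _) x)
    (a c b : β) (x : M) : ℝ :=
  jetCoord φ (e a)
    (fun y (w : TangentSpace 𝓘(ℝ, E) y) ↦ e.repr (mfderiv 𝓘(ℝ, E) 𝓘(ℝ, E) φ y w : E) c)
    (Γ x (coordVector φ (e b) x))

end Coordinates

/-! A linear connection is determined by its coefficients in linear fibred coordinates, so each
construction is computed in arbitrary coordinates. Write K for the coefficients of κ, D for their
derivatives, C for the coefficients of Γ.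

In coordinates, Jκ sends a jet (y; y_a) to (y, K y; y_a, D y + K y_a). It lies over the jet κ(y)
instead of over the given jet, so it is not a connection of JE. The exchange map swaps the two
first-order slots and repairs this. A bare swap with transposition of the second-order slot would
not be invariant: under a change of chart τ, the second derivative D²τ acts on one first-order slot
before the swap and on the other one after it. The discrepancy is D²τ applied to the difference of
the two slots, and this is what the inhomogeneous term in the transformation law of Γ cancels
(`exchangeModel_jetReadAt`, `tangentConnection_transform`). Hence the coefficients of κ' have the
same form Λ in all coordinates (`jetFiberMap_prolongConnection`).

The dual connection has coefficients minus the transpose of K, because pairings of parallel sections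
have zero derivative (`jetFiberMap_dualConnection`). The Leibniz rule then gives κ' ⊗ κ* on T : V →
JV as Λ T - T K (`jetFiberMap_tensorConnection`).

The elements of C are the maps T u = (u, S u). On them the first component of Λ T - T K is K - K =
0, so the connection is tangent to C (`overconnection_mem_jetsIn`); affineness is inherited from
linearity. The second component, expanded in bases, is the stated formula
(`tensorCoeff_prolongCoeff_single`).

For the section κ itself S = K, so the Γ term acts on K - K = 0 and drops out. What is left of the
covariant derivative is an antisymmetrised derivative of K and a commutator
(`sub_tensorCoeff_prolongCoeff`). The commutator of covariant derivatives yields the same expression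
with the opposite sign (`model_curvature`).

The bookkeeping rests on `jetFiberMap φ L`. A jet at x is stored in the preferred coordinates at x,
and this map reads it in the chart φ and the fibre coordinates L. It is again a smooth family of
linear fibre maps, so it can be iterated to read JJV. Most coordinate formulas follow by
differentiating one function along a local section with the given jet and using uniqueness of the
derivative. -/

section

set_option maxSynthPendingDepth 5

/-! ### Coordinate changes of first and second jets, and the exchange map in a vector space -/

noncomputable section Calculus

variable {E F G : Type*} [NormedAddCommGroup E] [NormedSpace ℝ E]
  [NormedAddCommGroup F] [NormedSpace ℝ F] [NormedAddCommGroup G] [NormedSpace ℝ G]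

/-- The action on first jets at `z` of `u ↦ A · (u ∘ τ)`. -/
def jetReadAt (A : E → F →L[ℝ] G) (τ : E → E) (z : E) :
    (F × (E →L[ℝ] F)) →L[ℝ] (G × (E →L[ℝ] G)) :=
  ((A z).comp (ContinuousLinearMap.fst ℝ F (E →L[ℝ] F))).prod
    ((fderiv ℝ A z).flip.comp (ContinuousLinearMap.fst ℝ F (E →L[ℝ] F)) +
      (((A z).postcomp E).comp ((fderiv ℝ τ z).precomp F)).comp
        (ContinuousLinearMap.snd ℝ F (E →L[ℝ] F)))

theorem jetReadAt_fst (A : E → F →L[ℝ] G) (τ : E → E) (z : E) (p : F × (E →L[ℝ] F)) :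
    (jetReadAt A τ z p).1 = A z p.1 := rfl

theorem jetReadAt_snd (A : E → F →L[ℝ] G) (τ : E → E) (z : E) (p : F × (E →L[ℝ] F)) (w : E) :
    (jetReadAt A τ z p).2 w = fderiv ℝ A z w p.1 + A z (p.2 (fderiv ℝ τ z w)) := rfl

theorem jetReadAt_congr {A B : E → F →L[ℝ] G} {τ υ : E → E} {z : E} (h : A =ᶠ[𝓝 z] B)
    (h' : τ =ᶠ[𝓝 z] υ) : jetReadAt A τ z = jetReadAt B υ z := by
  rw [jetReadAt, jetReadAt, h.eq_of_nhds, h.fderiv_eq, h'.fderiv_eq]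

/-- Product rule and chain rule; this justifies the form of `jetReadAt`. Differentiability of `u` is
needed at the one point only. -/
theorem hasFDerivAt_jetReadAt {A : E → F →L[ℝ] G} {τ : E → E} {z : E} {u : E → F}
    {u' : E →L[ℝ] F} (hA : DifferentiableAt ℝ A z) (hτ : DifferentiableAt ℝ τ z)
    (hu : HasFDerivAt u u' (τ z)) :
    HasFDerivAt (fun y ↦ A y (u (τ y))) (jetReadAt A τ z (u (τ z), u')).2 z := by
  refine (hA.hasFDerivAt.clm_apply (hu.comp z hτ.hasFDerivAt)).congr_fderiv ?_
  ext w
  simp [jetReadAt_snd, add_comm]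

theorem contDiff_clm_flip : ContDiff ℝ ∞ (fun T : E →L[ℝ] F →L[ℝ] G ↦ T.flip) := by
  apply IsBoundedLinearMap.contDiff
  refine IsLinearMap.with_bound ⟨fun _ _ ↦ rfl, fun _ _ ↦ rfl⟩ 1 fun T ↦ ?_
  simp

theorem contDiffAt_jetReadAt {A : E → F →L[ℝ] G} {τ : E → E} {z : E} (hA : ContDiffAt ℝ ∞ A z)
    (hτ : ContDiffAt ℝ ∞ τ z) : ContDiffAt ℝ ∞ (jetReadAt A τ) z := by
  have hA' : ContDiffAt ℝ ∞ (fderiv ℝ A) z := hA.fderiv_right le_rfl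
  have hτ' : ContDiffAt ℝ ∞ (fderiv ℝ τ) z := hτ.fderiv_right le_rfl
  have c1 : ContDiffAt ℝ ∞ (fun y ↦ (A y).comp (ContinuousLinearMap.fst ℝ F (E →L[ℝ] F))) z :=
    hA.clm_comp contDiffAt_const
  have c2 : ContDiffAt ℝ ∞ (fun y ↦ (fderiv ℝ A y).flip.comp
      (ContinuousLinearMap.fst ℝ F (E →L[ℝ] F))) z :=
    (contDiff_clm_flip.contDiffAt.comp z hA').clm_comp contDiffAt_const
  have c3 : ContDiffAt ℝ ∞ (fun y ↦ (A y).postcomp E) z :=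
    hA.contMDiffAt.clm_postcomp.contDiffAt
  have c4 : ContDiffAt ℝ ∞ (fun y ↦ (fderiv ℝ τ y).precomp F) z :=
    hτ'.contMDiffAt.clm_precomp.contDiffAt
  -- A map into a product is written as inl ∘ (first part) + inr ∘ (second part), so that smoothness
  -- follows from that of compositions and sums.
  have c := (contDiffAt_const (c := ContinuousLinearMap.inl ℝ G (E →L[ℝ] G))).clm_comp c1 |>.add
    ((contDiffAt_const (c := ContinuousLinearMap.inr ℝ G (E →L[ℝ] G))).clm_comp
      (c2.add ((c3.clm_comp c4).clm_comp
        (contDiffAt_const (c := ContinuousLinearMap.snd ℝ F (E →L[ℝ] F))))))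
  refine c.congr_of_eventuallyEq (Eventually.of_forall fun y ↦ ?_)
  ext v <;> simp [jetReadAt]

/-- Changing coordinates on JJV means applying `jetReadAt` to the operator field `jetReadAt A τ`,
and so requires its derivative. Evaluation at a fixed `p` and the two projections are linear, hence
each part can be differentiated separately. -/
theorem fderiv_jetReadAt {A : E → F →L[ℝ] G} {τ : E → E} {z : E} (hA : ContDiffAt ℝ ∞ A z)
    (hτ : ContDiffAt ℝ ∞ τ z) (w : E) (p : F × (E →L[ℝ] F)) :
    (fderiv ℝ (jetReadAt A τ) z w p).1 = fderiv ℝ A z w p.1 ∧ ∀ b,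
    (fderiv ℝ (jetReadAt A τ) z w p).2 b = fderiv ℝ (fderiv ℝ A) z w b p.1 +
      fderiv ℝ A z w (p.2 (fderiv ℝ τ z b)) + A z (p.2 (fderiv ℝ (fderiv ℝ τ) z w b)) := by
  have hA0 : DifferentiableAt ℝ A z := hA.differentiableAt (by simp)
  have hA' : DifferentiableAt ℝ (fderiv ℝ A) z :=
    (hA.fderiv_right (m := ∞) le_rfl).differentiableAt (by simp)
  have hτ' : DifferentiableAt ℝ (fderiv ℝ τ) z :=
    (hτ.fderiv_right (m := ∞) le_rfl).differentiableAt (by simp)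
  have hd : DifferentiableAt ℝ (jetReadAt A τ) z :=
    (contDiffAt_jetReadAt hA hτ).differentiableAt (by simp)
  have hp := hd.hasFDerivAt.clm_apply (hasFDerivAt_const p z)
  constructor
  · have h1 := ((ContinuousLinearMap.fst ℝ G (E →L[ℝ] G)).hasFDerivAt.comp z hp).fderiv
    have h2 := (hA0.hasFDerivAt.clm_apply (hasFDerivAt_const p.1 z)).fderiv
    have := DFunLike.congr_fun (h1.symm.trans h2) w
    simpa using this
  · intro b
    have h1 := (((ContinuousLinearMap.apply ℝ G b).comp
      (ContinuousLinearMap.snd ℝ G (E →L[ℝ] G))).hasFDerivAt.comp z hp).fderiv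
    have h2 := (((hA'.hasFDerivAt.clm_apply (hasFDerivAt_const b z)).clm_apply
      (hasFDerivAt_const p.1 z)).add (hA0.hasFDerivAt.clm_apply
        (p.2.hasFDerivAt.comp z (hτ'.hasFDerivAt.clm_apply (hasFDerivAt_const b z))))).fderiv
    have := DFunLike.congr_fun (h1.symm.trans h2) w
    simp only [ContinuousLinearMap.comp_apply, add_apply,
      ContinuousLinearMap.flip_apply, zero_apply, map_zero, zero_add,
      ContinuousLinearMap.apply_apply, ContinuousLinearMap.coe_snd', Function.comp_apply] at this
    rw [this]
    abel

/-- The exchange map in coordinates. -/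
def exchangeModel (Γ : E →L[ℝ] E →L[ℝ] E)
    (p : (F × (E →L[ℝ] F)) × (E →L[ℝ] F × (E →L[ℝ] F))) :
    (F × (E →L[ℝ] F)) × (E →L[ℝ] F × (E →L[ℝ] F)) :=
  let y₂ : E →L[ℝ] F := (ContinuousLinearMap.fst ℝ F (E →L[ℝ] F)).comp p.2
  ((p.1.1, y₂), p.1.2.prod (((ContinuousLinearMap.snd ℝ F (E →L[ℝ] F)).comp p.2).flip +
    ((p.1.2 - y₂).postcomp E).comp Γ.flip))

theorem exchangeModel_snd_snd (Γ : E →L[ℝ] E →L[ℝ] E)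
    (p : (F × (E →L[ℝ] F)) × (E →L[ℝ] F × (E →L[ℝ] F))) (w b : E) :
    ((exchangeModel Γ p).2 w).2 b = (p.2 b).2 w + (p.1.2 (Γ b w) - (p.2 (Γ b w)).1) := rfl

/-- The invariance of the exchange map. The hypothesis `hΓ` is the transformation law of connection
coefficients. The terms in DA merely trade places, while D²τ acts on the slot `p.1.2` on one side
and on the slot y₂ on the other; the inhomogeneous term of `hΓ` accounts for the difference. -/
theorem exchangeModel_jetReadAt {A : E → F →L[ℝ] G} {τ : E → E} {z : E}
    (hA : ContDiffAt ℝ ∞ A z) (hτ : ContDiffAt ℝ ∞ τ z) {Γ Γ' : E →L[ℝ] E →L[ℝ] E}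
    (hΓ : ∀ a b, fderiv ℝ τ z (Γ' b a) =
      Γ (fderiv ℝ τ z b) (fderiv ℝ τ z a) - fderiv ℝ (fderiv ℝ τ) z a b)
    (p : (F × (E →L[ℝ] F)) × (E →L[ℝ] F × (E →L[ℝ] F))) :
    exchangeModel Γ' (jetReadAt (jetReadAt A τ) τ z p) =
      jetReadAt (jetReadAt A τ) τ z (exchangeModel Γ p) := by
  -- The exchange transposes second-order slots, so the second derivatives of A and τ have to be
  -- symmetric.
  have sA : ∀ a b, fderiv ℝ (fderiv ℝ A) z a b = fderiv ℝ (fderiv ℝ A) z b a := fun a b ↦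
    (hA.isSymmSndFDerivAt (by
    rw [minSmoothness_of_isRCLikeNormedField]; exact WithTop.coe_le_coe.2 le_top)) a b
  have sτ : ∀ a b, fderiv ℝ (fderiv ℝ τ) z a b = fderiv ℝ (fderiv ℝ τ) z b a := fun a b ↦
    (hτ.isSymmSndFDerivAt (by
    rw [minSmoothness_of_isRCLikeNormedField]; exact WithTop.coe_le_coe.2 le_top)) a b
  have hD := fderiv_jetReadAt hA hτ
  refine Prod.ext (Prod.ext rfl ?_) ?_
  · ext w
    change ((jetReadAt (jetReadAt A τ) τ z p).2 w).1 = _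
    rw [jetReadAt_snd, Prod.fst_add, (hD w _).1, jetReadAt_fst, jetReadAt_fst, jetReadAt_snd]
    rfl
  · ext w
    · change (jetReadAt (jetReadAt A τ) τ z p).1.2 w = _
      rw [jetReadAt_snd, Prod.fst_add, (hD w _).1, jetReadAt_fst, jetReadAt_fst, jetReadAt_snd]
      rfl
    · rename_i b
      change ((exchangeModel Γ' (jetReadAt (jetReadAt A τ) τ z p)).2 w).2 b =
        ((jetReadAt (jetReadAt A τ) τ z (exchangeModel Γ p)).2 w).2 b
      rw [exchangeModel_snd_snd]
      simp only [jetReadAt_snd, jetReadAt_fst, Prod.fst_add, Prod.snd_add, (hD _ _).1, (hD _ _).2,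
        add_apply, hΓ, exchangeModel_snd_snd, map_sub, map_add, Prod.fst_sub]
      simp only [exchangeModel, ContinuousLinearMap.prod_apply, ContinuousLinearMap.comp_apply,
        ContinuousLinearMap.coe_fst', sA w b, sτ w b]
      abel

end Calculus

/-! ### Smooth linear fibre coordinates and the coordinates they induce on the jet bundle -/

noncomputable section FiberCoordinates

variable {E : Type*} [NormedAddCommGroup E] [NormedSpace ℝ E]
  {M : Type*} [TopologicalSpace M] [ChartedSpace E M] [IsManifold 𝓘(ℝ, E) ∞ M]
  {F : Type*} [NormedAddCommGroup F] [NormedSpace ℝ F]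
  {V : M → Type*} [TopologicalSpace (TotalSpace F V)]
  [∀ x, AddCommGroup (V x)] [∀ x, Module ℝ (V x)] [∀ x, TopologicalSpace (V x)]
  [FiberBundle F V] [VectorBundle ℝ F V] [ContMDiffVectorBundle ∞ F V 𝓘(ℝ, E)]
  {F' : Type*} [NormedAddCommGroup F'] [NormedSpace ℝ F']
  {W : M → Type*} [TopologicalSpace (TotalSpace F' W)]
  [∀ x, AddCommGroup (W x)] [∀ x, Module ℝ (W x)] [∀ x, TopologicalSpace (W x)]
  [FiberBundle F' W] [VectorBundle ℝ F' W] [ContMDiffVectorBundle ∞ F' W 𝓘(ℝ, E)]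
  {G : Type*} [NormedAddCommGroup G] [NormedSpace ℝ G]
  {G' : Type*} [NormedAddCommGroup G'] [NormedSpace ℝ G']

variable (E F) in
/-- The linear fibre maps `L` from `V` to a fixed normed space are smooth at `x`. -/
def SmoothToModelAt (L : ∀ y, V y →L[ℝ] G) (x : M) : Prop :=
  ContMDiffAt 𝓘(ℝ, E) 𝓘(ℝ, F →L[ℝ] G) ∞
    (fun y ↦ (L y).comp ((trivializationAt F V x).symmL ℝ y)) x

variable (E F) in
/-- The linear maps `R` from a fixed normed space to the fibres of `V` are smooth at `x`. -/
def SmoothFromModelAt (R : ∀ y, G →L[ℝ] V y) (x : M) : Prop :=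
  ContMDiffAt 𝓘(ℝ, E) 𝓘(ℝ, G →L[ℝ] F) ∞
    (fun y ↦ ((trivializationAt F V x).continuousLinearMapAt ℝ y).comp (R y)) x

variable (E F) in
/-- `L` and its inverse `R` are smooth linear fibre coordinates of `V` near `x`. -/
structure IsFiberCoordAt (L : ∀ y, V y →L[ℝ] G) (R : ∀ y, G →L[ℝ] V y) (x : M) : Prop where
  smooth_to : ∀ᶠ y in 𝓝 x, SmoothToModelAt E F L y
  smooth_from : ∀ᶠ y in 𝓝 x, SmoothFromModelAt E F R y
  from_to : ∀ᶠ y in 𝓝 x, ∀ v, R y (L y v) = v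
  to_from : ∀ᶠ y in 𝓝 x, ∀ u, L y (R y u) = u

variable (F) in
/-- The fibre maps `L` read in the preferred trivialization at `i` and the chart `φ`. -/
def localRead (L : ∀ y, V y →L[ℝ] G) (φ : OpenPartialHomeomorph M E) (i : M) (z : E) :
    F →L[ℝ] G :=
  (L (φ.symm z)).comp ((trivializationAt F V i).symmL ℝ (φ.symm z))

/-- Being C^∞ at a point is not by itself a condition on a neighbourhood. The fields of the
structure are required near `x`, and therefore pass to all nearby points. -/
theorem IsFiberCoordAt.eventually {L : ∀ y, V y →L[ℝ] G} {R : ∀ y, G →L[ℝ] V y} {x : M}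
    (h : IsFiberCoordAt E F L R x) : ∀ᶠ y in 𝓝 x, IsFiberCoordAt E F L R y := by
  filter_upwards [h.smooth_to.eventually_nhds, h.smooth_from.eventually_nhds,
    h.from_to.eventually_nhds, h.to_from.eventually_nhds] with y h1 h2 h3 h4
  exact ⟨h1, h2, h3, h4⟩

theorem eventually_mem_baseSet {i x : M} (hx : x ∈ (trivializationAt F V i).baseSet) :
    ∀ᶠ y in 𝓝 x, y ∈ (trivializationAt F V i).baseSet :=
  (trivializationAt F V i).open_baseSet.mem_nhds hx

theorem contMDiffAt_coordChange_trivializationAt {i j x : M}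
    (hi : x ∈ (trivializationAt F V i).baseSet) (hj : x ∈ (trivializationAt F V j).baseSet) :
    ContMDiffAt 𝓘(ℝ, E) 𝓘(ℝ, F →L[ℝ] F) ∞
      (fun y ↦ ((trivializationAt F V j).continuousLinearMapAt ℝ y).comp
        ((trivializationAt F V i).symmL ℝ y)) x := by
  refine (contMDiffAt_coordChangeL (IB := 𝓘(ℝ, E)) (n := ∞) hi hj).congr_of_eventuallyEq ?_
  filter_upwards [eventually_mem_baseSet hi, eventually_mem_baseSet hj] with y hyi hyj
  ext u
  simp only [ContinuousLinearMap.comp_apply, ContinuousLinearEquiv.coe_coe]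
  rw [Trivialization.coordChangeL_apply _ _ ⟨hyi, hyj⟩, Trivialization.symmL_apply _ hyi,
    Trivialization.continuousLinearMapAt_apply_of_mem ℝ _ hyj]

/-- Smoothness does not depend on the trivialization used to read `L`: another reading differs by a
smooth transition function. -/
theorem SmoothToModelAt.comp_symmL {L : ∀ y, V y →L[ℝ] G} {x i : M}
    (h : SmoothToModelAt E F L x) (hi : x ∈ (trivializationAt F V i).baseSet) :
    ContMDiffAt 𝓘(ℝ, E) 𝓘(ℝ, F →L[ℝ] G) ∞
      (fun y ↦ (L y).comp ((trivializationAt F V i).symmL ℝ y)) x := by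
  have hx := mem_baseSet_trivializationAt F V x
  refine (ContMDiffAt.clm_comp h (contMDiffAt_coordChange_trivializationAt
    hi hx)).congr_of_eventuallyEq ?_
  filter_upwards [eventually_mem_baseSet hx] with y hy
  ext u
  simp only [ContinuousLinearMap.comp_apply]
  rw [Trivialization.symmL_continuousLinearMapAt _ hy]

theorem contDiffAt_comp_symm_of_mem_maximalAtlas {φ : OpenPartialHomeomorph M E}
    (hφ : φ ∈ IsManifold.maximalAtlas 𝓘(ℝ, E) ∞ M) {x : M} (hx : x ∈ φ.source) {f : M → G}
    (hf : ContMDiffAt 𝓘(ℝ, E) 𝓘(ℝ, G) ∞ f x) : ContDiffAt ℝ ∞ (fun z ↦ f (φ.symm z)) (φ x) := by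
  rw [← contMDiffAt_iff_contDiffAt]
  have h1 : ContMDiffAt 𝓘(ℝ, E) 𝓘(ℝ, G) ∞ f (φ.symm (φ x)) := by rwa [φ.left_inv hx]
  exact h1.comp _ (contMDiffAt_symm_of_mem_maximalAtlas hφ (φ.map_source hx))

theorem contDiffAt_chart_comp_symm {φ ψ : OpenPartialHomeomorph M E}
    (hφ : φ ∈ IsManifold.maximalAtlas 𝓘(ℝ, E) ∞ M) (hψ : ψ ∈ IsManifold.maximalAtlas 𝓘(ℝ, E) ∞ M)
    {x : M} (hx : x ∈ φ.source) (hx' : x ∈ ψ.source) : ContDiffAt ℝ ∞ (ψ ∘ φ.symm) (φ x) :=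
  contDiffAt_comp_symm_of_mem_maximalAtlas hφ hx (contMDiffAt_of_mem_maximalAtlas hψ hx')

theorem contDiffAt_localRead {φ : OpenPartialHomeomorph M E}
    (hφ : φ ∈ IsManifold.maximalAtlas 𝓘(ℝ, E) ∞ M) {L : ∀ y, V y →L[ℝ] G} {x i : M}
    (hx : x ∈ φ.source) (hi : x ∈ (trivializationAt F V i).baseSet)
    (h : SmoothToModelAt E F L x) : ContDiffAt ℝ ∞ (localRead F L φ i) (φ x) :=
  contDiffAt_comp_symm_of_mem_maximalAtlas hφ hx (h.comp_symmL hi)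

theorem eventually_symm {φ : OpenPartialHomeomorph M E} {x : M} (hx : x ∈ φ.source)
    {p : M → Prop} (h : ∀ᶠ y in 𝓝 x, p y) : ∀ᶠ z in 𝓝 (φ x), p (φ.symm z) := by
  have hc := φ.continuousAt_symm (φ.map_source hx)
  rw [ContinuousAt, φ.left_inv hx] at hc
  exact hc.eventually h

theorem eventually_mem_source {φ : OpenPartialHomeomorph M E} {x : M} (hx : x ∈ φ.source) :
    ∀ᶠ y in 𝓝 x, y ∈ φ.source := φ.open_source.mem_nhds hx

/-- The preferred trivialization gives smooth linear fibre coordinates. -/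
theorem isFiberCoordAt_trivializationAt {i x : M} (hi : x ∈ (trivializationAt F V i).baseSet) :
    IsFiberCoordAt E F (fun y ↦ (trivializationAt F V i).continuousLinearMapAt ℝ y)
      (fun y ↦ (trivializationAt F V i).symmL ℝ y) x where
  smooth_to := by
    filter_upwards [eventually_mem_baseSet hi] with y hy
    exact contMDiffAt_coordChange_trivializationAt (mem_baseSet_trivializationAt F V y) hy
  smooth_from := by
    filter_upwards [eventually_mem_baseSet hi] with y hy
    exact contMDiffAt_coordChange_trivializationAt hy (mem_baseSet_trivializationAt F V y)
  from_to := by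
    filter_upwards [eventually_mem_baseSet hi] with y hy v
    exact Trivialization.symmL_continuousLinearMapAt _ hy v
  to_from := by
    filter_upwards [eventually_mem_baseSet hi] with y hy v
    exact Trivialization.continuousLinearMapAt_symmL _ hy v

variable (F) in
/-- The fibre coordinates of `JV` induced by the chart `φ` and the fibre coordinates `L` of `V`. -/
def jetFiberMap (φ : OpenPartialHomeomorph M E) (L : ∀ y, V y →L[ℝ] G) (y : M) :
    JetSpace E F V y →L[ℝ] G × (E →L[ℝ] G) :=
  jetReadAt (localRead F L φ y) (chartAt E y ∘ φ.symm) (φ y)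

theorem localRead_congr {φ : OpenPartialHomeomorph M E} {L L' : ∀ y, V y →L[ℝ] G} {y i : M}
    (hy : y ∈ φ.source) (h : ∀ᶠ y' in 𝓝 y, L y' = L' y') :
    localRead F L φ i =ᶠ[𝓝 (φ y)] localRead F L' φ i := by
  filter_upwards [eventually_symm hy h] with z hz
  rw [localRead, localRead, hz]

theorem jetFiberMap_congr {φ : OpenPartialHomeomorph M E} {L L' : ∀ y, V y →L[ℝ] G} {y : M}
    (hy : y ∈ φ.source) (h : ∀ᶠ y' in 𝓝 y, L y' = L' y') :
    jetFiberMap F φ L y = jetFiberMap F φ L' y :=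
  jetReadAt_congr (localRead_congr hy h) EventuallyEq.rfl

/-- The link between the bundle core and the coordinate calculus: both sides are the jet transition
from the preferred coordinates at `y` to those at `i`. -/
theorem trivializationAt_jetSpace {i y : M} (hy : y ∈ jetBaseSet E F V i) :
    (trivializationAt (F × (E →L[ℝ] F)) (JetSpace E F V) i).continuousLinearMapAt ℝ y =
      jetFiberMap F (chartAt E i) (fun y ↦ (trivializationAt F V i).continuousLinearMapAt ℝ y) y := by
  refine ((jetBundleCore E F V).trivializationAt_continuousLinearMapAt (b₀ := i) (b := y)
    hy).trans ?_
  have hA : (fun z ↦ fiberTransition F V y i ((chartAt E i).symm z)) =ᶠ[𝓝 (chartAt E i y)]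
      localRead F (fun y ↦ (trivializationAt F V i).continuousLinearMapAt ℝ y) (chartAt E i) y := by
    filter_upwards [eventually_symm hy.1 (eventually_mem_baseSet hy.2),
      eventually_symm hy.1 (eventually_mem_baseSet (mem_baseSet_trivializationAt F V y))]
      with z hz hz'
    ext u
    simp only [fiberTransition, localRead, ContinuousLinearMap.comp_apply,
      ContinuousLinearEquiv.coe_coe]
    rw [Trivialization.coordChangeL_apply _ _ ⟨hz', hz⟩, Trivialization.symmL_apply _ hz',
      Trivialization.continuousLinearMapAt_apply_of_mem ℝ _ hz]
  rw [jetFiberMap, ← jetReadAt_congr hA EventuallyEq.rfl]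
  have hτ : tangentCoordChange 𝓘(ℝ, E) i y y =
      fderiv ℝ (chartAt E y ∘ (chartAt E i).symm) (chartAt E i y) := by
    rw [tangentCoordChange_def]
    simp
  change jetTransition E F V y i y = _
  rw [jetTransition, jetReadAt, hτ, fiberTransitionDeriv, (chartAt E i).left_inv hy.1]

variable (E F) in
/-- The section `σ` is differentiable at `x`. -/
def DifferentiableSectionAt (σ : ∀ y, V y) (x : M) : Prop :=
  DifferentiableAt ℝ
    (fun z ↦ (trivializationAt F V x ⟨(chartAt E x).symm z, σ ((chartAt E x).symm z)⟩).2)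
    (chartAt E x x)

/-- The coordinates of the jet of a section. -/
theorem hasFDerivAt_section {φ : OpenPartialHomeomorph M E}
    (hφ : φ ∈ IsManifold.maximalAtlas 𝓘(ℝ, E) ∞ M) {L : ∀ y, V y →L[ℝ] G} {x : M}
    (hx : x ∈ φ.source) (h : SmoothToModelAt E F L x) {σ : ∀ y, V y}
    (hσ : DifferentiableSectionAt E F σ x) :
    HasFDerivAt (fun z ↦ L (φ.symm z) (σ (φ.symm z))) (jetFiberMap F φ L x (jet E F σ x)).2
      (φ x) := by
  have hx' := mem_baseSet_trivializationAt F V x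
  have hcx := mem_chart_source E x
  have hA := (contDiffAt_localRead hφ hx hx' h).differentiableAt (by simp)
  have hτ := (contDiffAt_chart_comp_symm hφ (IsManifold.chart_mem_maximalAtlas x) hx
    hcx).differentiableAt (by simp)
  have hτx : (chartAt E x ∘ φ.symm) (φ x) = chartAt E x x := by simp [φ.left_inv hx]
  have hu : HasFDerivAt (fun z ↦ (trivializationAt F V x
      ⟨(chartAt E x).symm z, σ ((chartAt E x).symm z)⟩).2) (jet E F σ x).2
      ((chartAt E x ∘ φ.symm) (φ x)) := by
    rw [hτx]
    exact hσ.hasFDerivAt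
  have key := hasFDerivAt_jetReadAt hA hτ hu
  rw [hτx] at key
  refine key.congr_of_eventuallyEq ?_
  filter_upwards [eventually_symm hx (eventually_mem_baseSet hx'),
    eventually_symm hx (eventually_mem_source hcx)] with z hz hz'
  simp only [localRead, Function.comp_apply, ContinuousLinearMap.comp_apply]
  rw [(chartAt E x).left_inv hz', Trivialization.symmL_apply _ hz,
    Trivialization.symm_apply_apply_mk _ hz]

theorem jetFiberMap_fst {φ : OpenPartialHomeomorph M E} (L : ∀ y, V y →L[ℝ] G) {x : M}
    (hx : x ∈ φ.source) (j : JetSpace E F V x) :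
    (jetFiberMap F φ L x j).1 = L x j.proj := by
  change localRead F L φ x (φ x) j.1 = _
  simp only [localRead, ContinuousLinearMap.comp_apply, JetSpace.proj]
  rw [φ.left_inv hx]

theorem differentiableSectionAt_of_eventually {σ : ∀ y, V y} {x : M} {f : E → F}
    (hf : DifferentiableAt ℝ f (chartAt E x x))
    (h : ∀ᶠ y in 𝓝 x, (trivializationAt F V x).continuousLinearMapAt ℝ y (σ y) =
      f (chartAt E x y)) : DifferentiableSectionAt E F σ x := by
  refine hf.congr_of_eventuallyEq ?_
  have hcx := mem_chart_source E x
  filter_upwards [eventually_symm hcx h, eventually_symm hcx (eventually_mem_baseSet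
    (mem_baseSet_trivializationAt F V x)),
    (chartAt E x).open_target.mem_nhds ((chartAt E x).map_source hcx)] with z hz hz' hz''
  rw [(chartAt E x).right_inv hz''] at hz
  rw [← hz, Trivialization.continuousLinearMapAt_apply_of_mem ℝ _ hz']

theorem continuousLinearMapAt_rep {x : M} (j : JetSpace E F V x) :
    ∀ᶠ y in 𝓝 x, (trivializationAt F V x).continuousLinearMapAt ℝ y (j.rep y) =
      j.1 + j.2 (chartAt E x y - chartAt E x x) := by
  filter_upwards [eventually_mem_baseSet (mem_baseSet_trivializationAt F V x)] with y hy
  rw [JetSpace.rep, Trivialization.continuousLinearMapAt_symmL _ hy]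

theorem differentiableSectionAt_rep {x : M} (j : JetSpace E F V x) :
    DifferentiableSectionAt E F j.rep x := by
  refine differentiableSectionAt_of_eventually (f := fun z ↦ j.1 + j.2 (z - chartAt E x x)) ?_
    (continuousLinearMapAt_rep j)
  fun_prop

theorem rep_self {x : M} (j : JetSpace E F V x) : j.rep x = j.proj := by
  simp [JetSpace.rep, JetSpace.proj]

theorem hasFDerivAt_rep {φ : OpenPartialHomeomorph M E}
    (hφ : φ ∈ IsManifold.maximalAtlas 𝓘(ℝ, E) ∞ M) {L : ∀ y, V y →L[ℝ] G} {x : M}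
    (hx : x ∈ φ.source) (h : SmoothToModelAt E F L x) (j : JetSpace E F V x) :
    HasFDerivAt (fun z ↦ L (φ.symm z) (j.rep (φ.symm z))) (jetFiberMap F φ L x j).2 (φ x) := by
  have := hasFDerivAt_section hφ hx h (differentiableSectionAt_rep j)
  rwa [jet_rep] at this

/-- The preferred coordinates on the fibre of `JV` at `x` are the tautological ones. -/
theorem jetFiberMap_chartAt_self (x : M) (j : JetSpace E F V x) :
    jetFiberMap F (chartAt E x) (fun y ↦ (trivializationAt F V x).continuousLinearMapAt ℝ y) x j =
      j := by
  rw [← trivializationAt_jetSpace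
    ⟨mem_chart_source E x, mem_baseSet_trivializationAt F V x⟩]
  refine DFunLike.congr_fun
    ((jetBundleCore E F V).trivializationAt_continuousLinearMapAt (b₀ := x) (b := x)
    ⟨mem_chart_source E x, mem_baseSet_trivializationAt F V x⟩) j |>.trans ?_
  exact (jetBundleCore E F V).coordChange_self x x
    ⟨mem_chart_source E x, mem_baseSet_trivializationAt F V x⟩ j

/-- The coordinates of `JV` induced by `φ` and `L`, read in the preferred trivialization of `JV`
at `i`. -/
theorem jetFiberMap_symmL {φ : OpenPartialHomeomorph M E}
    (hφ : φ ∈ IsManifold.maximalAtlas 𝓘(ℝ, E) ∞ M) {L : ∀ y, V y →L[ℝ] G} {x i : M}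
    (hx : x ∈ φ.source) (h : SmoothToModelAt E F L x) (hi : x ∈ jetBaseSet E F V i) :
    (jetFiberMap F φ L x).comp
        ((trivializationAt (F × (E →L[ℝ] F)) (JetSpace E F V) i).symmL ℝ x) =
      jetReadAt (localRead F L φ i) (chartAt E i ∘ φ.symm) (φ x) := by
  refine ContinuousLinearMap.ext fun p ↦ ?_
  have hi' : x ∈ (trivializationAt (F × (E →L[ℝ] F)) (JetSpace E F V) i).baseSet := hi
  -- Every model vector is the reading of some jet `j`. Both sides can then be compared as
  -- derivatives of `L` along the single section `j.rep`.
  obtain ⟨j, rfl⟩ : ∃ j, (trivializationAt (F × (E →L[ℝ] F)) (JetSpace E F V)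
      i).continuousLinearMapAt ℝ x j = p :=
    ⟨_, Trivialization.continuousLinearMapAt_symmL _ hi' p⟩
  rw [ContinuousLinearMap.comp_apply, Trivialization.symmL_continuousLinearMapAt _ hi',
    trivializationAt_jetSpace hi]
  have hA := (contDiffAt_localRead hφ hx hi.2 h).differentiableAt (by simp)
  have hτ := (contDiffAt_chart_comp_symm hφ (IsManifold.chart_mem_maximalAtlas i) hx
    hi.1).differentiableAt (by simp)
  have hτx : (chartAt E i ∘ φ.symm) (φ x) = chartAt E i x := by simp [φ.left_inv hx]
  have hu := hasFDerivAt_rep (IsManifold.chart_mem_maximalAtlas i) hi.1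
    (isFiberCoordAt_trivializationAt (E := E) hi.2).smooth_to.self_of_nhds j
  have hu' := hu
  rw [← hτx] at hu'
  have key := hasFDerivAt_jetReadAt hA hτ hu'
  simp only [Function.comp_apply] at key
  have hp : (chartAt E i).symm (chartAt E i (φ.symm (φ x))) = x := by
    rw [φ.left_inv hx, (chartAt E i).left_inv hi.1]
  have e1 : (jetFiberMap F (chartAt E i)
      (fun y ↦ (trivializationAt F V i).continuousLinearMapAt ℝ y) x j).1 =
      (trivializationAt F V i).continuousLinearMapAt ℝ ((chartAt E i).symm
        (chartAt E i (φ.symm (φ x))))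
        (j.rep ((chartAt E i).symm (chartAt E i (φ.symm (φ x))))) := by
    rw [jetFiberMap_fst _ hi.1, hp, rep_self]
  rw [← e1] at key
  refine Prod.ext ?_ ?_
  · rw [jetFiberMap_fst _ hx, jetReadAt_fst, jetFiberMap_fst _ hi.1]
    simp only [localRead, ContinuousLinearMap.comp_apply]
    rw [φ.left_inv hx, Trivialization.symmL_continuousLinearMapAt _ hi.2]
  · refine (hasFDerivAt_rep hφ hx h j).unique (key.congr_of_eventuallyEq ?_)
    filter_upwards [eventually_symm hx (eventually_mem_baseSet hi.2),
      eventually_symm hx (eventually_mem_source hi.1)] with z hz hz'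
    simp only [localRead, ContinuousLinearMap.comp_apply]
    congr 1
    -- The two base points are only propositionally equal and the fibres depend on them, so the
    -- point is generalised before substitution.
    have h2 : ∀ y, y = φ.symm z → (trivializationAt F V i).continuousLinearMapAt ℝ y (j.rep y) =
        (trivializationAt F V i).continuousLinearMapAt ℝ (φ.symm z) (j.rep (φ.symm z)) := by
      rintro _ rfl
      rfl
    exact (Trivialization.symmL_continuousLinearMapAt _ hz _).symm.trans
      (congrArg _ (h2 _ ((chartAt E i).left_inv hz')).symm)

theorem eventually_mem_jetBaseSet {i x : M} (hx : x ∈ jetBaseSet E F V i) :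
    ∀ᶠ y in 𝓝 x, y ∈ jetBaseSet E F V i := (isOpen_jetBaseSet i).mem_nhds hx

theorem mem_jetBaseSet_self (x : M) : x ∈ jetBaseSet E F V x :=
  ⟨mem_chart_source E x, mem_baseSet_trivializationAt F V x⟩

/-- The induced coordinates, read in a trivialization of JV, are again an operator field of the form
`jetReadAt`. As this holds near `φ x`, it may be differentiated, which makes the passage to JJV
possible. -/
theorem localRead_jetFiberMap {φ : OpenPartialHomeomorph M E}
    (hφ : φ ∈ IsManifold.maximalAtlas 𝓘(ℝ, E) ∞ M) {L : ∀ y, V y →L[ℝ] G} {x i : M}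
    (hx : x ∈ φ.source) (h : ∀ᶠ y in 𝓝 x, SmoothToModelAt E F L y) (hi : x ∈ jetBaseSet E F V i) :
    localRead (F × (E →L[ℝ] F)) (jetFiberMap F φ L) φ i =ᶠ[𝓝 (φ x)]
      jetReadAt (localRead F L φ i) (chartAt E i ∘ φ.symm) := by
  filter_upwards [eventually_symm hx h, eventually_symm hx (eventually_mem_jetBaseSet hi),
    eventually_symm hx (eventually_mem_source hx),
    φ.open_target.mem_nhds (φ.map_source hx)] with z h1 h2 h3 h4
  have := jetFiberMap_symmL hφ h3 h1 h2
  rw [φ.right_inv h4] at this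
  exact this

/-- This allows `jetFiberMap φ L` to take the role of `L` for the bundle JV. -/
theorem smoothToModelAt_jetFiberMap {φ : OpenPartialHomeomorph M E}
    (hφ : φ ∈ IsManifold.maximalAtlas 𝓘(ℝ, E) ∞ M) {L : ∀ y, V y →L[ℝ] G} {x : M}
    (hx : x ∈ φ.source) (h : ∀ᶠ y in 𝓝 x, SmoothToModelAt E F L y) :
    ∀ᶠ y in 𝓝 x, SmoothToModelAt E (F × (E →L[ℝ] F)) (jetFiberMap F φ L) y := by
  filter_upwards [h.eventually_nhds, eventually_mem_source hx] with y hy hyφ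
  have hi := mem_jetBaseSet_self (E := E) (F := F) (V := V) y
  have hA := contDiffAt_localRead hφ hyφ hi.2 hy.self_of_nhds
  have hτ := contDiffAt_chart_comp_symm hφ (IsManifold.chart_mem_maximalAtlas y) hyφ hi.1
  have h1 := (contDiffAt_jetReadAt hA hτ).congr_of_eventuallyEq (localRead_jetFiberMap hφ hyφ hy hi)
  have h2 := h1.contMDiffAt.comp y (contMDiffAt_of_mem_maximalAtlas hφ hyφ)
  refine h2.congr_of_eventuallyEq ?_
  filter_upwards [eventually_mem_source hyφ] with y' hy'
  simp only [localRead, Function.comp_apply]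
  rw [φ.left_inv hy']

end FiberCoordinates

/-! ### The differential of a chart as fibre coordinates of the tangent bundle -/

noncomputable section TangentCoordinates

variable {E : Type*} [NormedAddCommGroup E] [NormedSpace ℝ E]
  {M : Type*} [TopologicalSpace M] [ChartedSpace E M] [IsManifold 𝓘(ℝ, E) ∞ M]

/-- The inverse of the differential of the chart `φ`. -/
def chartDiffInv (φ : OpenPartialHomeomorph M E) (y : M) : E →L[ℝ] TangentSpace 𝓘(ℝ, E) y :=
  (mfderiv 𝓘(ℝ, E) 𝓘(ℝ, E) φ y).inverse

/-- The differential of the chart `φ`. -/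
def chartDiff (φ : OpenPartialHomeomorph M E) (y : M) : TangentSpace 𝓘(ℝ, E) y →L[ℝ] E :=
  mfderiv 𝓘(ℝ, E) 𝓘(ℝ, E) φ y

section

variable {φ : OpenPartialHomeomorph M E}

theorem mdifferentiableAt_of_mem_smoothAtlas (hφ : φ ∈ IsManifold.maximalAtlas 𝓘(ℝ, E) ∞ M)
    {x : M} (hx : x ∈ φ.source) :
    MDifferentiableAt 𝓘(ℝ, E) 𝓘(ℝ, E) φ x :=
  (contMDiffAt_of_mem_maximalAtlas hφ hx).mdifferentiableAt (by simp)

theorem mdifferentiableAt_symm_of_mem_smoothAtlas (hφ : φ ∈ IsManifold.maximalAtlas 𝓘(ℝ, E) ∞ M)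
    {z : E} (hz : z ∈ φ.target) :
    MDifferentiableAt 𝓘(ℝ, E) 𝓘(ℝ, E) φ.symm z :=
  (contMDiffAt_symm_of_mem_maximalAtlas hφ hz).mdifferentiableAt (by simp)

theorem mfderiv_chart_comp_mfderiv_symm (hφ : φ ∈ IsManifold.maximalAtlas 𝓘(ℝ, E) ∞ M)
    {x : M} (hx : x ∈ φ.source) :
    (mfderiv 𝓘(ℝ, E) 𝓘(ℝ, E) φ x).comp (mfderiv 𝓘(ℝ, E) 𝓘(ℝ, E) φ.symm (φ x)) =
      ContinuousLinearMap.id ℝ E := by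
  have h2 := mdifferentiableAt_symm_of_mem_smoothAtlas hφ (φ.map_source hx)
  have h1 : MDifferentiableAt 𝓘(ℝ, E) 𝓘(ℝ, E) φ (φ.symm (φ x)) := by
    rw [φ.left_inv hx]; exact mdifferentiableAt_of_mem_smoothAtlas hφ hx
  have h3 := mfderiv_comp (φ x) h1 h2
  have h4 : (φ ∘ φ.symm) =ᶠ[𝓝 (φ x)] id := by
    filter_upwards [φ.open_target.mem_nhds (φ.map_source hx)] with z hz
    exact φ.right_inv hz
  rw [h4.mfderiv_eq, mfderiv_id] at h3
  rw [φ.left_inv hx] at h3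
  exact h3.symm

theorem mfderiv_symm_comp_mfderiv_chart (hφ : φ ∈ IsManifold.maximalAtlas 𝓘(ℝ, E) ∞ M)
    {x : M} (hx : x ∈ φ.source) :
    (mfderiv 𝓘(ℝ, E) 𝓘(ℝ, E) φ.symm (φ x)).comp (mfderiv 𝓘(ℝ, E) 𝓘(ℝ, E) φ x) =
      ContinuousLinearMap.id ℝ (TangentSpace 𝓘(ℝ, E) x) := by
  have h2 := mdifferentiableAt_symm_of_mem_smoothAtlas hφ (φ.map_source hx)
  have h1 := mdifferentiableAt_of_mem_smoothAtlas hφ hx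
  have h3 := mfderiv_comp x h2 h1
  have h4 : (φ.symm ∘ φ) =ᶠ[𝓝 x] id := by
    filter_upwards [φ.open_source.mem_nhds hx] with z hz
    exact φ.left_inv hz
  rw [h4.mfderiv_eq, mfderiv_id] at h3
  exact h3.symm

/-- The operator inverse is meaningful only where the differential is invertible; on the domain of
the chart the differential of `φ.symm` is a two-sided inverse. -/
theorem chartDiffInv_eq (hφ : φ ∈ IsManifold.maximalAtlas 𝓘(ℝ, E) ∞ M)
    {x : M} (hx : x ∈ φ.source) :
    chartDiffInv φ x = mfderiv 𝓘(ℝ, E) 𝓘(ℝ, E) φ.symm (φ x) :=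
  ContinuousLinearMap.inverse_eq (mfderiv_chart_comp_mfderiv_symm hφ hx)
    (mfderiv_symm_comp_mfderiv_chart hφ hx)

theorem chartDiff_chartDiffInv (hφ : φ ∈ IsManifold.maximalAtlas 𝓘(ℝ, E) ∞ M)
    {x : M} (hx : x ∈ φ.source) (e : E) :
    chartDiff φ x (chartDiffInv φ x e) = e := by
  rw [chartDiffInv_eq hφ hx]
  exact DFunLike.congr_fun (mfderiv_chart_comp_mfderiv_symm hφ hx) e

theorem chartDiffInv_chartDiff (hφ : φ ∈ IsManifold.maximalAtlas 𝓘(ℝ, E) ∞ M)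
    {x : M} (hx : x ∈ φ.source) (v : TangentSpace 𝓘(ℝ, E) x) :
    chartDiffInv φ x (chartDiff φ x v) = v := by
  rw [chartDiffInv_eq hφ hx]
  exact DFunLike.congr_fun (mfderiv_symm_comp_mfderiv_chart hφ hx) v

/-- In the preferred trivialization the differential of `φ` is the ordinary derivative of a
transition map, whose smoothness is known. -/
theorem chartDiff_comp_symmL (hφ : φ ∈ IsManifold.maximalAtlas 𝓘(ℝ, E) ∞ M)
    {x i : M} (hx : x ∈ φ.source) (hi : x ∈ (chartAt E i).source) :
    (chartDiff φ x).comp ((trivializationAt E (TangentSpace 𝓘(ℝ, E)) i).symmL ℝ x) =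
      fderiv ℝ (φ ∘ (chartAt E i).symm) (chartAt E i x) := by
  have hc := IsManifold.chart_mem_maximalAtlas (I := 𝓘(ℝ, E)) (n := ∞) i
  have h2 := mdifferentiableAt_symm_of_mem_smoothAtlas hc ((chartAt E i).map_source hi)
  have h1 : MDifferentiableAt 𝓘(ℝ, E) 𝓘(ℝ, E) φ ((chartAt E i).symm (chartAt E i x)) := by
    rw [(chartAt E i).left_inv hi]; exact mdifferentiableAt_of_mem_smoothAtlas hφ hx
  have h3 := mfderiv_comp (chartAt E i x) h1 h2
  rw [mfderiv_eq_fderiv, (chartAt E i).left_inv hi] at h3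
  rw [h3, TangentBundle.symmL_trivializationAt hi]
  simp only [chartDiff, mfld_simps, mfderivWithin_univ]
  rfl

theorem continuousLinearMapAt_comp_chartDiffInv (hφ : φ ∈ IsManifold.maximalAtlas 𝓘(ℝ, E) ∞ M)
    {x i : M} (hx : x ∈ φ.source)
    (hi : x ∈ (chartAt E i).source) :
    ((trivializationAt E (TangentSpace 𝓘(ℝ, E)) i).continuousLinearMapAt ℝ x).comp
      (chartDiffInv φ x) = fderiv ℝ (chartAt E i ∘ φ.symm) (φ x) := by
  have hc := IsManifold.chart_mem_maximalAtlas (I := 𝓘(ℝ, E)) (n := ∞) i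
  have h2 := mdifferentiableAt_symm_of_mem_smoothAtlas hφ (φ.map_source hx)
  have h1 : MDifferentiableAt 𝓘(ℝ, E) 𝓘(ℝ, E) (chartAt E i) (φ.symm (φ x)) := by
    rw [φ.left_inv hx]; exact mdifferentiableAt_of_mem_smoothAtlas hc hi
  have h3 := mfderiv_comp (φ x) h1 h2
  rw [mfderiv_eq_fderiv, φ.left_inv hx] at h3
  rw [h3, TangentBundle.continuousLinearMapAt_trivializationAt hi, chartDiffInv_eq hφ hx]
  simp only [mfld_simps]
  rfl

/-- The differential of a chart gives smooth linear fibre coordinates of the tangent bundle. -/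
theorem isFiberCoordAt_chartDiff (hφ : φ ∈ IsManifold.maximalAtlas 𝓘(ℝ, E) ∞ M)
    {x : M} (hx : x ∈ φ.source) :
    IsFiberCoordAt E E (V := (TangentSpace 𝓘(ℝ, E) : M → Type _)) (chartDiff φ) (chartDiffInv φ)
      x where
  smooth_to := by
    filter_upwards [eventually_mem_source hx] with y hy
    have hc := IsManifold.chart_mem_maximalAtlas (I := 𝓘(ℝ, E)) (n := ∞) y
    have hyc := mem_chart_source E y
    have h1 : ContDiffAt ℝ ∞ (fderiv ℝ (φ ∘ (chartAt E y).symm)) (chartAt E y y) :=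
      (contDiffAt_chart_comp_symm hc hφ hyc hy).fderiv_right le_rfl
    refine (h1.contMDiffAt.comp y
      (contMDiffAt_of_mem_maximalAtlas hc hyc)).congr_of_eventuallyEq ?_
    filter_upwards [eventually_mem_source hy, eventually_mem_source hyc] with y' h h'
    exact chartDiff_comp_symmL hφ h h'
  smooth_from := by
    filter_upwards [eventually_mem_source hx] with y hy
    have hc := IsManifold.chart_mem_maximalAtlas (I := 𝓘(ℝ, E)) (n := ∞) y
    have hyc := mem_chart_source E y
    have h1 : ContDiffAt ℝ ∞ (fderiv ℝ (chartAt E y ∘ φ.symm)) (φ y) :=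
      (contDiffAt_chart_comp_symm hφ hc hy hyc).fderiv_right le_rfl
    refine (h1.contMDiffAt.comp y
      (contMDiffAt_of_mem_maximalAtlas hφ hy)).congr_of_eventuallyEq ?_
    filter_upwards [eventually_mem_source hy, eventually_mem_source hyc] with y' h h'
    exact continuousLinearMapAt_comp_chartDiffInv hφ h h'
  from_to := by
    filter_upwards [eventually_mem_source hx] with y hy v
    exact chartDiffInv_chartDiff hφ hy v
  to_from := by
    filter_upwards [eventually_mem_source hx] with y hy v
    exact chartDiff_chartDiffInv hφ hy v

end

end TangentCoordinates

/-! ### Coefficients of a connection and their smoothness -/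

noncomputable section ConnectionCoefficients

variable {E : Type*} [NormedAddCommGroup E] [NormedSpace ℝ E]
  {M : Type*} [TopologicalSpace M] [ChartedSpace E M] [IsManifold 𝓘(ℝ, E) ∞ M]
  {F : Type*} [NormedAddCommGroup F] [NormedSpace ℝ F]
  {V : M → Type*} [TopologicalSpace (TotalSpace F V)]
  [∀ x, AddCommGroup (V x)] [∀ x, Module ℝ (V x)] [∀ x, TopologicalSpace (V x)]
  [FiberBundle F V] [VectorBundle ℝ F V] [ContMDiffVectorBundle ∞ F V 𝓘(ℝ, E)]
  {F' : Type*} [NormedAddCommGroup F'] [NormedSpace ℝ F']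
  {W : M → Type*} [TopologicalSpace (TotalSpace F' W)]
  [∀ x, AddCommGroup (W x)] [∀ x, Module ℝ (W x)] [∀ x, TopologicalSpace (W x)]
  [FiberBundle F' W] [VectorBundle ℝ F' W] [ContMDiffVectorBundle ∞ F' W 𝓘(ℝ, E)]
  {G : Type*} [NormedAddCommGroup G] [NormedSpace ℝ G]
  {G' : Type*} [NormedAddCommGroup G'] [NormedSpace ℝ G']

/-- In finite dimension an operator is the sum over a basis of its values on the basis vectors
tensored with the dual basis, and this sum is a fixed linear expression in those values. -/
theorem contMDiffAt_clm_of_apply [FiniteDimensional ℝ F] {f : M → F →L[ℝ] G} {x : M}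
    (h : ∀ u, ContMDiffAt 𝓘(ℝ, E) 𝓘(ℝ, G) ∞ (fun y ↦ f y u) x) :
    ContMDiffAt 𝓘(ℝ, E) 𝓘(ℝ, F →L[ℝ] G) ∞ f x := by
  let b := Module.finBasis ℝ F
  have h1 : ContMDiffAt 𝓘(ℝ, E) 𝓘(ℝ, F →L[ℝ] G) ∞ (fun y ↦ ∑ i,
      ContinuousLinearMap.smulRightL ℝ F G (LinearMap.toContinuousLinearMap (b.coord i))
        (f y (b i))) x := by
    refine ContMDiffAt.sum fun i _ ↦ ?_
    exact (ContinuousLinearMap.contDiff _).contMDiff.contMDiffAt.comp x (h (b i))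
  refine h1.congr_of_eventuallyEq (Eventually.of_forall fun y ↦ ?_)
  ext u
  conv_lhs => rw [← b.sum_repr u, map_sum]
  simp

variable (F) in
/-- The coefficients of the connection `κ` of `V` in the chart `φ` and the linear fibre coordinates
`L` of `V`, whose inverse is `R`. -/
def connectionCoeff (φ : OpenPartialHomeomorph M E) (L : ∀ y, V y →L[ℝ] G)
    (R : ∀ y, G →L[ℝ] V y) (κ : ∀ x, V x →L[ℝ] JetSpace E F V x) (y : M) : G →L[ℝ] E →L[ℝ] G :=
  (ContinuousLinearMap.snd ℝ G (E →L[ℝ] G)).comp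
    ((jetFiberMap F φ L y).comp ((κ y).comp (R y)))

theorem jetFiberMap_connection {φ : OpenPartialHomeomorph M E} {L : ∀ y, V y →L[ℝ] G}
    {R : ∀ y, G →L[ℝ] V y} {κ : ∀ x, V x →L[ℝ] JetSpace E F V x}
    (hκ : ∀ x v, (κ x v).proj = v) {x : M} (hx : x ∈ φ.source) (h : IsFiberCoordAt E F L R x) :
    ∀ᶠ y in 𝓝 x, ∀ v, jetFiberMap F φ L y (κ y v) =
      (L y v, connectionCoeff F φ L R κ y (L y v)) := by
  filter_upwards [eventually_mem_source hx, h.from_to] with y hy hRL v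
  refine Prod.ext ?_ ?_
  · rw [jetFiberMap_fst L hy, hκ]
  · simp [connectionCoeff, hRL]

variable [FiniteDimensional ℝ F]

/-- A linear connection is a smooth morphism of vector bundles. -/
theorem IsConnection.contMDiffAt_inCoordinates {κ : ∀ x, V x →L[ℝ] JetSpace E F V x}
    (hκ : IsConnection (fun x v ↦ κ x v)) (x : M) :
    ContMDiffAt 𝓘(ℝ, E) 𝓘(ℝ, F →L[ℝ] F × (E →L[ℝ] F)) ∞
      (fun y ↦ ((trivializationAt (F × (E →L[ℝ] F)) (JetSpace E F V) x).continuousLinearMapAt ℝ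
        y).comp ((κ y).comp ((trivializationAt F V x).symmL ℝ y))) x := by
  refine contMDiffAt_clm_of_apply fun u ↦ ?_
  have hx := mem_baseSet_trivializationAt F V x
  -- A section with constant coordinate `u` is smooth, and the smooth map κ carries it to a smooth
  -- section of JV.
  have h1 : ContMDiffAt 𝓘(ℝ, E) (𝓘(ℝ, E).prod 𝓘(ℝ, F)) ∞
      (fun y ↦ TotalSpace.mk' F y ((trivializationAt F V x).symmL ℝ y u)) x := by
    rw [contMDiffAt_section]
    refine (contMDiffAt_const (c := u)).congr_of_eventuallyEq ?_
    filter_upwards [eventually_mem_baseSet hx] with y hy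
    rw [Trivialization.symmL_apply _ hy, Trivialization.apply_mk_symm _ hy]
  have h2 := (hκ.smooth _).comp x h1
  have h3 := (contMDiffAt_section (F := F × (E →L[ℝ] F)) (E := JetSpace E F V) x).1 h2
  refine h3.congr_of_eventuallyEq ?_
  filter_upwards [eventually_mem_jetBaseSet (mem_jetBaseSet_self (E := E) (F := F) (V := V) x)]
    with y hy
  have hy' : y ∈ (trivializationAt (F × (E →L[ℝ] F)) (JetSpace E F V) x).baseSet := hy
  simp only [ContinuousLinearMap.comp_apply]
  rw [Trivialization.continuousLinearMapAt_apply_of_mem ℝ _ hy']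

/-- Inserting the preferred trivializations between the factors writes the coefficients as a product
of the smooth readings of the induced coordinates, of κ and of `R`. -/
theorem contMDiffAt_connectionCoeff {φ : OpenPartialHomeomorph M E}
    (hφ : φ ∈ IsManifold.maximalAtlas 𝓘(ℝ, E) ∞ M) {L : ∀ y, V y →L[ℝ] G}
    {R : ∀ y, G →L[ℝ] V y} {κ : ∀ x, V x →L[ℝ] JetSpace E F V x}
    (hκ : IsConnection (fun x v ↦ κ x v)) {x : M} (hx : x ∈ φ.source)
    (h : IsFiberCoordAt E F L R x) :
    ContMDiffAt 𝓘(ℝ, E) 𝓘(ℝ, G →L[ℝ] E →L[ℝ] G) ∞ (connectionCoeff F φ L R κ) x := by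
  have h1 := (smoothToModelAt_jetFiberMap hφ hx h.smooth_to).self_of_nhds
  have h2 := hκ.contMDiffAt_inCoordinates x
  have h3 := h.smooth_from.self_of_nhds
  refine (contMDiffAt_const (c := ContinuousLinearMap.snd ℝ G (E →L[ℝ] G))).clm_comp
    (ContMDiffAt.clm_comp h1 (h2.clm_comp h3)) |>.congr_of_eventuallyEq ?_
  filter_upwards [eventually_mem_jetBaseSet (mem_jetBaseSet_self (E := E) (F := F) (V := V) x)]
    with y hy
  have hy' : y ∈ (trivializationAt (F × (E →L[ℝ] F)) (JetSpace E F V) x).baseSet := hy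
  ext u : 1
  simp only [connectionCoeff, ContinuousLinearMap.comp_apply]
  rw [Trivialization.symmL_continuousLinearMapAt _ hy',
    Trivialization.symmL_continuousLinearMapAt _ hy.2]

theorem contDiffAt_connectionCoeff {φ : OpenPartialHomeomorph M E}
    (hφ : φ ∈ IsManifold.maximalAtlas 𝓘(ℝ, E) ∞ M) {L : ∀ y, V y →L[ℝ] G}
    {R : ∀ y, G →L[ℝ] V y} {κ : ∀ x, V x →L[ℝ] JetSpace E F V x}
    (hκ : IsConnection (fun x v ↦ κ x v)) {x : M} (hx : x ∈ φ.source)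
    (h : IsFiberCoordAt E F L R x) :
    ContDiffAt ℝ ∞ (fun z ↦ connectionCoeff F φ L R κ (φ.symm z)) (φ x) :=
  contDiffAt_comp_symm_of_mem_maximalAtlas hφ hx (contMDiffAt_connectionCoeff hφ hκ hx h)

end ConnectionCoefficients

/-! ### The transformation law of the coefficients of a connection of TM -/

noncomputable section TangentConnection

variable {E : Type*} [NormedAddCommGroup E] [NormedSpace ℝ E]
  {M : Type*} [TopologicalSpace M] [ChartedSpace E M] [IsManifold 𝓘(ℝ, E) ∞ M]

theorem tangentSpace_symmL_self (x : M) (v : E) :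
    (trivializationAt E (TangentSpace 𝓘(ℝ, E)) x).symmL ℝ x v = v := by
  rw [TangentBundle.symmL_trivializationAt_eq_core (mem_chart_source E x)]
  exact (tangentBundleCore 𝓘(ℝ, E) M).coordChange_self (achart E x) x (mem_chart_source E x) v

/-- The transformation law of the coefficients of a connection of `TM`, from the preferred chart
at `x` to the chart `φ`. -/
theorem tangentConnection_transform {φ : OpenPartialHomeomorph M E}
    (hφ : φ ∈ IsManifold.maximalAtlas 𝓘(ℝ, E) ∞ M)
    {Γ : ∀ x : M, TangentSpace 𝓘(ℝ, E) x →L[ℝ] JetSpace E E (TangentSpace 𝓘(ℝ, E) : M → Type _) x}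
    (hΓ : ∀ x v, (Γ x v).proj = v) {x : M} (hx : x ∈ φ.source) (a b : E) :
    fderiv ℝ (chartAt E x ∘ φ.symm) (φ x)
        (connectionCoeff E φ (chartDiff φ) (chartDiffInv φ) Γ x b a) =
      ((ContinuousLinearMap.snd ℝ E (E →L[ℝ] E)).comp (Γ x) : E →L[ℝ] E →L[ℝ] E)
        (fderiv ℝ (chartAt E x ∘ φ.symm) (φ x) b) (fderiv ℝ (chartAt E x ∘ φ.symm) (φ x) a) -
      fderiv ℝ (fderiv ℝ (chartAt E x ∘ φ.symm)) (φ x) a b := by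
  set τ := chartAt E x ∘ φ.symm with hτdef
  set B := localRead E (chartDiff φ) φ x with hBdef
  have hc := IsManifold.chart_mem_maximalAtlas (I := 𝓘(ℝ, E)) (n := ∞) x
  have hcx := mem_chart_source E x
  have hx' : x ∈ (trivializationAt E (TangentSpace 𝓘(ℝ, E)) x).baseSet :=
    mem_baseSet_trivializationAt E (TangentSpace 𝓘(ℝ, E)) x
  have hτ : ContDiffAt ℝ ∞ τ (φ x) := contDiffAt_chart_comp_symm hφ hc hx hcx
  have hτ' : DifferentiableAt ℝ (fderiv ℝ τ) (φ x) :=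
    (hτ.fderiv_right (m := ∞) le_rfl).differentiableAt (by simp)
  have hB : DifferentiableAt ℝ B (φ x) := (contDiffAt_localRead hφ hx hx'
    (isFiberCoordAt_chartDiff hφ hx).smooth_to.self_of_nhds).differentiableAt (by simp)
  have hz0 : φ.symm (φ x) = x := φ.left_inv hx
  have hτ1 : ∀ b, fderiv ℝ τ (φ x) b =
      (trivializationAt E (TangentSpace 𝓘(ℝ, E)) x).continuousLinearMapAt ℝ x
        (chartDiffInv φ x b) := fun b ↦
    (DFunLike.congr_fun (continuousLinearMapAt_comp_chartDiffInv hφ hx hcx) b).symm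
  have hBτ : ∀ b, B (φ x) (fderiv ℝ τ (φ x) b) = b := by
    intro b
    simp only [hBdef, localRead, ContinuousLinearMap.comp_apply]
    rw [hz0, hτ1, Trivialization.symmL_continuousLinearMapAt _ hx', chartDiff_chartDiffInv hφ hx]
  -- B is the reading of the differential of `φ`, hence inverse to Dτ; the identity Dτ · B = id
  -- holds on a neighbourhood and may be differentiated.
  have hτB : ∀ v, (fun z ↦ fderiv ℝ τ z (B z v)) =ᶠ[𝓝 (φ x)] fun _ ↦ v := by
    intro v
    filter_upwards [eventually_symm hx (eventually_mem_baseSet hx'),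
      eventually_symm hx (eventually_mem_source hx), eventually_symm hx (eventually_mem_source hcx),
      φ.open_target.mem_nhds (φ.map_source hx)] with z h1 h2 h3 h4
    have := DFunLike.congr_fun (continuousLinearMapAt_comp_chartDiffInv hφ h2 h3) (B z v)
    rw [φ.right_inv h4] at this
    rw [← this]
    simp only [hBdef, localRead, ContinuousLinearMap.comp_apply]
    rw [chartDiffInv_chartDiff hφ h2, Trivialization.continuousLinearMapAt_symmL _ h1]
  -- Differentiating Dτ · B = id on the constant vector Dτ b replaces the derivative of B by -D²τ.
  -- This is the source of the inhomogeneous term.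
  have hD : fderiv ℝ τ (φ x) (fderiv ℝ B (φ x) a (fderiv ℝ τ (φ x) b)) =
      -fderiv ℝ (fderiv ℝ τ) (φ x) a b := by
    have h1 := (hτ'.hasFDerivAt.clm_apply
      (hB.hasFDerivAt.clm_apply (hasFDerivAt_const (fderiv ℝ τ (φ x) b) (φ x)))).fderiv
    rw [(hτB _).fderiv_eq] at h1
    have := DFunLike.congr_fun h1 a
    simp only [fderiv_fun_const, Pi.zero_apply, zero_apply, add_apply,
      ContinuousLinearMap.comp_apply, ContinuousLinearMap.flip_apply, hBτ, map_zero,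
      zero_add] at this
    exact eq_neg_of_add_eq_zero_left this.symm
  have hsymm := tangentSpace_symmL_self (E := E) x
  have hRb : chartDiffInv φ x b = fderiv ℝ τ (φ x) b := by
    rw [hτ1]
    refine Eq.trans ?_ (hsymm _)
    rw [Trivialization.symmL_continuousLinearMapAt _ hx']
  have h1 : (Γ x (chartDiffInv φ x b)).1 = fderiv ℝ τ (φ x) b :=
    (hsymm _).symm.trans ((hΓ x _).trans hRb)
  have h2 : connectionCoeff E φ (chartDiff φ) (chartDiffInv φ) Γ x b a =
      fderiv ℝ B (φ x) a (Γ x (chartDiffInv φ x b)).1 +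
        B (φ x) ((Γ x (chartDiffInv φ x b)).2 (fderiv ℝ τ (φ x) a)) := rfl
  rw [h2, map_add, h1, hD]
  have hτB' : ∀ v, fderiv ℝ τ (φ x) (B (φ x) v) = v := fun v ↦ (hτB v).eq_of_nhds
  rw [hτB', hRb, neg_add_eq_sub]
  rfl

end TangentConnection

/-! ### The prolonged connection κ' in arbitrary coordinates -/

noncomputable section Prolongation

variable {E : Type*} [NormedAddCommGroup E] [NormedSpace ℝ E]
  {M : Type*} [TopologicalSpace M] [ChartedSpace E M] [IsManifold 𝓘(ℝ, E) ∞ M]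
  {F : Type*} [NormedAddCommGroup F] [NormedSpace ℝ F]
  {V : M → Type*} [TopologicalSpace (TotalSpace F V)]
  [∀ x, AddCommGroup (V x)] [∀ x, Module ℝ (V x)] [∀ x, TopologicalSpace (V x)]
  [FiberBundle F V] [VectorBundle ℝ F V] [ContMDiffVectorBundle ∞ F V 𝓘(ℝ, E)]
  {F' : Type*} [NormedAddCommGroup F'] [NormedSpace ℝ F']
  {W : M → Type*} [TopologicalSpace (TotalSpace F' W)]
  [∀ x, AddCommGroup (W x)] [∀ x, Module ℝ (W x)] [∀ x, TopologicalSpace (W x)]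
  [FiberBundle F' W] [VectorBundle ℝ F' W] [ContMDiffVectorBundle ∞ F' W 𝓘(ℝ, E)]
  {G : Type*} [NormedAddCommGroup G] [NormedSpace ℝ G]
  {G' : Type*} [NormedAddCommGroup G'] [NormedSpace ℝ G']

/-- The exchange map in arbitrary coordinates. -/
theorem jetFiberMap_jetExchange {φ : OpenPartialHomeomorph M E}
    (hφ : φ ∈ IsManifold.maximalAtlas 𝓘(ℝ, E) ∞ M) {L : ∀ y, V y →L[ℝ] G}
    {Γ : ∀ x : M, TangentSpace 𝓘(ℝ, E) x →L[ℝ] JetSpace E E (TangentSpace 𝓘(ℝ, E) : M → Type _) x}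
    (hΓ : ∀ x v, (Γ x v).proj = v) {x : M} (hx : x ∈ φ.source)
    (h : ∀ᶠ y in 𝓝 x, SmoothToModelAt E F L y)
    (j : JetSpace E (F × (E →L[ℝ] F)) (JetSpace E F V) x) :
    jetFiberMap (F × (E →L[ℝ] F)) φ (jetFiberMap F φ L) x (jetExchange Γ j) =
      exchangeModel (connectionCoeff E φ (chartDiff φ) (chartDiffInv φ) Γ x)
        (jetFiberMap (F × (E →L[ℝ] F)) φ (jetFiberMap F φ L) x j) := by
  have hi := mem_jetBaseSet_self (E := E) (F := F) (V := V) x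
  have hA := contDiffAt_localRead hφ hx hi.2 h.self_of_nhds
  have hτ := contDiffAt_chart_comp_symm hφ (IsManifold.chart_mem_maximalAtlas x) hx hi.1
  rw [jetFiberMap, jetReadAt_congr (localRead_jetFiberMap hφ hx h hi) EventuallyEq.rfl]
  -- In the preferred coordinates at `x` the map `jetExchange` is `exchangeModel` by definition,
  -- with Γ read in the preferred chart.
  exact (exchangeModel_jetReadAt hA hτ
    (fun a b ↦ tangentConnection_transform hφ hΓ hx a b) j).symm

theorem eventually_continuousLinearMapAt_section (σ : ∀ y, V y) (x : M) :
    ∀ᶠ y in 𝓝 x, (trivializationAt F V x).continuousLinearMapAt ℝ y (σ y) =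
      (fun z ↦ (trivializationAt F V x
        ⟨(chartAt E x).symm z, σ ((chartAt E x).symm z)⟩).2) (chartAt E x y) := by
  filter_upwards [eventually_mem_baseSet (mem_baseSet_trivializationAt F V x),
    eventually_mem_source (mem_chart_source E x)] with y hy hy'
  rw [(chartAt E x).left_inv hy', Trivialization.continuousLinearMapAt_apply_of_mem ℝ _ hy]

variable [FiniteDimensional ℝ F]

/-- If σ has coordinates u, then κ ∘ σ has coordinates (u, K u), and K is smooth. -/
theorem DifferentiableSectionAt.connection {κ : ∀ x, V x →L[ℝ] JetSpace E F V x}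
    (hκ : IsConnection (fun x v ↦ κ x v)) {σ : ∀ y, V y} {x : M}
    (hσ : DifferentiableSectionAt E F σ x) :
    DifferentiableSectionAt E (F × (E →L[ℝ] F)) (fun y ↦ κ y (σ y)) x := by
  have hi := mem_jetBaseSet_self (E := E) (F := F) (V := V) x
  have hc := IsManifold.chart_mem_maximalAtlas (I := 𝓘(ℝ, E)) (n := ∞) x
  have hcoord := isFiberCoordAt_trivializationAt (E := E) hi.2
  have hK := (contDiffAt_connectionCoeff hc hκ hi.1 hcoord).differentiableAt (by simp)
  refine differentiableSectionAt_of_eventually (hσ.prodMk (hK.clm_apply hσ)) ?_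
  filter_upwards [jetFiberMap_connection hκ.proj hi.1 hcoord,
    eventually_mem_jetBaseSet hi, eventually_continuousLinearMapAt_section (E := E) (F := F) σ x]
    with y h1 h2 h3
  rw [trivializationAt_jetSpace h2, h1, h3, (chartAt E x).left_inv h2.1]

/-- The prolongation of `κ` in arbitrary coordinates. -/
theorem jetFiberMap_jetMap {φ : OpenPartialHomeomorph M E}
    (hφ : φ ∈ IsManifold.maximalAtlas 𝓘(ℝ, E) ∞ M) {L : ∀ y, V y →L[ℝ] G}
    {R : ∀ y, G →L[ℝ] V y} {κ : ∀ x, V x →L[ℝ] JetSpace E F V x}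
    (hκ : IsConnection (fun x v ↦ κ x v)) {x : M} (hx : x ∈ φ.source)
    (h : IsFiberCoordAt E F L R x) (j : JetSpace E F V x) (w : E) :
    (jetFiberMap (F × (E →L[ℝ] F)) φ (jetFiberMap F φ L) x (jetMap (fun y v ↦ κ y v) j)).1 =
        ((jetFiberMap F φ L x j).1, connectionCoeff F φ L R κ x (jetFiberMap F φ L x j).1) ∧
    (jetFiberMap (F × (E →L[ℝ] F)) φ (jetFiberMap F φ L) x (jetMap (fun y v ↦ κ y v) j)).2 w =
      ((jetFiberMap F φ L x j).2 w,
        fderiv ℝ (fun z ↦ connectionCoeff F φ L R κ (φ.symm z)) (φ x) w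
          (jetFiberMap F φ L x j).1 +
        connectionCoeff F φ L R κ x ((jetFiberMap F φ L x j).2 w)) := by
  have hcon := jetFiberMap_connection hκ.proj hx h
  constructor
  · have hs := smoothToModelAt_jetFiberMap hφ hx h.smooth_to
    rw [jetFiberMap_fst _ hx, jetMap, jet_proj, hcon.self_of_nhds, rep_self, jetFiberMap_fst L hx]
  · have h1 := hasFDerivAt_section hφ hx (smoothToModelAt_jetFiberMap hφ hx h.smooth_to).self_of_nhds
      ((differentiableSectionAt_rep j).connection hκ)
    have h2 := hasFDerivAt_rep hφ hx h.smooth_to.self_of_nhds j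
    have h3 := ((contDiffAt_connectionCoeff hφ hκ hx h).differentiableAt (by simp)).hasFDerivAt
    have h4 := h2.prodMk (h3.clm_apply h2)
    -- Along the representative of the jet, κ reads (u, K u) near the point; the product rule then
    -- produces D u + K u_a.
    have h5 : (fun z ↦ jetFiberMap F φ L (φ.symm z) (κ (φ.symm z) (j.rep (φ.symm z)))) =ᶠ[𝓝 (φ x)]
        fun z ↦ (L (φ.symm z) (j.rep (φ.symm z)),
          connectionCoeff F φ L R κ (φ.symm z) (L (φ.symm z) (j.rep (φ.symm z)))) := by
      filter_upwards [eventually_symm hx hcon] with z hz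
      exact hz _
    have h6 := DFunLike.congr_fun (h1.unique (h4.congr_of_eventuallyEq h5)) w
    refine h6.trans ?_
    have h7 : ∀ y, y = x → L y (j.rep y) = (jetFiberMap F φ L x j).1 := by
      rintro _ rfl
      rw [jetFiberMap_fst L hx, rep_self]
    simp only [ContinuousLinearMap.prod_apply, add_apply, ContinuousLinearMap.comp_apply,
      ContinuousLinearMap.flip_apply, h7 _ (φ.left_inv hx)]
    rw [φ.left_inv hx, add_comm]

/-- The coefficients of the prolonged connection `κ'`, where `K` and `D` are the coefficients of `κ`
and their derivatives, and `C` are the coefficients of `Γ`. -/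
def prolongCoeff (K : G →L[ℝ] E →L[ℝ] G) (D : E →L[ℝ] G →L[ℝ] E →L[ℝ] G)
    (C : E →L[ℝ] E →L[ℝ] E) (p : G × (E →L[ℝ] G)) : E →L[ℝ] G × (E →L[ℝ] G) :=
  (K p.1).prod (D.flip p.1 + K.comp p.2 +
    (ContinuousLinearMap.compL ℝ E E G (K p.1 - p.2)).comp C).flip

theorem prolongCoeff_apply (K : G →L[ℝ] E →L[ℝ] G) (D : E →L[ℝ] G →L[ℝ] E →L[ℝ] G)
    (C : E →L[ℝ] E →L[ℝ] E) (p : G × (E →L[ℝ] G)) (w : E) :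
    (prolongCoeff K D C p w).1 = K p.1 w ∧ ∀ b, (prolongCoeff K D C p w).2 b =
      D b p.1 w + K (p.2 b) w + (K p.1 (C b w) - p.2 (C b w)) :=
  ⟨rfl, fun _ ↦ rfl⟩

/-- The exchange puts the first-order slot of `j` back into the base point and moves K y into the
derivative slot. Therefore the result lies over `j`, as a connection of JV must. -/
theorem jetFiberMap_prolongConnection {φ : OpenPartialHomeomorph M E}
    (hφ : φ ∈ IsManifold.maximalAtlas 𝓘(ℝ, E) ∞ M) {L : ∀ y, V y →L[ℝ] G}
    {R : ∀ y, G →L[ℝ] V y} {κ : ∀ x, V x →L[ℝ] JetSpace E F V x}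
    (hκ : IsConnection (fun x v ↦ κ x v))
    {Γ : ∀ x : M, TangentSpace 𝓘(ℝ, E) x →L[ℝ] JetSpace E E (TangentSpace 𝓘(ℝ, E) : M → Type _) x}
    (hΓ : ∀ x v, (Γ x v).proj = v) {x : M} (hx : x ∈ φ.source)
    (h : IsFiberCoordAt E F L R x) (j : JetSpace E F V x) :
    jetFiberMap (F × (E →L[ℝ] F)) φ (jetFiberMap F φ L) x
        (prolongConnection Γ (fun y v ↦ κ y v) x j) =
      (jetFiberMap F φ L x j, prolongCoeff (connectionCoeff F φ L R κ x)
        (fderiv ℝ (fun z ↦ connectionCoeff F φ L R κ (φ.symm z)) (φ x))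
        (connectionCoeff E φ (chartDiff φ) (chartDiffInv φ) Γ x) (jetFiberMap F φ L x j)) := by
  rw [prolongConnection, jetFiberMap_jetExchange hφ hΓ hx h.smooth_to]
  have h1 := fun w ↦ (jetFiberMap_jetMap hφ hκ hx h j w).1
  have h2 := fun w ↦ (jetFiberMap_jetMap hφ hκ hx h j w).2
  refine Prod.ext (Prod.ext ?_ ?_) ?_
  · have h3 := congrArg Prod.fst (h1 0)
    exact h3
  · ext w
    have h3 := congrArg Prod.fst (h2 w)
    exact h3
  · refine ContinuousLinearMap.ext fun w ↦ Prod.ext ?_ (ContinuousLinearMap.ext fun b ↦ ?_)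
    · have h3 := DFunLike.congr_fun (congrArg Prod.snd (h1 0)) w
      exact h3
    · rw [exchangeModel_snd_snd, (prolongCoeff_apply _ _ _ _ w).2, h1 0, h2, h2]
      rfl

end Prolongation

/-! ### Coordinates of Hom bundles, and the dual connection -/

noncomputable section HomCoordinates

variable {E : Type*} [NormedAddCommGroup E] [NormedSpace ℝ E]
  {M : Type*} [TopologicalSpace M] [ChartedSpace E M] [IsManifold 𝓘(ℝ, E) ∞ M]
  {F : Type*} [NormedAddCommGroup F] [NormedSpace ℝ F]
  {V : M → Type*} [TopologicalSpace (TotalSpace F V)]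
  [∀ x, AddCommGroup (V x)] [∀ x, Module ℝ (V x)] [∀ x, TopologicalSpace (V x)]
  [FiberBundle F V] [VectorBundle ℝ F V] [ContMDiffVectorBundle ∞ F V 𝓘(ℝ, E)]
  {F' : Type*} [NormedAddCommGroup F'] [NormedSpace ℝ F']
  {W : M → Type*} [TopologicalSpace (TotalSpace F' W)]
  [∀ x, AddCommGroup (W x)] [∀ x, Module ℝ (W x)] [∀ x, TopologicalSpace (W x)]
  [FiberBundle F' W] [VectorBundle ℝ F' W] [ContMDiffVectorBundle ∞ F' W 𝓘(ℝ, E)]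
  {G : Type*} [NormedAddCommGroup G] [NormedSpace ℝ G]
  {G' : Type*} [NormedAddCommGroup G'] [NormedSpace ℝ G']

variable [∀ x, IsTopologicalAddGroup (W x)] [∀ x, ContinuousSMul ℝ (W x)]

/-- The fibre coordinates of `Hom (V, W)` induced by the fibre coordinates `L'` of `W` and the
inverse `R` of the fibre coordinates of `V`. -/
def homCoord (L' : ∀ y, W y →L[ℝ] G') (R : ∀ y, G →L[ℝ] V y) (y : M) :
    (V y →L[ℝ] W y) →L[ℝ] (G →L[ℝ] G') :=
  ((L' y).postcomp G).comp ((R y).precomp (W y))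

theorem homCoord_apply (L' : ∀ y, W y →L[ℝ] G') (R : ∀ y, G →L[ℝ] V y) (y : M)
    (A : V y →L[ℝ] W y) : homCoord L' R y A = (L' y).comp (A.comp (R y)) := rfl

theorem hom_continuousLinearMapAt {i y : M} (hy : y ∈ (trivializationAt F V i).baseSet)
    (hy' : y ∈ (trivializationAt F' W i).baseSet) :
    (trivializationAt (F →L[ℝ] F') (fun x ↦ V x →L[ℝ] W x) i).continuousLinearMapAt ℝ y =
      homCoord (fun y ↦ (trivializationAt F' W i).continuousLinearMapAt ℝ y)
        (fun y ↦ (trivializationAt F V i).symmL ℝ y) y := by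
  ext1 A
  have h : y ∈ (trivializationAt (F →L[ℝ] F') (fun x ↦ V x →L[ℝ] W x) i).baseSet := ⟨hy, hy'⟩
  rw [Trivialization.continuousLinearMapAt_apply_of_mem ℝ _ h]
  rfl

theorem hom_symmL {i y : M} (hy : y ∈ (trivializationAt F V i).baseSet)
    (hy' : y ∈ (trivializationAt F' W i).baseSet) (B : F →L[ℝ] F') :
    (trivializationAt (F →L[ℝ] F') (fun x ↦ V x →L[ℝ] W x) i).symmL ℝ y B =
      ((trivializationAt F' W i).symmL ℝ y).comp
        (B.comp ((trivializationAt F V i).continuousLinearMapAt ℝ y)) := by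
  have h : y ∈ (trivializationAt (F →L[ℝ] F') (fun x ↦ V x →L[ℝ] W x) i).baseSet := ⟨hy, hy'⟩
  obtain ⟨A, rfl⟩ : ∃ A, (trivializationAt (F →L[ℝ] F')
      (fun x ↦ V x →L[ℝ] W x) i).continuousLinearMapAt ℝ y A = B :=
    ⟨_, Trivialization.continuousLinearMapAt_symmL _ h B⟩
  rw [Trivialization.symmL_continuousLinearMapAt _ h, hom_continuousLinearMapAt hy hy']
  refine ContinuousLinearMap.ext fun v ↦ ?_
  simp only [homCoord_apply, ContinuousLinearMap.comp_apply]
  rw [Trivialization.symmL_continuousLinearMapAt _ hy,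
    Trivialization.symmL_continuousLinearMapAt _ hy']

/-- The reading of the induced coordinates is composition on the left with the reading of `L'` and
on the right with that of `R`; both operations depend smoothly on these readings. -/
theorem SmoothToModelAt.homCoord {L' : ∀ y, W y →L[ℝ] G'} {R : ∀ y, G →L[ℝ] V y} {x : M}
    (h' : SmoothToModelAt E F' L' x) (h : SmoothFromModelAt E F R x) :
    SmoothToModelAt E (F →L[ℝ] F') (homCoord L' R) x := by
  have h1 : ContMDiffAt 𝓘(ℝ, E) 𝓘(ℝ, (F →L[ℝ] F') →L[ℝ] (F →L[ℝ] G')) ∞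
      (fun y ↦ ((L' y).comp ((trivializationAt F' W x).symmL ℝ y)).postcomp F) x :=
    ContMDiffAt.clm_postcomp h'
  have h2 : ContMDiffAt 𝓘(ℝ, E) 𝓘(ℝ, (F →L[ℝ] G') →L[ℝ] (G →L[ℝ] G')) ∞
      (fun y ↦ (((trivializationAt F V x).continuousLinearMapAt ℝ y).comp (R y)).precomp G') x :=
    ContMDiffAt.clm_precomp h
  refine (h2.clm_comp h1).congr_of_eventuallyEq ?_
  filter_upwards [eventually_mem_baseSet (mem_baseSet_trivializationAt F V x),
    eventually_mem_baseSet (mem_baseSet_trivializationAt F' W x)] with y hy hy'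
  refine ContinuousLinearMap.ext fun B ↦ ?_
  rw [ContinuousLinearMap.comp_apply, hom_symmL hy hy']
  rfl

/-- The tautological fibre coordinate of the trivial bundle. -/
def trivialCoord (y : M) : Trivial M ℝ y →L[ℝ] ℝ := ContinuousLinearMap.id ℝ ℝ

theorem trivial_symmL (i y : M) (c : ℝ) :
    (trivializationAt ℝ (Trivial M ℝ) i).symmL ℝ y c = c := by
  have h : y ∈ (trivializationAt ℝ (Trivial M ℝ) i).baseSet := mem_univ y
  have h1 := Trivialization.continuousLinearMapAt_symmL (R := ℝ) _ h c
  rwa [Trivialization.continuousLinearMapAt_apply_of_mem ℝ _ h] at h1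

theorem trivial_continuousLinearMapAt (i y : M) (c : Trivial M ℝ y) :
    (trivializationAt ℝ (Trivial M ℝ) i).continuousLinearMapAt ℝ y c = c := by
  have h : y ∈ (trivializationAt ℝ (Trivial M ℝ) i).baseSet := mem_univ y
  rw [Trivialization.continuousLinearMapAt_apply_of_mem ℝ _ h]
  rfl

theorem smoothToModelAt_trivialCoord (x : M) :
    SmoothToModelAt E ℝ (V := Trivial M ℝ) trivialCoord x := by
  refine (contMDiffAt_const (c := ContinuousLinearMap.id ℝ ℝ)).congr_of_eventuallyEq
    (Eventually.of_forall fun y ↦ ContinuousLinearMap.ext fun c ↦ ?_)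
  exact trivial_symmL x y c

/-- The coordinates of `V*` induced by the inverse `R` of the fibre coordinates of `V`. -/
abbrev dualCoord (R : ∀ y, G →L[ℝ] V y) (y : M) : (V y →L[ℝ] Trivial M ℝ y) →L[ℝ] (G →L[ℝ] ℝ) :=
  homCoord trivialCoord R y

theorem dualCoord_apply (R : ∀ y, G →L[ℝ] V y) (y : M) (α : V y →L[ℝ] Trivial M ℝ y) (u : G) :
    dualCoord R y α u = α (R y u) := rfl

theorem proj_dualConnection (κ : ∀ x, V x →L[ℝ] JetSpace E F V x) (x : M)
    (α : V x →L[ℝ] Trivial M ℝ x) : (dualConnection κ x α).proj = α := by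
  have hx := mem_baseSet_trivializationAt F V x
  refine (hom_symmL hx (mem_univ x) _).trans (ContinuousLinearMap.ext fun v ↦ ?_)
  simp only [ContinuousLinearMap.comp_apply]
  rw [trivial_symmL]
  simp only [dualConnection]
  exact congrArg α (Trivialization.symmL_continuousLinearMapAt _ hx v)

theorem rep_dual {x : M} (j : JetSpace E (F →L[ℝ] ℝ) (fun y ↦ V y →L[ℝ] Trivial M ℝ y) x) :
    ∀ᶠ y in 𝓝 x, ∀ v, j.rep y v = (j.1 + j.2 (chartAt E x y - chartAt E x x))
      ((trivializationAt F V x).continuousLinearMapAt ℝ y v) := by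
  filter_upwards [eventually_mem_baseSet (mem_baseSet_trivializationAt F V x)] with y hy v
  rw [JetSpace.rep, hom_symmL hy (mem_univ y)]
  exact trivial_symmL x y _

/-- The coefficients of the dual connection. -/
def dualCoeff (K : G →L[ℝ] E →L[ℝ] G) (a : G →L[ℝ] ℝ) : E →L[ℝ] G →L[ℝ] ℝ :=
  -((ContinuousLinearMap.compL ℝ G G ℝ a).comp K.flip)

theorem dualCoeff_apply (K : G →L[ℝ] E →L[ℝ] G) (a : G →L[ℝ] ℝ) (w : E) (u : G) :
    dualCoeff K a w u = -a (K u w) := rfl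

/-- The pairing of the representatives of κ*(α) and κ(v) is a function on M, so it can be
differentiated in any coordinates. In the preferred ones the derivative at `x` vanishes by the
definition of κ*; in those of φ and L this vanishing is the claimed formula. -/
theorem jetFiberMap_dualConnection {φ : OpenPartialHomeomorph M E}
    (hφ : φ ∈ IsManifold.maximalAtlas 𝓘(ℝ, E) ∞ M) {L : ∀ y, V y →L[ℝ] G}
    {R : ∀ y, G →L[ℝ] V y} {κ : ∀ x, V x →L[ℝ] JetSpace E F V x}
    (hκ : ∀ x v, (κ x v).proj = v) {x : M} (hx : x ∈ φ.source)
    (h : IsFiberCoordAt E F L R x) (α : V x →L[ℝ] Trivial M ℝ x) :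
    jetFiberMap (F →L[ℝ] ℝ) φ (dualCoord R) x (dualConnection κ x α) =
      (dualCoord R x α, dualCoeff (connectionCoeff F φ L R κ x) (dualCoord R x α)) := by
  have hs : SmoothToModelAt E (F →L[ℝ] ℝ) (dualCoord R) x :=
    (smoothToModelAt_trivialCoord x).homCoord h.smooth_from.self_of_nhds
  have h1 : (jetFiberMap (F →L[ℝ] ℝ) φ (dualCoord R) x (dualConnection κ x α)).1 =
      dualCoord R x α := by
    rw [jetFiberMap_fst _ hx, proj_dualConnection]
  refine Prod.ext h1 ?_
  -- Vectors of the form `L x v` suffice, since `L x` is onto; this form makes the section through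
  -- κ(v) available.
  suffices H : ∀ v : V x, ∀ w, (jetFiberMap (F →L[ℝ] ℝ) φ (dualCoord R) x
      (dualConnection κ x α)).2 w (L x v) =
      -(dualCoord R x α (connectionCoeff F φ L R κ x (L x v) w)) by
    ext w u
    have := H (R x u) w
    rw [h.to_from.self_of_nhds] at this
    exact this
  intro v w
  have d1 := hasFDerivAt_rep hφ hx hs (dualConnection κ x α)
  have d2 := hasFDerivAt_rep hφ hx h.smooth_to.self_of_nhds (κ x v)
  have d3 := d1.clm_apply d2
  have hi := mem_jetBaseSet_self (E := E) (F := F) (V := V) x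
  have hτ : DifferentiableAt ℝ (chartAt E x ∘ φ.symm) (φ x) :=
    (contDiffAt_chart_comp_symm hφ (IsManifold.chart_mem_maximalAtlas x) hx
      hi.1).differentiableAt (by simp)
  have d4 := hτ.hasFDerivAt.sub_const (chartAt E x x)
  have d5 := (((dualConnection κ x α).2.hasFDerivAt.comp _ d4).const_add
    (dualConnection κ x α).1).clm_apply (((κ x v).2.hasFDerivAt.comp _ d4).const_add (κ x v).1)
  have heq : (fun z ↦ dualCoord R (φ.symm z) ((dualConnection κ x α).rep (φ.symm z))
      (L (φ.symm z) ((κ x v).rep (φ.symm z)))) =ᶠ[𝓝 (φ x)] fun z ↦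
      ((dualConnection κ x α).1 + (dualConnection κ x α).2
        ((chartAt E x ∘ φ.symm) z - chartAt E x x))
      ((κ x v).1 + (κ x v).2 ((chartAt E x ∘ φ.symm) z - chartAt E x x)) := by
    filter_upwards [eventually_symm hx h.from_to, eventually_symm hx (rep_dual (dualConnection κ x α)),
      eventually_symm hx (continuousLinearMapAt_rep (κ x v))] with z z1 z2 z3
    rw [dualCoord_apply, z1, z2, z3]
    rfl
  have key := DFunLike.congr_fun ((d3.congr_of_eventuallyEq heq.symm).unique d5) w
  have e1 : ∀ y, y = x → L y ((κ x v).rep y) = L x v := by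
    rintro _ rfl
    rw [rep_self, hκ]
  have e2 : ∀ y, y = x → dualCoord R y ((dualConnection κ x α).rep y) = dualCoord R x α := by
    rintro _ rfl
    rw [rep_self, proj_dualConnection]
  have e3 : (jetFiberMap F φ L x (κ x v)).2 = connectionCoeff F φ L R κ x (L x v) := by
    simp only [connectionCoeff, ContinuousLinearMap.comp_apply]
    rw [h.from_to.self_of_nhds]
    rfl
  -- The two terms of the product rule in the preferred coordinates cancel.
  have e4 : ∀ e, (dualConnection κ x α).2 e (κ x v).1 = -(dualConnection κ x α).1 ((κ x v).2 e) := by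
    intro e
    have : (trivializationAt F V x).symmL ℝ x (κ x v).1 = v := hκ x v
    simp only [dualConnection]
    change -(α ((trivializationAt F V x).symmL ℝ x
      ((κ x ((trivializationAt F V x).symmL ℝ x (κ x v).1)).2 e))) = _
    rw [this]
    rfl
  simp only [add_apply, ContinuousLinearMap.comp_apply, ContinuousLinearMap.flip_apply,
    e1 _ (φ.left_inv hx), e2 _ (φ.left_inv hx), e3, Function.comp_apply, φ.left_inv hx, sub_self,
    map_zero, add_zero] at key
  rw [e4, add_neg_cancel] at key
  exact eq_neg_of_add_eq_zero_right key

end HomCoordinates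

/-! ### The tensor product of connections -/

noncomputable section TensorConnection

variable {E : Type*} [NormedAddCommGroup E] [NormedSpace ℝ E]
  {M : Type*} [TopologicalSpace M] [ChartedSpace E M] [IsManifold 𝓘(ℝ, E) ∞ M]
  {F : Type*} [NormedAddCommGroup F] [NormedSpace ℝ F]
  {V : M → Type*} [TopologicalSpace (TotalSpace F V)]
  [∀ x, AddCommGroup (V x)] [∀ x, Module ℝ (V x)] [∀ x, TopologicalSpace (V x)]
  [FiberBundle F V] [VectorBundle ℝ F V] [ContMDiffVectorBundle ∞ F V 𝓘(ℝ, E)]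
  {F' : Type*} [NormedAddCommGroup F'] [NormedSpace ℝ F']
  {W : M → Type*} [TopologicalSpace (TotalSpace F' W)]
  [∀ x, AddCommGroup (W x)] [∀ x, Module ℝ (W x)] [∀ x, TopologicalSpace (W x)]
  [FiberBundle F' W] [VectorBundle ℝ F' W] [ContMDiffVectorBundle ∞ F' W 𝓘(ℝ, E)]
  {G : Type*} [NormedAddCommGroup G] [NormedSpace ℝ G]
  {G' : Type*} [NormedAddCommGroup G'] [NormedSpace ℝ G']

variable [∀ x, IsTopologicalAddGroup (W x)] [∀ x, ContinuousSMul ℝ (W x)]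

theorem homCoord_smulRight (L' : ∀ y, W y →L[ℝ] G') (R : ∀ y, G →L[ℝ] V y) (y : M)
    (α : V y →L[ℝ] Trivial M ℝ y) (t : W y) :
    homCoord L' R y (ContinuousLinearMap.smulRight (M₁ := V y) (S := ℝ) α t) =
      (dualCoord R y α).smulRight (L' y t) := by
  ext u
  exact map_smul (L' y) _ _

theorem differentiableSectionAt_smulRight {x : M} (t : JetSpace E F' W x)
    (α : JetSpace E (F →L[ℝ] ℝ) (fun y ↦ V y →L[ℝ] Trivial M ℝ y) x) :
    DifferentiableSectionAt E (F →L[ℝ] F') (V := fun y ↦ V y →L[ℝ] W y)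
      (fun y ↦ (α.rep y).smulRight (t.rep y)) x := by
  refine differentiableSectionAt_of_eventually (f := fun z ↦
    ContinuousLinearMap.smulRightL ℝ F F' (α.1 + α.2 (z - chartAt E x x))
      (t.1 + t.2 (z - chartAt E x x))) ?_ ?_
  · have h1 : DifferentiableAt ℝ (fun z ↦ α.1 + α.2 (z - chartAt E x x)) (chartAt E x x) := by
      fun_prop
    have h2 : DifferentiableAt ℝ (fun z ↦ t.1 + t.2 (z - chartAt E x x)) (chartAt E x x) := by
      fun_prop
    exact ((ContinuousLinearMap.smulRightL ℝ F F').differentiableAt.comp _ h1).clm_apply h2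
  · filter_upwards [eventually_mem_baseSet (mem_baseSet_trivializationAt F V x),
      eventually_mem_baseSet (mem_baseSet_trivializationAt F' W x), rep_dual α,
      continuousLinearMapAt_rep t] with y h1 h2 h3 h4
    rw [hom_continuousLinearMapAt h1 h2, homCoord_smulRight, h4]
    refine ContinuousLinearMap.ext fun u ↦ ?_
    simp only [ContinuousLinearMap.smulRight_apply, dualCoord_apply]
    rw [h3, Trivialization.continuousLinearMapAt_symmL _ h1]
    rfl

/-- The Leibniz rule, applied to the product of the representatives of the two jets. -/
theorem jetFiberMap_jetTensor {φ : OpenPartialHomeomorph M E}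
    (hφ : φ ∈ IsManifold.maximalAtlas 𝓘(ℝ, E) ∞ M) {R : ∀ y, G →L[ℝ] V y}
    {L' : ∀ y, W y →L[ℝ] G'} {x : M} (hx : x ∈ φ.source)
    (h : SmoothFromModelAt E F R x) (h' : SmoothToModelAt E F' L' x) (t : JetSpace E F' W x)
    (α : JetSpace E (F →L[ℝ] ℝ) (fun y ↦ V y →L[ℝ] Trivial M ℝ y) x) (w : E) :
    (jetFiberMap (F →L[ℝ] F') φ (homCoord L' R) x (jetTensor t α)).1 =
      (jetFiberMap (F →L[ℝ] ℝ) φ (dualCoord R) x α).1.smulRight (jetFiberMap F' φ L' x t).1 ∧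
    (jetFiberMap (F →L[ℝ] F') φ (homCoord L' R) x (jetTensor t α)).2 w =
      (jetFiberMap (F →L[ℝ] ℝ) φ (dualCoord R) x α).1.smulRight ((jetFiberMap F' φ L' x t).2 w) +
      ((jetFiberMap (F →L[ℝ] ℝ) φ (dualCoord R) x α).2 w).smulRight
        (jetFiberMap F' φ L' x t).1 := by
  have hs : SmoothToModelAt E (F →L[ℝ] ℝ) (dualCoord R) x :=
    (smoothToModelAt_trivialCoord x).homCoord h
  constructor
  · rw [jetFiberMap_fst _ hx, jetTensor, jet_proj, homCoord_smulRight, rep_self, rep_self,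
      jetFiberMap_fst _ hx, jetFiberMap_fst _ hx]
  · have d := hasFDerivAt_section hφ hx (h'.homCoord h) (differentiableSectionAt_smulRight t α)
    have d1 := hasFDerivAt_rep hφ hx hs α
    have d2 := hasFDerivAt_rep hφ hx h' t
    have d3 := (ContinuousLinearMap.smulRightL ℝ G G').hasFDerivAt_of_bilinear d1 d2
    have key := DFunLike.congr_fun (d.unique (d3.congr_of_eventuallyEq
      (Eventually.of_forall fun z ↦ homCoord_smulRight L' R (φ.symm z) _ _))) w
    have e1 : ∀ y, y = x → dualCoord R y (α.rep y) =
        (jetFiberMap (F →L[ℝ] ℝ) φ (dualCoord R) x α).1 := by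
      rintro _ rfl
      rw [rep_self, jetFiberMap_fst _ hx]
    have e2 : ∀ y, y = x → L' y (t.rep y) = (jetFiberMap F' φ L' x t).1 := by
      rintro _ rfl
      rw [rep_self, jetFiberMap_fst _ hx]
    refine key.trans ?_
    simp only [add_apply, e1 _ (φ.left_inv hx), e2 _ (φ.left_inv hx)]
    rfl

/-- The coefficients of the tensor product connection. -/
def tensorCoeff (Λ : G' →L[ℝ] E →L[ℝ] G') (K : G →L[ℝ] E →L[ℝ] G) (B : G →L[ℝ] G') :
    E →L[ℝ] G →L[ℝ] G' :=
  (Λ.comp B).flip - (ContinuousLinearMap.compL ℝ G G G' B).comp K.flip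

theorem tensorCoeff_apply (Λ : G' →L[ℝ] E →L[ℝ] G') (K : G →L[ℝ] E →L[ℝ] G) (B : G →L[ℝ] G')
    (w : E) (u : G) : tensorCoeff Λ K B w u = Λ (B u) w - B (K u w) := rfl

theorem isLinearMap_tensorCoeff (Λ : G' →L[ℝ] E →L[ℝ] G') (K : G →L[ℝ] E →L[ℝ] G) :
    IsLinearMap ℝ (tensorCoeff Λ K) := by
  constructor
  · intro B C
    ext w u
    simp only [tensorCoeff_apply, add_apply, map_add]
    abel
  · intro c B
    ext w u
    simp only [tensorCoeff_apply, smul_apply, map_smul, smul_sub]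

/-- The jets of tensor products of parallel sections in coordinates. -/
theorem jetFiberMap_jetTensor_of_parallel {φ : OpenPartialHomeomorph M E}
    (hφ : φ ∈ IsManifold.maximalAtlas 𝓘(ℝ, E) ∞ M) {R : ∀ y, G →L[ℝ] V y}
    {L' : ∀ y, W y →L[ℝ] G'} {x : M} (hx : x ∈ φ.source)
    (h : SmoothFromModelAt E F R x) (h' : SmoothToModelAt E F' L' x)
    {Λ : G' →L[ℝ] E →L[ℝ] G'} {K : G →L[ℝ] E →L[ℝ] G} {t : JetSpace E F' W x} {t₀ : W x}
    {α : JetSpace E (F →L[ℝ] ℝ) (fun y ↦ V y →L[ℝ] Trivial M ℝ y) x}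
    {α₀ : V x →L[ℝ] Trivial M ℝ x}
    (ht : jetFiberMap F' φ L' x t = (L' x t₀, Λ (L' x t₀)))
    (hα : jetFiberMap (F →L[ℝ] ℝ) φ (dualCoord R) x α =
      (dualCoord R x α₀, dualCoeff K (dualCoord R x α₀))) :
    jetFiberMap (F →L[ℝ] F') φ (homCoord L' R) x (jetTensor t α) =
      (homCoord L' R x (ContinuousLinearMap.smulRight (M₁ := V x) (S := ℝ) α₀ t₀),
        tensorCoeff Λ K
          (homCoord L' R x (ContinuousLinearMap.smulRight (M₁ := V x) (S := ℝ) α₀ t₀))) := by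
  have key := jetFiberMap_jetTensor hφ hx h h' t α
  rw [homCoord_smulRight]
  refine Prod.ext ?_ ?_
  · rw [(key 0).1, ht, hα]
  · ext w u
    rw [(key w).2, ht, hα, tensorCoeff_apply]
    simp only [add_apply, ContinuousLinearMap.smulRight_apply, dualCoeff_apply, neg_smul, map_smul,
      smul_apply]
    abel

variable [FiniteDimensional ℝ F]

/-- The expansion of A as the sum of b^i ⊗ A(b_i), with the basis of the model carried to the fibre
by the preferred trivialization. -/
theorem tensorConnection_expand (x : M) (A : V x →L[ℝ] W x) :
    ∑ i, ContinuousLinearMap.smulRight (M₁ := V x) (S := ℝ)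
      ((LinearMap.toContinuousLinearMap ((Module.finBasis ℝ F).coord i)).comp
        ((trivializationAt F V x).continuousLinearMapAt ℝ x))
      (A ((trivializationAt F V x).symmL ℝ x (Module.finBasis ℝ F i))) = A := by
  ext v
  have hx := mem_baseSet_trivializationAt F V x
  conv_rhs => rw [← Trivialization.symmL_continuousLinearMapAt (R := ℝ) _ hx v,
    ← (Module.finBasis ℝ F).sum_repr ((trivializationAt F V x).continuousLinearMapAt ℝ x v)]
  rw [map_sum, map_sum, sum_apply]
  refine Finset.sum_congr rfl fun i _ ↦ ?_
  rw [map_smul, map_smul]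
  rfl

/-- On decomposable tensors the coordinates are linear in the tensor itself, so the sum over the
basis in the definition collapses. The coefficients keep no trace of the basis. -/
theorem jetFiberMap_tensorConnection {φ : OpenPartialHomeomorph M E}
    (hφ : φ ∈ IsManifold.maximalAtlas 𝓘(ℝ, E) ∞ M) {R : ∀ y, G →L[ℝ] V y}
    {L' : ∀ y, W y →L[ℝ] G'} {x : M} (hx : x ∈ φ.source)
    (h : SmoothFromModelAt E F R x) (h' : SmoothToModelAt E F' L' x)
    {Λ : G' →L[ℝ] E →L[ℝ] G'} {K : G →L[ℝ] E →L[ℝ] G}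
    {l : ∀ x, W x → JetSpace E F' W x}
    {m : ∀ x, (V x →L[ℝ] Trivial M ℝ x) →
      JetSpace E (F →L[ℝ] ℝ) (fun y ↦ V y →L[ℝ] Trivial M ℝ y) x}
    (hl : ∀ t, jetFiberMap F' φ L' x (l x t) = (L' x t, Λ (L' x t)))
    (hm : ∀ α, jetFiberMap (F →L[ℝ] ℝ) φ (dualCoord R) x (m x α) =
      (dualCoord R x α, dualCoeff K (dualCoord R x α))) (A : V x →L[ℝ] W x) :
    jetFiberMap (F →L[ℝ] F') φ (homCoord L' R) x (tensorConnection l m x A) =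
      (homCoord L' R x A, tensorCoeff Λ K (homCoord L' R x A)) := by
  have hlin : ∀ B : V x →L[ℝ] W x, (homCoord L' R x B, tensorCoeff Λ K (homCoord L' R x B)) =
      (LinearMap.prod LinearMap.id
        (isLinearMap_tensorCoeff Λ K).mk') (homCoord L' R x B) :=
    fun B ↦ rfl
  conv_rhs => rw [← tensorConnection_expand (F := F) x A, hlin, map_sum, map_sum]
  rw [tensorConnection, map_sum]
  refine Finset.sum_congr rfl fun i _ ↦ ?_
  rw [← hlin]
  exact jetFiberMap_jetTensor_of_parallel hφ hx h h' (hl _) (hm _)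

end TensorConnection

/-! ### κ', κ* and κ' ⊗ κ* are linear connections -/

noncomputable section LinearConnections

variable {E : Type*} [NormedAddCommGroup E] [NormedSpace ℝ E]
  {M : Type*} [TopologicalSpace M] [ChartedSpace E M] [IsManifold 𝓘(ℝ, E) ∞ M]
  {F : Type*} [NormedAddCommGroup F] [NormedSpace ℝ F]
  {V : M → Type*} [TopologicalSpace (TotalSpace F V)]
  [∀ x, AddCommGroup (V x)] [∀ x, Module ℝ (V x)] [∀ x, TopologicalSpace (V x)]
  [FiberBundle F V] [VectorBundle ℝ F V] [ContMDiffVectorBundle ∞ F V 𝓘(ℝ, E)]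
  {F' : Type*} [NormedAddCommGroup F'] [NormedSpace ℝ F']
  {W : M → Type*} [TopologicalSpace (TotalSpace F' W)]
  [∀ x, AddCommGroup (W x)] [∀ x, Module ℝ (W x)] [∀ x, TopologicalSpace (W x)]
  [FiberBundle F' W] [VectorBundle ℝ F' W] [ContMDiffVectorBundle ∞ F' W 𝓘(ℝ, E)]
  {G : Type*} [NormedAddCommGroup G] [NormedSpace ℝ G]
  {G' : Type*} [NormedAddCommGroup G'] [NormedSpace ℝ G']

/-- A fibre map `k : V → JV` which in the preferred coordinates is given by smooth linear
coefficients is a linear connection. -/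
theorem isLinearConnection_of_coord [FiniteDimensional ℝ F] {k : ∀ x, V x → JetSpace E F V x}
    (h : ∀ x, ∃ (L : ∀ y, V y →L[ℝ] F) (Λ : M → F → E →L[ℝ] F),
      (∀ᶠ y in 𝓝 x, (trivializationAt F V x).continuousLinearMapAt ℝ y = L y) ∧
      (∀ y, IsLinearMap ℝ (Λ y)) ∧
      (∀ u, ContMDiffAt 𝓘(ℝ, E) 𝓘(ℝ, E →L[ℝ] F) ∞ (fun y ↦ Λ y u) x) ∧
      ∀ᶠ y in 𝓝 x, ∀ v, jetFiberMap F (chartAt E x) L y (k y v) = (L y v, Λ y (L y v))) :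
    IsLinearConnection k := by
  have key : ∀ x, ∃ Λ : M → F →L[ℝ] E →L[ℝ] F,
      ContMDiffAt 𝓘(ℝ, E) 𝓘(ℝ, F →L[ℝ] E →L[ℝ] F) ∞ Λ x ∧
      ∀ᶠ y in 𝓝 x, ∀ v, jetFiberMap F (chartAt E x)
        (fun y ↦ (trivializationAt F V x).continuousLinearMapAt ℝ y) y (k y v) =
        ((trivializationAt F V x).continuousLinearMapAt ℝ y v,
          Λ y ((trivializationAt F V x).continuousLinearMapAt ℝ y v)) := by
    intro x
    obtain ⟨L, Λ, hL, hlin, hΛ, hk⟩ := h x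
    -- Linearity in the fibre and smoothness on each fixed vector give a smooth family of operators,
    -- because the model is finite-dimensional.
    refine ⟨fun y ↦ LinearMap.toContinuousLinearMap (hlin y).mk', contMDiffAt_clm_of_apply hΛ, ?_⟩
    filter_upwards [hL.eventually_nhds, hk, eventually_mem_source (mem_chart_source E x)]
      with y h1 h2 h3 v
    rw [jetFiberMap_congr h3 h1, h2, h1.self_of_nhds]
    rfl
  -- At the centre `x` the preferred coordinates of a jet are the jet itself, so the coordinate
  -- formula becomes an equation for `k x v`; projection and linearity are read off from it.
  have key' : ∀ x, ∃ Λ : F →L[ℝ] E →L[ℝ] F, ∀ v, k x v =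
      ((trivializationAt F V x).continuousLinearMapAt ℝ x v,
        Λ ((trivializationAt F V x).continuousLinearMapAt ℝ x v)) := by
    intro x
    obtain ⟨Λ, -, hk⟩ := key x
    refine ⟨Λ x, fun v ↦ ?_⟩
    have := hk.self_of_nhds v
    rwa [jetFiberMap_chartAt_self] at this
  refine ⟨⟨fun x v ↦ ?_, fun v₀ ↦ ?_⟩, fun x ↦ ?_⟩
  · obtain ⟨Λ, hΛ⟩ := key' x
    rw [JetSpace.proj, hΛ]
    exact Trivialization.symmL_continuousLinearMapAt _ (mem_baseSet_trivializationAt F V x) v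
  · obtain ⟨Λ, hΛ, hk⟩ := key v₀.proj
    rw [contMDiffAt_totalSpace]
    have hp : ContMDiffAt (𝓘(ℝ, E).prod 𝓘(ℝ, F)) 𝓘(ℝ, E) ∞ (TotalSpace.proj : TotalSpace F V → M)
        v₀ := contMDiffAt_proj V
    refine ⟨hp, ?_⟩
    have hi : ContMDiffAt (𝓘(ℝ, E).prod 𝓘(ℝ, F)) 𝓘(ℝ, F) ∞
        (fun v : TotalSpace F V ↦ (trivializationAt F V v₀.proj v).2) v₀ :=
      ((contMDiffAt_totalSpace (f := fun v : TotalSpace F V ↦ v)).1 contMDiffAt_id).2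
    refine (hi.prodMk_space ((hΛ.comp v₀ hp).clm_apply hi)).congr_of_eventuallyEq ?_
    have hc : ContinuousAt (TotalSpace.proj : TotalSpace F V → M) v₀ := hp.continuousAt
    filter_upwards [hc.eventually hk, hc.eventually (eventually_mem_jetBaseSet
      (mem_jetBaseSet_self (E := E) (F := F) (V := V) v₀.proj))] with v h1 h2
    have h2' : v.proj ∈ (trivializationAt (F × (E →L[ℝ] F)) (JetSpace E F V) v₀.proj).baseSet := h2
    have h3 := h1 v.snd
    rw [← trivializationAt_jetSpace h2, Trivialization.continuousLinearMapAt_apply_of_mem ℝ _ h2',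
      Trivialization.continuousLinearMapAt_apply_of_mem ℝ _ h2.2] at h3
    exact h3
  · obtain ⟨Λ, hΛ⟩ := key' x
    constructor
    · intro v w
      rw [hΛ, hΛ, hΛ, map_add, map_add]
      rfl
    · intro c v
      rw [hΛ, hΛ, map_smul, map_smul]
      rfl

theorem eventually_trivializationAt_jetSpace (x : M) :
    ∀ᶠ y in 𝓝 x,
      (trivializationAt (F × (E →L[ℝ] F)) (JetSpace E F V) x).continuousLinearMapAt ℝ y =
      jetFiberMap F (chartAt E x) (fun y ↦ (trivializationAt F V x).continuousLinearMapAt ℝ y)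
        y := by
  filter_upwards [eventually_mem_jetBaseSet (mem_jetBaseSet_self (E := E) (F := F) (V := V) x)]
    with y hy using trivializationAt_jetSpace hy

theorem isLinearMap_prolongCoeff (K : G →L[ℝ] E →L[ℝ] G) (D : E →L[ℝ] G →L[ℝ] E →L[ℝ] G)
    (C : E →L[ℝ] E →L[ℝ] E) : IsLinearMap ℝ (prolongCoeff K D C) := by
  constructor
  · intro p q
    refine ContinuousLinearMap.ext fun w ↦ Prod.ext ?_ (ContinuousLinearMap.ext fun b ↦ ?_)
    · simp only [add_apply, Prod.fst_add, prolongCoeff_apply, map_add]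
    · simp only [add_apply, Prod.snd_add, Prod.fst_add, prolongCoeff_apply, map_add]
      abel
  · intro c p
    refine ContinuousLinearMap.ext fun w ↦ Prod.ext ?_ (ContinuousLinearMap.ext fun b ↦ ?_)
    · simp only [smul_apply, Prod.smul_fst, prolongCoeff_apply, map_smul]
    · simp only [smul_apply, Prod.smul_snd, Prod.smul_fst, prolongCoeff_apply, map_smul, smul_add,
        smul_sub]

theorem isLinearMap_dualCoeff (K : G →L[ℝ] E →L[ℝ] G) : IsLinearMap ℝ (dualCoeff K) := by
  constructor
  · intro a b
    ext w u
    simp only [dualCoeff_apply, add_apply]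
    abel
  · intro c a
    ext w u
    simp only [dualCoeff_apply, smul_apply, smul_neg]

variable [FiniteDimensional ℝ E] [FiniteDimensional ℝ F] [FiniteDimensional ℝ G]

/-- Smoothness is tested on fixed vectors, where only evaluations, sums and differences of K, D and
C remain. -/
theorem contMDiffAt_prolongCoeff {K : M → G →L[ℝ] E →L[ℝ] G} {D : M → E →L[ℝ] G →L[ℝ] E →L[ℝ] G}
    {C : M → E →L[ℝ] E →L[ℝ] E} {x : M}
    (hK : ContMDiffAt 𝓘(ℝ, E) 𝓘(ℝ, G →L[ℝ] E →L[ℝ] G) ∞ K x)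
    (hD : ContMDiffAt 𝓘(ℝ, E) 𝓘(ℝ, E →L[ℝ] G →L[ℝ] E →L[ℝ] G) ∞ D x)
    (hC : ContMDiffAt 𝓘(ℝ, E) 𝓘(ℝ, E →L[ℝ] E →L[ℝ] E) ∞ C x) (p : G × (E →L[ℝ] G)) :
    ContMDiffAt 𝓘(ℝ, E) 𝓘(ℝ, E →L[ℝ] G × (E →L[ℝ] G)) ∞
      (fun y ↦ prolongCoeff (K y) (D y) (C y) p) x := by
  refine contMDiffAt_clm_of_apply fun w ↦ ?_
  have hw : ContMDiffAt 𝓘(ℝ, E) 𝓘(ℝ, E) ∞ (fun _ : M ↦ w) x := contMDiffAt_const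
  have hp : ContMDiffAt 𝓘(ℝ, E) 𝓘(ℝ, G) ∞ (fun _ : M ↦ p.1) x := contMDiffAt_const
  have hp' : ContMDiffAt 𝓘(ℝ, E) 𝓘(ℝ, E →L[ℝ] G) ∞ (fun _ : M ↦ p.2) x := contMDiffAt_const
  have h1' := hK.clm_apply hp
  refine (h1'.clm_apply hw).prodMk_space (contMDiffAt_clm_of_apply fun b ↦ ?_)
  have hb : ContMDiffAt 𝓘(ℝ, E) 𝓘(ℝ, E) ∞ (fun _ : M ↦ b) x := contMDiffAt_const
  have hCb := (hC.clm_apply hb).clm_apply hw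
  have hpb : ContMDiffAt 𝓘(ℝ, E) 𝓘(ℝ, G) ∞ (fun _ : M ↦ p.2 b) x := contMDiffAt_const
  exact ((((hD.clm_apply hb).clm_apply hp).clm_apply hw).add ((hK.clm_apply hpb).clm_apply hw)).add
    ((h1'.clm_apply hCb).sub (hp'.clm_apply hCb))

theorem contMDiffAt_dualCoeff {K : M → G →L[ℝ] E →L[ℝ] G} {x : M}
    (hK : ContMDiffAt 𝓘(ℝ, E) 𝓘(ℝ, G →L[ℝ] E →L[ℝ] G) ∞ K x) (a : G →L[ℝ] ℝ) :
    ContMDiffAt 𝓘(ℝ, E) 𝓘(ℝ, E →L[ℝ] G →L[ℝ] ℝ) ∞ (fun y ↦ dualCoeff (K y) a) x := by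
  refine contMDiffAt_clm_of_apply fun w ↦ contMDiffAt_clm_of_apply fun u ↦ ?_
  exact ((contMDiffAt_const (c := a)).clm_apply
    ((hK.clm_apply (contMDiffAt_const (c := u))).clm_apply (contMDiffAt_const (c := w)))).neg

theorem contMDiffAt_tensorCoeff {Λ : M → G' → E →L[ℝ] G'} {K : M → G →L[ℝ] E →L[ℝ] G}
    (hl : ∀ y, IsLinearMap ℝ (Λ y)) [FiniteDimensional ℝ G'] {x : M}
    (hΛ : ∀ u, ContMDiffAt 𝓘(ℝ, E) 𝓘(ℝ, E →L[ℝ] G') ∞ (fun y ↦ Λ y u) x)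
    (hK : ContMDiffAt 𝓘(ℝ, E) 𝓘(ℝ, G →L[ℝ] E →L[ℝ] G) ∞ K x) (B : G →L[ℝ] G') :
    ContMDiffAt 𝓘(ℝ, E) 𝓘(ℝ, E →L[ℝ] G →L[ℝ] G') ∞
      (fun y ↦ tensorCoeff (LinearMap.toContinuousLinearMap (hl y).mk') (K y) B) x := by
  refine contMDiffAt_clm_of_apply fun w ↦ contMDiffAt_clm_of_apply fun u ↦ ?_
  exact ((hΛ (B u)).clm_apply contMDiffAt_const).sub ((contMDiffAt_const (c := B)).clm_apply
    ((hK.clm_apply (contMDiffAt_const (c := u))).clm_apply (contMDiffAt_const (c := w))))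

/-- The coefficients of the prolonged connection in the given coordinates. -/
def prolongedCoeff (φ : OpenPartialHomeomorph M E) (L : ∀ y, V y →L[ℝ] G)
    (R : ∀ y, G →L[ℝ] V y) (κ : ∀ x, V x →L[ℝ] JetSpace E F V x)
    (Γ : ∀ x : M, TangentSpace 𝓘(ℝ, E) x →L[ℝ] JetSpace E E (TangentSpace 𝓘(ℝ, E) : M → Type _) x)
    (y : M) : G × (E →L[ℝ] G) →L[ℝ] E →L[ℝ] G × (E →L[ℝ] G) :=
  LinearMap.toContinuousLinearMap (isLinearMap_prolongCoeff (connectionCoeff F φ L R κ y)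
    (fderiv ℝ (fun z ↦ connectionCoeff F φ L R κ (φ.symm z)) (φ y))
    (connectionCoeff E φ (chartDiff φ) (chartDiffInv φ) Γ y)).mk'

section

variable {κ : ∀ x, V x →L[ℝ] JetSpace E F V x}
  {Γ : ∀ x : M, TangentSpace 𝓘(ℝ, E) x →L[ℝ] JetSpace E E (TangentSpace 𝓘(ℝ, E) : M → Type _) x}

theorem contMDiffAt_prolongedCoeff (hκ : IsConnection (fun x v ↦ κ x v))
    (hΓ : IsConnection (fun x v ↦ Γ x v)) {φ : OpenPartialHomeomorph M E}
    (hφ : φ ∈ IsManifold.maximalAtlas 𝓘(ℝ, E) ∞ M) {L : ∀ y, V y →L[ℝ] G}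
    {R : ∀ y, G →L[ℝ] V y} {x : M} (hx : x ∈ φ.source) (h : IsFiberCoordAt E F L R x)
    (p : G × (E →L[ℝ] G)) :
    ContMDiffAt 𝓘(ℝ, E) 𝓘(ℝ, E →L[ℝ] G × (E →L[ℝ] G)) ∞
      (fun y ↦ prolongedCoeff φ L R κ Γ y p) x :=
  contMDiffAt_prolongCoeff (contMDiffAt_connectionCoeff hφ hκ hx h)
    (((contDiffAt_connectionCoeff hφ hκ hx h).fderiv_right (m := ∞) le_rfl).contMDiffAt.comp x
      (contMDiffAt_of_mem_maximalAtlas hφ hx))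
    (contMDiffAt_connectionCoeff hφ hΓ hx (isFiberCoordAt_chartDiff hφ hx)) p

/-- The prolongation of a linear connection is a linear connection. -/
theorem isLinearConnection_prolongConnection (hκ : IsConnection (fun x v ↦ κ x v))
    (hΓ : IsConnection (fun x v ↦ Γ x v)) :
    IsLinearConnection (prolongConnection Γ (fun x v ↦ κ x v)) := by
  refine isLinearConnection_of_coord fun x ↦ ?_
  have hi := mem_jetBaseSet_self (E := E) (F := F) (V := V) x
  have hc := IsManifold.chart_mem_maximalAtlas (I := 𝓘(ℝ, E)) (n := ∞) x
  have hcoord := isFiberCoordAt_trivializationAt (E := E) hi.2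
  refine ⟨_, fun y ↦ prolongedCoeff (chartAt E x) _ _ κ Γ y, eventually_trivializationAt_jetSpace x,
    fun y ↦ LinearMap.isLinear _, contMDiffAt_prolongedCoeff hκ hΓ hc hi.1 hcoord, ?_⟩
  filter_upwards [hcoord.eventually, eventually_mem_source hi.1] with y h1 h2 j
  exact jetFiberMap_prolongConnection hc hκ hΓ.proj h2 h1 j

theorem eventually_trivializationAt_dual (x : M) :
    ∀ᶠ y in 𝓝 x, (trivializationAt (F →L[ℝ] ℝ)
      (fun y ↦ V y →L[ℝ] Trivial M ℝ y) x).continuousLinearMapAt ℝ y =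
      dualCoord (fun y ↦ (trivializationAt F V x).symmL ℝ y) y := by
  filter_upwards [eventually_mem_baseSet (mem_baseSet_trivializationAt F V x)] with y hy
  rw [hom_continuousLinearMapAt hy (mem_univ y)]
  refine ContinuousLinearMap.ext fun α ↦ ContinuousLinearMap.ext fun u ↦ ?_
  exact trivial_continuousLinearMapAt x y _

/-- The dual of a linear connection is a linear connection. -/
theorem isLinearConnection_dualConnection (hκ : IsConnection (fun x v ↦ κ x v)) :
    IsLinearConnection (dualConnection κ) := by
  refine isLinearConnection_of_coord fun x ↦ ?_
  have hi := mem_jetBaseSet_self (E := E) (F := F) (V := V) x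
  have hc := IsManifold.chart_mem_maximalAtlas (I := 𝓘(ℝ, E)) (n := ∞) x
  have hcoord := isFiberCoordAt_trivializationAt (E := E) hi.2
  refine ⟨_, fun y ↦ dualCoeff (connectionCoeff F (chartAt E x) _ _ κ y),
    eventually_trivializationAt_dual x, fun y ↦ isLinearMap_dualCoeff _,
    contMDiffAt_dualCoeff (contMDiffAt_connectionCoeff hc hκ hi.1 hcoord), ?_⟩
  filter_upwards [hcoord.eventually, eventually_mem_source hi.1] with y h1 h2 α
  exact jetFiberMap_dualConnection hc hκ.proj h2 h1 α

/-- The coefficients of the connection `κ' ⊗ κ*`. -/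
theorem jetFiberMap_overconnection (hκ : IsConnection (fun x v ↦ κ x v))
    (hΓ : ∀ x v, (Γ x v).proj = v) {φ : OpenPartialHomeomorph M E}
    (hφ : φ ∈ IsManifold.maximalAtlas 𝓘(ℝ, E) ∞ M) {L : ∀ y, V y →L[ℝ] G}
    {R : ∀ y, G →L[ℝ] V y} {x : M} (hx : x ∈ φ.source) (h : IsFiberCoordAt E F L R x)
    (A : V x →L[ℝ] JetSpace E F V x) :
    jetFiberMap (F →L[ℝ] F × (E →L[ℝ] F)) φ (homCoord (jetFiberMap F φ L) R) x
        (overconnection Γ κ x A) =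
      (homCoord (jetFiberMap F φ L) R x A,
        tensorCoeff (prolongedCoeff φ L R κ Γ x) (connectionCoeff F φ L R κ x)
          (homCoord (jetFiberMap F φ L) R x A)) :=
  jetFiberMap_tensorConnection hφ hx h.smooth_from.self_of_nhds
    (smoothToModelAt_jetFiberMap hφ hx h.smooth_to).self_of_nhds
    (jetFiberMap_prolongConnection hφ hκ hΓ hx h) (jetFiberMap_dualConnection hφ hκ.proj hx h) A

/-- Near `x` the preferred trivialization of Hom (V, JV) is given by the induced coordinates, in
which the coefficients of κ' ⊗ κ* are known. -/
theorem eventually_trivializationAt_hom_jetSpace (x : M) :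
    ∀ᶠ y in 𝓝 x, Trivialization.continuousLinearMapAt (E := fun y ↦ V y →L[ℝ] JetSpace E F V y) ℝ
      (trivializationAt (F →L[ℝ] F × (E →L[ℝ] F)) (fun y ↦ V y →L[ℝ] JetSpace E F V y) x) y =
      homCoord (jetFiberMap F (chartAt E x)
        (fun y ↦ (trivializationAt F V x).continuousLinearMapAt ℝ y))
        (fun y ↦ (trivializationAt F V x).symmL ℝ y) y := by
  filter_upwards [eventually_mem_jetBaseSet (mem_jetBaseSet_self (E := E) (F := F) (V := V) x)]
    with y hy
  have hy' : y ∈ (trivializationAt (F × (E →L[ℝ] F)) (JetSpace E F V) x).baseSet := hy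
  rw [hom_continuousLinearMapAt hy.2 hy']
  refine ContinuousLinearMap.ext fun A ↦ ?_
  rw [homCoord_apply, homCoord_apply, trivializationAt_jetSpace hy]

/-- The tensor product of the prolongation and the dual of a linear connection is a linear
connection. -/
theorem isLinearConnection_overconnection (hκ : IsConnection (fun x v ↦ κ x v))
    (hΓ : IsConnection (fun x v ↦ Γ x v)) : IsLinearConnection (overconnection Γ κ) := by
  refine isLinearConnection_of_coord fun x ↦ ?_
  have hi := mem_jetBaseSet_self (E := E) (F := F) (V := V) x
  have hc := IsManifold.chart_mem_maximalAtlas (I := 𝓘(ℝ, E)) (n := ∞) x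
  have hcoord := isFiberCoordAt_trivializationAt (E := E) hi.2
  refine ⟨_, fun y ↦ tensorCoeff (prolongedCoeff (chartAt E x) _ _ κ Γ y)
    (connectionCoeff F (chartAt E x) _ _ κ y), eventually_trivializationAt_hom_jetSpace x,
    fun y ↦ isLinearMap_tensorCoeff _ _,
    contMDiffAt_tensorCoeff _ (contMDiffAt_prolongedCoeff hκ hΓ hc hi.1 hcoord)
      (contMDiffAt_connectionCoeff hc hκ hi.1 hcoord), ?_⟩
  filter_upwards [hcoord.eventually, eventually_mem_source hi.1] with y h1 h2 A
  exact jetFiberMap_overconnection hκ hΓ.proj hc h2 h1 A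

/-- `κ' ⊗ κ*` on decomposable elements. -/
theorem overconnection_smulRight (hκ : IsConnection (fun x v ↦ κ x v))
    (hΓ : ∀ x v, (Γ x v).proj = v) (x : M) (t : JetSpace E F V x) (α : V x →L[ℝ] Trivial M ℝ x) :
    overconnection Γ κ x (ContinuousLinearMap.smulRight (M₁ := V x) (S := ℝ) α t) =
      jetTensor (prolongConnection Γ (fun y v ↦ κ y v) x t) (dualConnection κ x α) := by
  have hi := mem_jetBaseSet_self (E := E) (F := F) (V := V) x
  have hc := IsManifold.chart_mem_maximalAtlas (I := 𝓘(ℝ, E)) (n := ∞) x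
  have hcoord := isFiberCoordAt_trivializationAt (E := E) hi.2
  have h1 := jetFiberMap_overconnection hκ hΓ hc hi.1 hcoord
    (ContinuousLinearMap.smulRight (M₁ := V x) (S := ℝ) α t)
  have h2 := jetFiberMap_jetTensor_of_parallel hc hi.1 hcoord.smooth_from.self_of_nhds
    (smoothToModelAt_jetFiberMap hc hi.1 hcoord.smooth_to).self_of_nhds
    (Λ := prolongedCoeff (chartAt E x) _ _ κ Γ x)
    (jetFiberMap_prolongConnection hc hκ hΓ hi.1 hcoord t)
    (jetFiberMap_dualConnection hc hκ.proj hi.1 hcoord α)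
  have h3 := h1.trans h2.symm
  -- The coordinates of a jet depend only on the germ of the fibre coordinates, so the induced ones
  -- may be replaced by the preferred trivialization, in which a jet at `x` is its own coordinate.
  have h4 := jetFiberMap_congr (E := E) (F := F →L[ℝ] F × (E →L[ℝ] F))
    (V := fun y ↦ V y →L[ℝ] JetSpace E F V y) hi.1 (eventually_trivializationAt_hom_jetSpace x)
  rw [← h4] at h3
  exact (jetFiberMap_chartAt_self x _).symm.trans (h3.trans (jetFiberMap_chartAt_self x _))

end

end LinearConnections

/-! ### Reduction to the affine bundle of linear connections -/

noncomputable section ConnectionBundle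

variable {E : Type*} [NormedAddCommGroup E] [NormedSpace ℝ E]
  {M : Type*} [TopologicalSpace M] [ChartedSpace E M] [IsManifold 𝓘(ℝ, E) ∞ M]
  {F : Type*} [NormedAddCommGroup F] [NormedSpace ℝ F]
  {V : M → Type*} [TopologicalSpace (TotalSpace F V)]
  [∀ x, AddCommGroup (V x)] [∀ x, Module ℝ (V x)] [∀ x, TopologicalSpace (V x)]
  [FiberBundle F V] [VectorBundle ℝ F V] [ContMDiffVectorBundle ∞ F V 𝓘(ℝ, E)]
  {F' : Type*} [NormedAddCommGroup F'] [NormedSpace ℝ F']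
  {W : M → Type*} [TopologicalSpace (TotalSpace F' W)]
  [∀ x, AddCommGroup (W x)] [∀ x, Module ℝ (W x)] [∀ x, TopologicalSpace (W x)]
  [FiberBundle F' W] [VectorBundle ℝ F' W] [ContMDiffVectorBundle ∞ F' W 𝓘(ℝ, E)]
  {G : Type*} [NormedAddCommGroup G] [NormedSpace ℝ G]
  {G' : Type*} [NormedAddCommGroup G'] [NormedSpace ℝ G']

/-- In the preferred coordinates the representative is an affine function of the chart. -/
theorem contMDiffAt_rep {x : M} (j : JetSpace E F V x) :
    ContMDiffAt 𝓘(ℝ, E) (𝓘(ℝ, E).prod 𝓘(ℝ, F)) ∞ (fun y ↦ TotalSpace.mk' F y (j.rep y)) x := by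
  rw [contMDiffAt_section]
  have h1 : ContMDiffAt 𝓘(ℝ, E) 𝓘(ℝ, E) ∞ (fun y ↦ chartAt E x y - chartAt E x x) x :=
    (contMDiffAt_of_mem_maximalAtlas (IsManifold.chart_mem_maximalAtlas x)
      (mem_chart_source E x)).sub contMDiffAt_const
  have h2 : ContMDiffAt 𝓘(ℝ, E) 𝓘(ℝ, F) ∞
      (fun y ↦ j.1 + j.2 (chartAt E x y - chartAt E x x)) x :=
    contMDiffAt_const.add ((contMDiffAt_const (c := j.2)).clm_apply h1)
  refine h2.congr_of_eventuallyEq ?_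
  filter_upwards [continuousLinearMapAt_rep j,
    eventually_mem_baseSet (mem_baseSet_trivializationAt F V x)] with y h3 h4
  rw [← h3, Trivialization.continuousLinearMapAt_apply_of_mem ℝ _ h4]

theorem continuousLinearMapAt_proj {i y : M} (hy : y ∈ jetBaseSet E F V i) (j : JetSpace E F V y) :
    (trivializationAt F V i).continuousLinearMapAt ℝ y j.proj =
      ((trivializationAt (F × (E →L[ℝ] F)) (JetSpace E F V) i).continuousLinearMapAt ℝ y j).1 := by
  rw [trivializationAt_jetSpace hy, jetFiberMap_fst _ hy.1]

/-- The elements of the bundle of connections in coordinates. -/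
theorem homCoord_jetFiberMap_fst {φ : OpenPartialHomeomorph M E} {L : ∀ y, V y →L[ℝ] G}
    {R : ∀ y, G →L[ℝ] V y} {x : M} (hx : x ∈ φ.source) (hLR : ∀ u, L x (R x u) = u)
    {A : V x →L[ℝ] JetSpace E F V x} (hA : A ∈ connectionBundle E F V x) (u : G) :
    (homCoord (jetFiberMap F φ L) R x A u).1 = u := by
  change (jetFiberMap F φ L x (A (R x u))).1 = u
  rw [jetFiberMap_fst _ hx, hA, hLR]

variable [FiniteDimensional ℝ E] [FiniteDimensional ℝ F] {κ : ∀ x, V x →L[ℝ] JetSpace E F V x}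
  {Γ : ∀ x : M, TangentSpace 𝓘(ℝ, E) x →L[ℝ] JetSpace E E (TangentSpace 𝓘(ℝ, E) : M → Type _) x}

/-- In the preferred coordinates C consists of the maps whose first component is the identity, and
the representative of a jet is affine in the chart. The representative therefore stays in C near `x`
as soon as its value is in C and the first component of its derivative vanishes. -/
theorem overconnection_mem_jetsIn (hκ : IsConnection (fun x v ↦ κ x v))
    (hΓ : ∀ x v, (Γ x v).proj = v) {x : M} {A : V x →L[ℝ] JetSpace E F V x}
    (hA : A ∈ connectionBundle E F V x) :
    overconnection Γ κ x A ∈ jetsIn (F := F →L[ℝ] F × (E →L[ℝ] F))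
      (fun y ↦ (connectionBundle E F V y : Set (V y →L[ℝ] JetSpace E F V y))) x := by
  have hi := mem_jetBaseSet_self (E := E) (F := F) (V := V) x
  have hc := IsManifold.chart_mem_maximalAtlas (I := 𝓘(ℝ, E)) (n := ∞) x
  have hcoord := isFiberCoordAt_trivializationAt (E := E) hi.2
  have h1 := jetFiberMap_overconnection hκ hΓ hc hi.1 hcoord A
  have h4 := jetFiberMap_congr (E := E) (F := F →L[ℝ] F × (E →L[ℝ] F))
    (V := fun y ↦ V y →L[ℝ] JetSpace E F V y) hi.1 (eventually_trivializationAt_hom_jetSpace x)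
  rw [← h4] at h1
  have h2 := (jetFiberMap_chartAt_self x (overconnection Γ κ x A)).symm.trans h1
  set j := overconnection Γ κ x A
  have hfst := homCoord_jetFiberMap_fst hi.1 hcoord.to_from.self_of_nhds hA
  have hj1 : ∀ u, (j.1 u).1 = u := fun u ↦
    (congrArg Prod.fst (DFunLike.congr_fun (congrArg Prod.fst h2) u)).trans (hfst u)
  -- The first component is K u from κ' minus K u from κ*.
  have hj2 : ∀ w u, (j.2 w u).1 = 0 := by
    intro w u
    refine (congrArg Prod.fst (DFunLike.congr_fun (DFunLike.congr_fun
      (congrArg Prod.snd h2) w) u)).trans ?_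
    rw [tensorCoeff_apply, Prod.fst_sub, hfst]
    refine (congrArg₂ (· - ·) ((prolongCoeff_apply _ _ _ _ w).1) rfl).trans ?_
    rw [hfst, sub_self]
  refine ⟨j.rep, contMDiffAt_rep j, ?_, jet_rep j⟩
  filter_upwards [eventually_mem_jetBaseSet hi] with y hy v
  have hy' : y ∈ (trivializationAt (F × (E →L[ℝ] F)) (JetSpace E F V) x).baseSet := hy
  have h5 : j.rep y v = (trivializationAt (F × (E →L[ℝ] F)) (JetSpace E F V) x).symmL ℝ y
      ((j.1 + j.2 (chartAt E x y - chartAt E x x))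
        ((trivializationAt F V x).continuousLinearMapAt ℝ y v)) := by
    rw [JetSpace.rep, hom_symmL hy.2 hy']
    rfl
  have h6 : (trivializationAt F V x).continuousLinearMapAt ℝ y (j.rep y v).proj =
      (trivializationAt F V x).continuousLinearMapAt ℝ y v := by
    rw [continuousLinearMapAt_proj hy, h5, Trivialization.continuousLinearMapAt_symmL _ hy',
      add_apply, Prod.fst_add, hj1, hj2, add_zero]
  have h7 := congrArg ((trivializationAt F V x).symmL ℝ y) h6
  rwa [Trivialization.symmL_continuousLinearMapAt _ hy.2,
    Trivialization.symmL_continuousLinearMapAt _ hy.2] at h7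

/-- The connection `κ' ⊗ κ*` is reducible to an affine connection of the bundle of connections. -/
theorem isReducibleToAffineConnection_overconnection (hκ : IsConnection (fun x v ↦ κ x v))
    (hΓ : IsConnection (fun x v ↦ Γ x v)) :
    IsReducibleToAffineConnection (connectionBundle E F V) (overconnection Γ κ) := by
  have h := isLinearConnection_overconnection hκ hΓ
  refine ⟨fun x A _ ↦ h.proj x A, fun x A hA ↦ overconnection_mem_jetsIn hκ hΓ.proj hA,
    h.smooth.contMDiffOn, fun x A _ B _ t ↦ ?_⟩
  rw [AffineMap.lineMap_apply_module, AffineMap.lineMap_apply_module, (h.linear x).map_add,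
    (h.linear x).map_smul, (h.linear x).map_smul]

end ConnectionBundle

/-! ### Vertical jets and covariant derivatives in coordinates -/

noncomputable section CovariantDerivative

variable {E : Type*} [NormedAddCommGroup E] [NormedSpace ℝ E]
  {M : Type*} [TopologicalSpace M] [ChartedSpace E M] [IsManifold 𝓘(ℝ, E) ∞ M]
  {F : Type*} [NormedAddCommGroup F] [NormedSpace ℝ F]
  {V : M → Type*} [TopologicalSpace (TotalSpace F V)]
  [∀ x, AddCommGroup (V x)] [∀ x, Module ℝ (V x)] [∀ x, TopologicalSpace (V x)]
  [FiberBundle F V] [VectorBundle ℝ F V] [ContMDiffVectorBundle ∞ F V 𝓘(ℝ, E)]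
  {F' : Type*} [NormedAddCommGroup F'] [NormedSpace ℝ F']
  {W : M → Type*} [TopologicalSpace (TotalSpace F' W)]
  [∀ x, AddCommGroup (W x)] [∀ x, Module ℝ (W x)] [∀ x, TopologicalSpace (W x)]
  [FiberBundle F' W] [VectorBundle ℝ F' W] [ContMDiffVectorBundle ∞ F' W 𝓘(ℝ, E)]
  {G : Type*} [NormedAddCommGroup G] [NormedSpace ℝ G]
  {G' : Type*} [NormedAddCommGroup G'] [NormedSpace ℝ G']

theorem proj_sub {x : M} (j j' : JetSpace E F V x) : (j - j').proj = j.proj - j'.proj :=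
  map_sub ((trivializationAt F V x).symmL ℝ x) j.1 j'.1

theorem fst_eq_zero_of_proj_eq_zero {x : M} {j : JetSpace E F V x} (hj : j.proj = 0) :
    j.1 = 0 := by
  have h := congrArg ((trivializationAt F V x).continuousLinearMapAt ℝ x) hj
  rw [JetSpace.proj, Trivialization.continuousLinearMapAt_symmL _
    (mem_baseSet_trivializationAt F V x), map_zero] at h
  exact h

/-- Vertical jets in coordinates. -/
theorem coord_vert {φ : OpenPartialHomeomorph M E}
    (hφ : φ ∈ IsManifold.maximalAtlas 𝓘(ℝ, E) ∞ M) {L : ∀ y, V y →L[ℝ] G} {x : M}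
    (hx : x ∈ φ.source) {j : JetSpace E F V x} (hj : j.proj = 0) (X : TangentSpace 𝓘(ℝ, E) x) :
    L x (j.vert X) = (jetFiberMap F φ L x j).2 (chartDiff φ x X) := by
  have h1 := fst_eq_zero_of_proj_eq_zero hj
  have h2 : fderiv ℝ (chartAt E x ∘ φ.symm) (φ x) (chartDiff φ x X) = X := by
    rw [← continuousLinearMapAt_comp_chartDiffInv hφ hx (mem_chart_source E x),
      ContinuousLinearMap.comp_apply, chartDiffInv_chartDiff hφ hx]
    exact (tangentSpace_symmL_self (E := E) x _).symm.trans
      (Trivialization.symmL_continuousLinearMapAt _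
        (mem_baseSet_trivializationAt E (TangentSpace 𝓘(ℝ, E)) x) X)
  have h3 : (jetFiberMap F φ L x j).2 (chartDiff φ x X) =
      fderiv ℝ (localRead F L φ x) (φ x) (chartDiff φ x X) j.1 + localRead F L φ x (φ x)
        (j.2 (fderiv ℝ (chartAt E x ∘ φ.symm) (φ x) (chartDiff φ x X))) := rfl
  -- The value of a vertical jet is zero, which removes the term with the derivative of the fibre
  -- coordinates; what remains transforms as a tensor.
  rw [h3, h1, map_zero, zero_add, h2]
  simp only [localRead, ContinuousLinearMap.comp_apply]
  rw [φ.left_inv hx]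
  rfl

theorem proj_jet_sub {k : ∀ x, V x → JetSpace E F V x} (hk : ∀ x v, (k x v).proj = v)
    (σ : ∀ y, V y) (x : M) : (jet E F σ x - k x (σ x)).proj = 0 := by
  rw [proj_sub, jet_proj, hk, sub_self]

/-- Covariant derivatives in coordinates. -/
theorem coord_covDeriv {φ : OpenPartialHomeomorph M E}
    (hφ : φ ∈ IsManifold.maximalAtlas 𝓘(ℝ, E) ∞ M) {L : ∀ y, V y →L[ℝ] G} {x : M}
    (hx : x ∈ φ.source) {k : ∀ x, V x → JetSpace E F V x} (hk : ∀ x v, (k x v).proj = v)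
    (σ : ∀ y, V y) (X : TangentSpace 𝓘(ℝ, E) x) :
    L x (covDeriv k σ x X) = (jetFiberMap F φ L x (jet E F σ x)).2 (chartDiff φ x X) -
      (jetFiberMap F φ L x (k x (σ x))).2 (chartDiff φ x X) := by
  rw [covDeriv, coord_vert hφ hx (proj_jet_sub hk σ x), map_sub]
  rfl

/-- The section `σ` of class `C^n` in coordinates. -/
theorem contMDiffAt_coord {L : ∀ y, V y →L[ℝ] G} {x : M} (h : SmoothToModelAt E F L x)
    {σ : ∀ y, V y}
    (hσ : ContMDiffAt 𝓘(ℝ, E) (𝓘(ℝ, E).prod 𝓘(ℝ, F)) ∞ (fun y ↦ TotalSpace.mk' F y (σ y)) x) :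
    ContMDiffAt 𝓘(ℝ, E) 𝓘(ℝ, G) ∞ (fun y ↦ L y (σ y)) x := by
  rw [contMDiffAt_section] at hσ
  refine (ContMDiffAt.clm_apply h hσ).congr_of_eventuallyEq ?_
  filter_upwards [eventually_mem_baseSet (mem_baseSet_trivializationAt F V x)] with y hy
  rw [ContinuousLinearMap.comp_apply, Trivialization.symmL_apply _ hy,
    Trivialization.symm_apply_apply_mk _ hy]

theorem differentiableSectionAt_of_contMDiffAt {σ : ∀ y, V y} {x : M}
    (hσ : ContMDiffAt 𝓘(ℝ, E) (𝓘(ℝ, E).prod 𝓘(ℝ, F)) 1 (fun y ↦ TotalSpace.mk' F y (σ y)) x) :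
    DifferentiableSectionAt E F σ x := by
  rw [contMDiffAt_section] at hσ
  have h1 : ContMDiffAt 𝓘(ℝ, E) 𝓘(ℝ, F) 1
      (fun y ↦ (trivializationAt F V x (TotalSpace.mk' F y (σ y))).2)
      ((chartAt E x).symm (chartAt E x x)) := by
    rwa [(chartAt E x).left_inv (mem_chart_source E x)]
  have h2 : ContMDiffAt 𝓘(ℝ, E) 𝓘(ℝ, E) 1 (chartAt E x).symm (chartAt E x x) :=
    (contMDiffAt_symm_of_mem_maximalAtlas (IsManifold.chart_mem_maximalAtlas (n := ∞) x)
      ((chartAt E x).map_source (mem_chart_source E x))).of_le (by simp)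
  exact (h1.comp _ h2).contDiffAt.differentiableAt (by simp)

theorem eventually_differentiableSectionAt {σ : ∀ y, V y} {x : M}
    (hσ : ContMDiffAt 𝓘(ℝ, E) (𝓘(ℝ, E).prod 𝓘(ℝ, F)) ∞ (fun y ↦ TotalSpace.mk' F y (σ y)) x) :
    ∀ᶠ y in 𝓝 x, DifferentiableSectionAt E F σ y := by
  -- Unlike C^∞ at a point, C^1 at a point extends to a neighbourhood, and differentiability needs
  -- no more.
  have h : ContMDiffAt 𝓘(ℝ, E) (𝓘(ℝ, E).prod 𝓘(ℝ, F)) 1 (fun y ↦ TotalSpace.mk' F y (σ y)) x :=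
    hσ.of_le (by simp)
  filter_upwards [(contMDiffAt_iff_contMDiffAt_nhds (by simp)).1 h] with y hy
  exact differentiableSectionAt_of_contMDiffAt hy

end CovariantDerivative

/-! ### The covariant derivative of κ with respect to κ' ⊗ κ* -/

noncomputable section CovariantDerivativeOfConnection

variable {E : Type*} [NormedAddCommGroup E] [NormedSpace ℝ E]
  {M : Type*} [TopologicalSpace M] [ChartedSpace E M] [IsManifold 𝓘(ℝ, E) ∞ M]
  {F : Type*} [NormedAddCommGroup F] [NormedSpace ℝ F]
  {V : M → Type*} [TopologicalSpace (TotalSpace F V)]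
  [∀ x, AddCommGroup (V x)] [∀ x, Module ℝ (V x)] [∀ x, TopologicalSpace (V x)]
  [FiberBundle F V] [VectorBundle ℝ F V] [ContMDiffVectorBundle ∞ F V 𝓘(ℝ, E)]
  {F' : Type*} [NormedAddCommGroup F'] [NormedSpace ℝ F']
  {W : M → Type*} [TopologicalSpace (TotalSpace F' W)]
  [∀ x, AddCommGroup (W x)] [∀ x, Module ℝ (W x)] [∀ x, TopologicalSpace (W x)]
  [FiberBundle F' W] [VectorBundle ℝ F' W] [ContMDiffVectorBundle ∞ F' W 𝓘(ℝ, E)]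
  {G : Type*} [NormedAddCommGroup G] [NormedSpace ℝ G]
  {G' : Type*} [NormedAddCommGroup G'] [NormedSpace ℝ G']

variable [FiniteDimensional ℝ E] [FiniteDimensional ℝ F] {κ : ∀ x, V x →L[ℝ] JetSpace E F V x}
  {Γ : ∀ x : M, TangentSpace 𝓘(ℝ, E) x →L[ℝ] JetSpace E E (TangentSpace 𝓘(ℝ, E) : M → Type _) x}

/-- A linear connection, as a section of the bundle of connections, in coordinates. -/
theorem homCoord_connection {φ : OpenPartialHomeomorph M E} {L : ∀ y, V y →L[ℝ] G}
    {R : ∀ y, G →L[ℝ] V y} (hκ : ∀ x v, (κ x v).proj = v) {x : M} (hx : x ∈ φ.source)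
    (h : IsFiberCoordAt E F L R x) :
    ∀ᶠ y in 𝓝 x, homCoord (jetFiberMap F φ L) R y (κ y) =
      ContinuousLinearMap.inl ℝ G (E →L[ℝ] G) + ContinuousLinearMap.compL ℝ G (E →L[ℝ] G) _
        (ContinuousLinearMap.inr ℝ G (E →L[ℝ] G)) (connectionCoeff F φ L R κ y) := by
  filter_upwards [jetFiberMap_connection hκ hx h, h.to_from] with y h1 h2
  refine ContinuousLinearMap.ext fun u ↦ ?_
  refine (h1 (R y u)).trans ?_
  rw [h2]
  refine Prod.ext ?_ ?_
  · exact (add_zero u).symm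
  · exact (zero_add (connectionCoeff F φ L R κ y u)).symm

theorem hasFDerivAt_inl_add_inr_comp {K : E → G →L[ℝ] E →L[ℝ] G} {z : E}
    (hK : DifferentiableAt ℝ K z) :
    HasFDerivAt (fun z ↦ ContinuousLinearMap.inl ℝ G (E →L[ℝ] G) +
      ContinuousLinearMap.compL ℝ G (E →L[ℝ] G) _ (ContinuousLinearMap.inr ℝ G (E →L[ℝ] G)) (K z))
      ((ContinuousLinearMap.compL ℝ G (E →L[ℝ] G) _
        (ContinuousLinearMap.inr ℝ G (E →L[ℝ] G))).comp (fderiv ℝ K z)) z :=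
  (((ContinuousLinearMap.compL ℝ G (E →L[ℝ] G) _
    (ContinuousLinearMap.inr ℝ G (E →L[ℝ] G))).hasFDerivAt).comp z hK.hasFDerivAt).const_add _

/-- In coordinates κ is u ↦ (u, K u), whose dependence on the point is that of K. -/
theorem differentiableSectionAt_connection (hκ : IsConnection (fun x v ↦ κ x v)) (x : M) :
    DifferentiableSectionAt E (F →L[ℝ] F × (E →L[ℝ] F)) (V := fun y ↦ V y →L[ℝ] JetSpace E F V y)
      κ x := by
  have hi := mem_jetBaseSet_self (E := E) (F := F) (V := V) x
  have hc := IsManifold.chart_mem_maximalAtlas (I := 𝓘(ℝ, E)) (n := ∞) x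
  have hcoord := isFiberCoordAt_trivializationAt (E := E) hi.2
  have hK := (contDiffAt_connectionCoeff hc hκ hi.1 hcoord).differentiableAt (by simp)
  refine differentiableSectionAt_of_eventually
    (hasFDerivAt_inl_add_inr_comp hK).differentiableAt ?_
  filter_upwards [homCoord_connection hκ.proj hi.1 hcoord, eventually_mem_source hi.1,
    eventually_trivializationAt_hom_jetSpace (E := E) (F := F) (V := V) x] with y h1 h2 h3
  rw [h3, h1, (chartAt E x).left_inv h2]

/-- The curvature coefficients, where `K` and `D` are the coefficients of a linear connection and
their derivatives. -/
def curvCoeff (K : G →L[ℝ] E →L[ℝ] G) (D : E →L[ℝ] G →L[ℝ] E →L[ℝ] G) (a b : E) (u : G) : G :=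
  D a u b - D b u a - K (K u b) a + K (K u a) b

/-- The algebra behind the third assertion. On the graph of K, the C term of `prolongCoeff` is
applied to K u - K u = 0, so Γ disappears; subtracting the rest from the derivative of K leaves the
curvature expression. -/
theorem sub_tensorCoeff_prolongCoeff (K : G →L[ℝ] E →L[ℝ] G) (D : E →L[ℝ] G →L[ℝ] E →L[ℝ] G)
    (C : E →L[ℝ] E →L[ℝ] E) {Λ : G × (E →L[ℝ] G) →L[ℝ] E →L[ℝ] G × (E →L[ℝ] G)}
    (hΛ : ∀ p, Λ p = prolongCoeff K D C p) {T : G →L[ℝ] G × (E →L[ℝ] G)}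
    (hT : ∀ u, T u = (u, K u)) (a : E) (u : G) :
    ((0, D a u) - tensorCoeff Λ K T a u).1 = 0 ∧
    ∀ b, ((0, D a u) - tensorCoeff Λ K T a u).2 b = curvCoeff K D a b u := by
  have h7 := prolongCoeff_apply K D C (u, K u) a
  rw [tensorCoeff_apply, hT, hT, hΛ]
  constructor
  · rw [Prod.fst_sub, Prod.fst_sub, h7.1, sub_self, sub_zero]
  · intro b
    rw [Prod.snd_sub, Prod.snd_sub, sub_apply, sub_apply, h7.2, curvCoeff]
    abel

variable [FiniteDimensional ℝ G]

/-- The covariant derivative of `κ` with respect to `κ' ⊗ κ*` in coordinates. -/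
theorem coord_covDeriv_overconnection (hκ : IsConnection (fun x v ↦ κ x v))
    (hΓ : IsConnection (fun x v ↦ Γ x v)) {φ : OpenPartialHomeomorph M E}
    (hφ : φ ∈ IsManifold.maximalAtlas 𝓘(ℝ, E) ∞ M) {L : ∀ y, V y →L[ℝ] G}
    {R : ∀ y, G →L[ℝ] V y} {x : M} (hx : x ∈ φ.source) (h : IsFiberCoordAt E F L R x)
    (X : TangentSpace 𝓘(ℝ, E) x) (v : V x) :
    (jetFiberMap F φ L x (covDeriv (overconnection Γ κ) κ x X v)).1 = 0 ∧
    ∀ b, (jetFiberMap F φ L x (covDeriv (overconnection Γ κ) κ x X v)).2 b =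
      curvCoeff (connectionCoeff F φ L R κ x)
        (fderiv ℝ (fun z ↦ connectionCoeff F φ L R κ (φ.symm z)) (φ x))
        (chartDiff φ x X) b (L x v) := by
  have hs := smoothToModelAt_jetFiberMap hφ hx h.smooth_to
  have hK := (contDiffAt_connectionCoeff hφ hκ hx h).differentiableAt (by simp)
  have hcon := homCoord_connection hκ.proj hx h
  have h1 := hasFDerivAt_section hφ hx (hs.self_of_nhds.homCoord h.smooth_from.self_of_nhds)
    (differentiableSectionAt_connection hκ x)
  -- The identity component of κ is constant, so its derivative in coordinates is (0, D).
  have h2 := h1.unique ((hasFDerivAt_inl_add_inr_comp hK).congr_of_eventuallyEq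
    (eventually_symm hx hcon))
  have h3 := coord_covDeriv hφ (L := homCoord (jetFiberMap F φ L) R) hx
    (isLinearConnection_overconnection hκ hΓ).proj κ X
  rw [h2, jetFiberMap_overconnection hκ hΓ.proj hφ hx h, hcon.self_of_nhds] at h3
  have h4 := DFunLike.congr_fun h3 (L x v)
  have h5 : jetFiberMap F φ L x (covDeriv (overconnection Γ κ) κ x X v) =
      homCoord (jetFiberMap F φ L) R x (covDeriv (overconnection Γ κ) κ x X) (L x v) := by
    rw [homCoord_apply, ContinuousLinearMap.comp_apply, ContinuousLinearMap.comp_apply,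
      h.from_to.self_of_nhds]
  rw [h5, h4]
  exact sub_tensorCoeff_prolongCoeff _ _ _ (fun _ ↦ rfl)
    (fun u ↦ Prod.ext (add_zero u) (zero_add (connectionCoeff F φ L R κ x u))) _ _

/-- Since ∇κ takes vertical values, `vert` identifies them with elements of T*M ⊗ V. -/
theorem proj_covDeriv_overconnection (hκ : IsConnection (fun x v ↦ κ x v))
    (hΓ : IsConnection (fun x v ↦ Γ x v)) (x : M) (X : TangentSpace 𝓘(ℝ, E) x) (v : V x) :
    (covDeriv (overconnection Γ κ) κ x X v).proj = 0 := by
  have hi := mem_jetBaseSet_self (E := E) (F := F) (V := V) x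
  have hc := IsManifold.chart_mem_maximalAtlas (I := 𝓘(ℝ, E)) (n := ∞) x
  have hcoord := isFiberCoordAt_trivializationAt (E := E) hi.2
  have h1 := (coord_covDeriv_overconnection hκ hΓ hc hi.1 hcoord X v).1
  rw [jetFiberMap_fst _ hi.1] at h1
  rw [← hcoord.from_to.self_of_nhds (covDeriv (overconnection Γ κ) κ x X v).proj, h1, map_zero]

/-- The vertical part of the covariant derivative of `κ` in coordinates. -/
theorem coord_vert_covDeriv_overconnection (hκ : IsConnection (fun x v ↦ κ x v))
    (hΓ : IsConnection (fun x v ↦ Γ x v)) {φ : OpenPartialHomeomorph M E}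
    (hφ : φ ∈ IsManifold.maximalAtlas 𝓘(ℝ, E) ∞ M) {L : ∀ y, V y →L[ℝ] G}
    {R : ∀ y, G →L[ℝ] V y} {x : M} (hx : x ∈ φ.source) (h : IsFiberCoordAt E F L R x)
    (X Y : TangentSpace 𝓘(ℝ, E) x) (v : V x) :
    L x ((covDeriv (overconnection Γ κ) κ x X v).vert Y) =
      curvCoeff (connectionCoeff F φ L R κ x)
        (fderiv ℝ (fun z ↦ connectionCoeff F φ L R κ (φ.symm z)) (φ x))
        (chartDiff φ x X) (chartDiff φ x Y) (L x v) := by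
  rw [coord_vert hφ hx (proj_covDeriv_overconnection hκ hΓ x X v),
    (coord_covDeriv_overconnection hκ hΓ hφ hx h X v).2]

/-- The covariant derivative of `κ` with respect to `κ' ⊗ κ*` does not depend on `Γ`. -/
theorem covDeriv_overconnection_eq (hκ : IsConnection (fun x v ↦ κ x v))
    (hΓ : IsConnection (fun x v ↦ Γ x v))
    {Γ₁ : ∀ x : M, TangentSpace 𝓘(ℝ, E) x →L[ℝ]
      JetSpace E E (TangentSpace 𝓘(ℝ, E) : M → Type _) x}
    (hΓ₁ : IsConnection (fun x v ↦ Γ₁ x v)) (x : M) :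
    covDeriv (overconnection Γ₁ κ) κ x = covDeriv (overconnection Γ κ) κ x := by
  have hi := mem_jetBaseSet_self (E := E) (F := F) (V := V) x
  have hc := IsManifold.chart_mem_maximalAtlas (I := 𝓘(ℝ, E)) (n := ∞) x
  have hcoord := isFiberCoordAt_trivializationAt (E := E) hi.2
  refine ContinuousLinearMap.ext fun X ↦ ContinuousLinearMap.ext fun v ↦ ?_
  have h1 := coord_covDeriv_overconnection hκ hΓ hc hi.1 hcoord X v
  have h2 := coord_covDeriv_overconnection hκ hΓ₁ hc hi.1 hcoord X v
  -- Both values are compared in the preferred coordinates at `x`, where the formula contains no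
  -- coefficient of Γ or Γ₁.
  rw [← jetFiberMap_chartAt_self x (covDeriv (overconnection Γ κ) κ x X v),
    ← jetFiberMap_chartAt_self x (covDeriv (overconnection Γ₁ κ) κ x X v)]
  exact Prod.ext (h2.1.trans h1.1.symm)
    (ContinuousLinearMap.ext fun b ↦ (h2.2 b).trans (h1.2 b).symm)

end CovariantDerivativeOfConnection

/-! ### Curvature as a commutator of covariant derivatives, in coordinates -/

noncomputable section Curvature

variable {E : Type*} [NormedAddCommGroup E] [NormedSpace ℝ E]
  {M : Type*} [TopologicalSpace M] [ChartedSpace E M] [IsManifold 𝓘(ℝ, E) ∞ M]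
  {F : Type*} [NormedAddCommGroup F] [NormedSpace ℝ F]
  {V : M → Type*} [TopologicalSpace (TotalSpace F V)]
  [∀ x, AddCommGroup (V x)] [∀ x, Module ℝ (V x)] [∀ x, TopologicalSpace (V x)]
  [FiberBundle F V] [VectorBundle ℝ F V] [ContMDiffVectorBundle ∞ F V 𝓘(ℝ, E)]
  {F' : Type*} [NormedAddCommGroup F'] [NormedSpace ℝ F']
  {W : M → Type*} [TopologicalSpace (TotalSpace F' W)]
  [∀ x, AddCommGroup (W x)] [∀ x, Module ℝ (W x)] [∀ x, TopologicalSpace (W x)]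
  [FiberBundle F' W] [VectorBundle ℝ F' W] [ContMDiffVectorBundle ∞ F' W 𝓘(ℝ, E)]
  {G : Type*} [NormedAddCommGroup G] [NormedSpace ℝ G]
  {G' : Type*} [NormedAddCommGroup G'] [NormedSpace ℝ G']

/-- The commutator of covariant derivatives in a vector space. -/
theorem model_curvature {S : E → G} {K : E → G →L[ℝ] E →L[ℝ] G} {X Y : E → E} {z : E}
    (hS : ContDiffAt ℝ 2 S z) (hK : DifferentiableAt ℝ K z) (hX : DifferentiableAt ℝ X z)
    (hY : DifferentiableAt ℝ Y z) :
    fderiv ℝ (fun z ↦ fderiv ℝ S z (Y z) - K z (S z) (Y z)) z (X z)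
        - K z (fderiv ℝ S z (Y z) - K z (S z) (Y z)) (X z)
      - (fderiv ℝ (fun z ↦ fderiv ℝ S z (X z) - K z (S z) (X z)) z (Y z)
        - K z (fderiv ℝ S z (X z) - K z (S z) (X z)) (Y z))
      - (fderiv ℝ S z (VectorField.lieBracket ℝ X Y z)
        - K z (S z) (VectorField.lieBracket ℝ X Y z)) =
      -curvCoeff (K z) (fderiv ℝ K z) (X z) (Y z) (S z) := by
  have hS1 : DifferentiableAt ℝ S z := hS.differentiableAt (by simp)
  have hS2 : DifferentiableAt ℝ (fderiv ℝ S) z :=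
    (hS.fderiv_right (m := 1) (by norm_num)).differentiableAt (by simp)
  have hsymm : IsSymmSndFDerivAt ℝ S z := hS.isSymmSndFDerivAt (by simp)
  have key : ∀ {Z : E → E}, DifferentiableAt ℝ Z z → ∀ w,
      fderiv ℝ (fun z ↦ fderiv ℝ S z (Z z) - K z (S z) (Z z)) z w =
      fderiv ℝ (fderiv ℝ S) z w (Z z) + fderiv ℝ S z (fderiv ℝ Z z w) -
        (fderiv ℝ K z w (S z) (Z z) + K z (fderiv ℝ S z w) (Z z) +
          K z (S z) (fderiv ℝ Z z w)) := by
    intro Z hZ w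
    have h := (hS2.hasFDerivAt.clm_apply hZ.hasFDerivAt).sub
      ((hK.hasFDerivAt.clm_apply hS1.hasFDerivAt).clm_apply hZ.hasFDerivAt)
    refine (DFunLike.congr_fun h.fderiv w).trans ?_
    simp only [sub_apply, add_apply, ContinuousLinearMap.comp_apply,
      ContinuousLinearMap.flip_apply]
    abel
  -- The second derivatives of S cancel by symmetry, the derivatives of X and Y cancel against the
  -- bracket, and the mixed terms K(DS) are symmetric in X and Y. What remains is DK and the
  -- commutator of K.
  rw [key hY, key hX, VectorField.lieBracket_eq, curvCoeff, hsymm.eq (X z) (Y z)]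
  simp only [map_sub, sub_apply]
  abel

/-- The bracket on M is defined by pulling back to the preferred chart at `x`, and near the centre
that pullback is the chart reading of the fields. -/
theorem chartDiff_mlieBracket (X Y : ∀ y : M, TangentSpace 𝓘(ℝ, E) y) (x : M) :
    chartDiff (chartAt E x) x (VectorField.mlieBracket 𝓘(ℝ, E) X Y x) =
      VectorField.lieBracket ℝ
        (fun z ↦ chartDiff (chartAt E x) ((chartAt E x).symm z) (X ((chartAt E x).symm z)))
        (fun z ↦ chartDiff (chartAt E x) ((chartAt E x).symm z) (Y ((chartAt E x).symm z)))
        (chartAt E x x) := by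
  have hc := IsManifold.chart_mem_maximalAtlas (I := 𝓘(ℝ, E)) (n := ∞) x
  have hx := mem_chart_source E x
  have h1 : ∀ Z : ∀ y : M, TangentSpace 𝓘(ℝ, E) y,
      VectorField.mpullbackWithin 𝓘(ℝ, E) 𝓘(ℝ, E) (chartAt E x).symm Z univ =ᶠ[𝓝 (chartAt E x x)]
      fun z ↦ chartDiff (chartAt E x) ((chartAt E x).symm z) (Z ((chartAt E x).symm z)) := by
    intro Z
    filter_upwards [(chartAt E x).open_target.mem_nhds ((chartAt E x).map_source hx)] with z hz
    have hz' := (chartAt E x).map_target hz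
    rw [VectorField.mpullbackWithin_apply, mfderivWithin_univ]
    have h2 := mfderiv_chart_comp_mfderiv_symm hc hz'
    have h3 := mfderiv_symm_comp_mfderiv_chart hc hz'
    rw [(chartAt E x).right_inv hz] at h2 h3
    rw [ContinuousLinearMap.inverse_eq h3 h2]
    rfl
  have h4 := (h1 X).lieBracket_vectorField_eq (𝕜 := ℝ) (h1 Y)
  rw [← h4, ← VectorField.mlieBracketWithin_univ, VectorField.mlieBracketWithin_apply]
  refine (chartDiff_chartDiffInv hc hx _).trans ?_
  simp only [mfld_simps]
  exact congrFun VectorField.lieBracketWithin_univ _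

variable [FiniteDimensional ℝ F] {κ : ∀ x, V x →L[ℝ] JetSpace E F V x}

/-- The covariant derivative of a section in coordinates. -/
theorem coord_covDeriv_section (hκ : ∀ x v, (κ x v).proj = v) {φ : OpenPartialHomeomorph M E}
    (hφ : φ ∈ IsManifold.maximalAtlas 𝓘(ℝ, E) ∞ M) {L : ∀ y, V y →L[ℝ] G}
    {R : ∀ y, G →L[ℝ] V y} {x : M} (hx : x ∈ φ.source) (h : IsFiberCoordAt E F L R x)
    {σ : ∀ y, V y} (hσ : DifferentiableSectionAt E F σ x) (X : TangentSpace 𝓘(ℝ, E) x) :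
    L x (covDeriv (fun y v ↦ κ y v) σ x X) =
      fderiv ℝ (fun z ↦ L (φ.symm z) (σ (φ.symm z))) (φ x) (chartDiff φ x X) -
        connectionCoeff F φ L R κ x (L x (σ x)) (chartDiff φ x X) := by
  rw [coord_covDeriv hφ hx hκ,
    (hasFDerivAt_section hφ hx h.smooth_to.self_of_nhds hσ).fderiv,
    (jetFiberMap_connection hκ hx h).self_of_nhds]

/-- The curvature in the preferred coordinates. -/
theorem coord_curvature (hκ : IsConnection (fun x v ↦ κ x v)) {x : M}
    {X Y : ∀ y : M, TangentSpace 𝓘(ℝ, E) y} {s : ∀ y, V y}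
    (hX : CMDiffAt ∞ (T% X) x) (hY : CMDiffAt ∞ (T% Y) x) (hs : CMDiffAt ∞ (T% s) x) :
    (trivializationAt F V x).continuousLinearMapAt ℝ x (curvature (fun y v ↦ κ y v) X Y s x) =
      -curvCoeff (connectionCoeff F (chartAt E x)
          (fun y ↦ (trivializationAt F V x).continuousLinearMapAt ℝ y)
          (fun y ↦ (trivializationAt F V x).symmL ℝ y) κ x)
        (fderiv ℝ (fun z ↦ connectionCoeff F (chartAt E x)
          (fun y ↦ (trivializationAt F V x).continuousLinearMapAt ℝ y)
          (fun y ↦ (trivializationAt F V x).symmL ℝ y) κ ((chartAt E x).symm z)) (chartAt E x x))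
        (chartDiff (chartAt E x) x (X x)) (chartDiff (chartAt E x) x (Y x))
        ((trivializationAt F V x).continuousLinearMapAt ℝ x (s x)) := by
  have hi := mem_jetBaseSet_self (E := E) (F := F) (V := V) x
  have hc := IsManifold.chart_mem_maximalAtlas (I := 𝓘(ℝ, E)) (n := ∞) x
  have hcoord := isFiberCoordAt_trivializationAt (E := E) hi.2
  set φ := chartAt E x
  set L : ∀ y, V y →L[ℝ] F := fun y ↦ (trivializationAt F V x).continuousLinearMapAt ℝ y
  set R : ∀ y, F →L[ℝ] V y := fun y ↦ (trivializationAt F V x).symmL ℝ y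
  set K : E → F →L[ℝ] E →L[ℝ] F := fun z ↦ connectionCoeff F φ L R κ (φ.symm z) with hKdef
  set S : E → F := fun z ↦ L (φ.symm z) (s (φ.symm z)) with hSdef
  have hS : ContDiffAt ℝ ∞ S (φ x) := contDiffAt_comp_symm_of_mem_maximalAtlas hc hi.1
    (contMDiffAt_coord hcoord.smooth_to.self_of_nhds hs)
  have hK : DifferentiableAt ℝ K (φ x) :=
    (contDiffAt_connectionCoeff hc hκ hi.1 hcoord).differentiableAt (by simp)
  have eK : K (φ x) = connectionCoeff F φ L R κ x := by
    simp only [hKdef]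
    rw [φ.left_inv hi.1]
  have htan := (isFiberCoordAt_chartDiff hc hi.1).smooth_to.self_of_nhds
  have hZ : ∀ {Z : ∀ y : M, TangentSpace 𝓘(ℝ, E) y}, CMDiffAt ∞ (T% Z) x →
      DifferentiableAt ℝ (fun z ↦ chartDiff φ (φ.symm z) (Z (φ.symm z))) (φ x) := fun h ↦
    (contDiffAt_comp_symm_of_mem_maximalAtlas hc hi.1
      (contMDiffAt_coord htan h)).differentiableAt (by simp)
  -- The outer covariant derivative differentiates the inner one, so the formula for the inner one
  -- is needed on a neighbourhood of `x`.
  have hN : ∀ Z : ∀ y : M, TangentSpace 𝓘(ℝ, E) y, ∀ᶠ y in 𝓝 x,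
      L y (covDeriv (fun y v ↦ κ y v) s y (Z y)) =
        (fun z ↦ fderiv ℝ S z (chartDiff φ (φ.symm z) (Z (φ.symm z))) -
          K z (S z) (chartDiff φ (φ.symm z) (Z (φ.symm z)))) (φ y) := by
    intro Z
    filter_upwards [eventually_mem_source hi.1, hcoord.eventually,
      eventually_differentiableSectionAt hs] with y h1 h2 h3
    rw [coord_covDeriv_section hκ.proj hc h1 h2 h3, hKdef]
    simp only [hSdef]
    rw [φ.left_inv h1]
  have hD : ∀ {Z : ∀ y : M, TangentSpace 𝓘(ℝ, E) y}, CMDiffAt ∞ (T% Z) x →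
      DifferentiableAt ℝ (fun z ↦ fderiv ℝ S z (chartDiff φ (φ.symm z) (Z (φ.symm z))) -
          K z (S z) (chartDiff φ (φ.symm z) (Z (φ.symm z)))) (φ x) := fun h ↦
    (((hS.fderiv_right (m := ∞) le_rfl).differentiableAt (by simp)).clm_apply (hZ h)).sub
      ((hK.clm_apply (hS.differentiableAt (by simp))).clm_apply (hZ h))
  have hcov : ∀ {Z : ∀ y : M, TangentSpace 𝓘(ℝ, E) y}, CMDiffAt ∞ (T% Z) x →
      ∀ Z' : TangentSpace 𝓘(ℝ, E) x,
      L x (covDeriv (fun y v ↦ κ y v) (fun y ↦ covDeriv (fun y v ↦ κ y v) s y (Z y)) x Z') =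
        fderiv ℝ (fun z ↦ fderiv ℝ S z (chartDiff φ (φ.symm z) (Z (φ.symm z))) -
          K z (S z) (chartDiff φ (φ.symm z) (Z (φ.symm z)))) (φ x) (chartDiff φ x Z') -
        K (φ x) (fderiv ℝ S (φ x) (chartDiff φ (φ.symm (φ x)) (Z (φ.symm (φ x)))) -
          K (φ x) (S (φ x)) (chartDiff φ (φ.symm (φ x)) (Z (φ.symm (φ x)))))
          (chartDiff φ x Z') := by
    intro Z h Z'
    rw [coord_covDeriv_section hκ.proj hc hi.1 hcoord
      (differentiableSectionAt_of_eventually (hD h) (hN Z)), (hN Z).self_of_nhds]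
    congr 2
    · refine EventuallyEq.fderiv_eq ?_
      filter_upwards [eventually_symm hi.1 (hN Z), φ.open_target.mem_nhds (φ.map_source hi.1)]
        with z h1 h2
      rw [h1, φ.right_inv h2]
    · exact DFunLike.congr_fun eK.symm _
  have hbr := coord_covDeriv_section hκ.proj hc hi.1 hcoord
    (eventually_differentiableSectionAt hs).self_of_nhds (VectorField.mlieBracket 𝓘(ℝ, E) X Y x)
  rw [chartDiff_mlieBracket] at hbr
  have key := model_curvature (mod_cast contDiffAt_infty.1 hS 2) hK (hZ hX) (hZ hY)
  change L x _ = _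
  rw [curvature, map_sub, map_sub, hcov hX, hcov hY, hbr]
  have e : ∀ Z : ∀ y : M, TangentSpace 𝓘(ℝ, E) y,
      chartDiff φ (φ.symm (φ x)) (Z (φ.symm (φ x))) = chartDiff φ x (Z x) := by
    intro Z
    rw [φ.left_inv hi.1]
  have eS : S (φ x) = L x (s x) := by
    simp only [hSdef]
    rw [φ.left_inv hi.1]
  rw [e, e, eS, eK] at key
  rw [e, e, eS, eK]
  exact key

end Curvature

/-! ### ∇κ is minus the curvature -/

noncomputable section ConnectionBundleCurvature

variable {E : Type*} [NormedAddCommGroup E] [NormedSpace ℝ E]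
  {M : Type*} [TopologicalSpace M] [ChartedSpace E M] [IsManifold 𝓘(ℝ, E) ∞ M]
  {F : Type*} [NormedAddCommGroup F] [NormedSpace ℝ F]
  {V : M → Type*} [TopologicalSpace (TotalSpace F V)]
  [∀ x, AddCommGroup (V x)] [∀ x, Module ℝ (V x)] [∀ x, TopologicalSpace (V x)]
  [FiberBundle F V] [VectorBundle ℝ F V] [ContMDiffVectorBundle ∞ F V 𝓘(ℝ, E)]
  {F' : Type*} [NormedAddCommGroup F'] [NormedSpace ℝ F']
  {W : M → Type*} [TopologicalSpace (TotalSpace F' W)]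
  [∀ x, AddCommGroup (W x)] [∀ x, Module ℝ (W x)] [∀ x, TopologicalSpace (W x)]
  [FiberBundle F' W] [VectorBundle ℝ F' W] [ContMDiffVectorBundle ∞ F' W 𝓘(ℝ, E)]
  {G : Type*} [NormedAddCommGroup G] [NormedSpace ℝ G]
  {G' : Type*} [NormedAddCommGroup G'] [NormedSpace ℝ G']

variable [FiniteDimensional ℝ E] [FiniteDimensional ℝ F] {κ : ∀ x, V x →L[ℝ] JetSpace E F V x}
  {Γ : ∀ x : M, TangentSpace 𝓘(ℝ, E) x →L[ℝ] JetSpace E E (TangentSpace 𝓘(ℝ, E) : M → Type _) x}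

/-- The covariant derivative of `κ` with respect to `κ' ⊗ κ*` is minus the curvature of `κ`. -/
theorem vert_covDeriv_overconnection (hκ : IsConnection (fun x v ↦ κ x v))
    (hΓ : IsConnection (fun x v ↦ Γ x v)) {x : M} {X Y : ∀ y : M, TangentSpace 𝓘(ℝ, E) y}
    {s : ∀ y, V y} (hX : CMDiffAt ∞ (T% X) x) (hY : CMDiffAt ∞ (T% Y) x)
    (hs : CMDiffAt ∞ (T% s) x) :
    (covDeriv (overconnection Γ κ) κ x (X x) (s x)).vert (Y x) =
      -curvature (fun y v ↦ κ y v) X Y s x := by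
  have hi := mem_jetBaseSet_self (E := E) (F := F) (V := V) x
  have hc := IsManifold.chart_mem_maximalAtlas (I := 𝓘(ℝ, E)) (n := ∞) x
  have hcoord := isFiberCoordAt_trivializationAt (E := E) hi.2
  have h1 := coord_vert_covDeriv_overconnection hκ hΓ hc hi.1 hcoord (X x) (Y x) (s x)
  have h2 := coord_curvature hκ hX hY hs
  rw [← h1, ← map_neg] at h2
  have h3 := congrArg ((trivializationAt F V x).symmL ℝ x) h2
  rw [Trivialization.symmL_continuousLinearMapAt _ hi.2,
    Trivialization.symmL_continuousLinearMapAt _ hi.2] at h3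
  rw [h3, neg_neg]

theorem SmoothFromModelAt.contMDiffAt {R : ∀ y, G →L[ℝ] V y} {x : M}
    (h : SmoothFromModelAt E F R x) (u : G) :
    ContMDiffAt 𝓘(ℝ, E) (𝓘(ℝ, E).prod 𝓘(ℝ, F)) ∞ (fun y ↦ TotalSpace.mk' F y (R y u)) x := by
  rw [contMDiffAt_section]
  refine (ContMDiffAt.clm_apply h (contMDiffAt_const (c := u))).congr_of_eventuallyEq ?_
  filter_upwards [eventually_mem_baseSet (mem_baseSet_trivializationAt F V x)] with y hy
  rw [ContinuousLinearMap.comp_apply, Trivialization.continuousLinearMapAt_apply_of_mem ℝ _ hy]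

theorem contMDiffAt_coordVector {φ : OpenPartialHomeomorph M E}
    (hφ : φ ∈ IsManifold.maximalAtlas 𝓘(ℝ, E) ∞ M) {x : M} (hx : x ∈ φ.source) (e : E) :
    CMDiffAt ∞ (T% (coordVector φ e)) x :=
  (isFiberCoordAt_chartDiff hφ hx).smooth_from.self_of_nhds.contMDiffAt e

end ConnectionBundleCurvature

/-! ### Local frames as smooth fibre coordinates -/

noncomputable section FrameCoordinates

variable {E : Type*} [NormedAddCommGroup E] [NormedSpace ℝ E]
  {M : Type*} [TopologicalSpace M] [ChartedSpace E M] [IsManifold 𝓘(ℝ, E) ∞ M]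
  {F : Type*} [NormedAddCommGroup F] [NormedSpace ℝ F]
  {V : M → Type*} [TopologicalSpace (TotalSpace F V)]
  [∀ x, AddCommGroup (V x)] [∀ x, Module ℝ (V x)] [∀ x, TopologicalSpace (V x)]
  [FiberBundle F V] [VectorBundle ℝ F V] [ContMDiffVectorBundle ∞ F V 𝓘(ℝ, E)]
  {F' : Type*} [NormedAddCommGroup F'] [NormedSpace ℝ F']
  {W : M → Type*} [TopologicalSpace (TotalSpace F' W)]
  [∀ x, AddCommGroup (W x)] [∀ x, Module ℝ (W x)] [∀ x, TopologicalSpace (W x)]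
  [FiberBundle F' W] [VectorBundle ℝ F' W] [ContMDiffVectorBundle ∞ F' W 𝓘(ℝ, E)]
  {G : Type*} [NormedAddCommGroup G] [NormedSpace ℝ G]
  {G' : Type*} [NormedAddCommGroup G'] [NormedSpace ℝ G']

variable [FiniteDimensional ℝ F] {ι : Type*} [Fintype ι] {s : ι → ∀ y, V y} {u : Set M}

/-- The fibre coordinates of a local frame. -/
def frameCoord (hs : IsLocalFrameOn 𝓘(ℝ, E) F ∞ s u) (y : M) : V y →L[ℝ] ι → ℝ :=
  -- The frame coefficients are only linear maps on the fibre. Passing through the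
  -- finite-dimensional model F supplies continuity.
  (LinearMap.toContinuousLinearMap ((LinearMap.pi fun i ↦ hs.coeff i y).comp
    ((trivializationAt F V y).symmL ℝ y : F →ₗ[ℝ] V y))).comp
    ((trivializationAt F V y).continuousLinearMapAt ℝ y)

theorem frameCoord_apply (hs : IsLocalFrameOn 𝓘(ℝ, E) F ∞ s u) (y : M) (v : V y) (i : ι) :
    frameCoord hs y v i = hs.coeff i y v := by
  refine congrArg (hs.coeff i y) (Trivialization.symmL_continuousLinearMapAt _
    (mem_baseSet_trivializationAt F V y) v)

variable (F) in
/-- The linear combinations of the sections of a frame. -/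
def frameMap (s : ι → ∀ y, V y) (y : M) : (ι → ℝ) →L[ℝ] V y :=
  ((trivializationAt F V y).symmL ℝ y).comp (LinearMap.toContinuousLinearMap
    (Fintype.linearCombination ℝ fun i ↦ (trivializationAt F V y).continuousLinearMapAt ℝ y (s i y)))

theorem frameMap_apply (s : ι → ∀ y, V y) (y : M) (c : ι → ℝ) :
    frameMap F s y c = ∑ i, c i • s i y := by
  change (trivializationAt F V y).symmL ℝ y (Fintype.linearCombination ℝ _ c) = _
  rw [Fintype.linearCombination_apply, map_sum]
  refine Finset.sum_congr rfl fun i _ ↦ ?_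
  rw [map_smul, Trivialization.symmL_continuousLinearMapAt _ (mem_baseSet_trivializationAt F V y)]

theorem frameMap_single [DecidableEq ι] (s : ι → ∀ y, V y) (y : M) (j : ι) :
    frameMap F s y (Pi.single j 1) = s j y := by
  simp [frameMap_apply, Pi.single_apply]

theorem frameMap_frameCoord (hs : IsLocalFrameOn 𝓘(ℝ, E) F ∞ s u) {y : M} (hy : y ∈ u) (v : V y) :
    frameMap F s y (frameCoord hs y v) = v := by
  rw [frameMap_apply]
  conv_rhs => rw [← (hs.toBasisAt hy).sum_repr v]
  simp [frameCoord_apply, IsLocalFrameOn.coeff, hy]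

theorem frameCoord_frameMap (hs : IsLocalFrameOn 𝓘(ℝ, E) F ∞ s u) {y : M} (hy : y ∈ u)
    (c : ι → ℝ) : frameCoord hs y (frameMap F s y c) = c := by
  ext i
  rw [frameCoord_apply, frameMap_apply]
  simp only [IsLocalFrameOn.coeff, hy, dif_pos, Module.Basis.coord_apply]
  simp only [← hs.toBasisAt_coe hy]
  rw [Module.Basis.repr_sum_self]

theorem smoothFromModelAt_frameMap (hs : IsLocalFrameOn 𝓘(ℝ, E) F ∞ s u) (hu : IsOpen u) {x : M}
    (hx : x ∈ u) : SmoothFromModelAt E F (frameMap F s) x := by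
  refine contMDiffAt_clm_of_apply fun c ↦ ?_
  have h : ContMDiffAt 𝓘(ℝ, E) 𝓘(ℝ, F) ∞
      (fun y ↦ ∑ i, c i • (trivializationAt F V x (TotalSpace.mk' F y (s i y))).2) x :=
    ContMDiffAt.sum fun i _ ↦
      (contMDiffAt_const (c := c i • ContinuousLinearMap.id ℝ F)).clm_apply ((contMDiffAt_section x).1 (hs.contMDiffAt hu hx i))
  refine h.congr_of_eventuallyEq ?_
  filter_upwards [eventually_mem_baseSet (mem_baseSet_trivializationAt F V x)] with y hy
  rw [ContinuousLinearMap.comp_apply, frameMap_apply, map_sum]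
  refine Finset.sum_congr rfl fun i _ ↦ ?_
  rw [map_smul, Trivialization.continuousLinearMapAt_apply_of_mem ℝ _ hy]

/-- The reading of the frame coordinates is the pointwise inverse of the reading of `frameMap`,
which is smooth because the sections are, and inversion of operators is smooth at invertible ones.
-/
theorem smoothToModelAt_frameCoord (hs : IsLocalFrameOn 𝓘(ℝ, E) F ∞ s u) (hu : IsOpen u) {x : M}
    (hx : x ∈ u) : SmoothToModelAt E F (frameCoord hs) x := by
  have h1 := smoothFromModelAt_frameMap hs hu hx
  have key : ∀ y ∈ u ∩ (trivializationAt F V x).baseSet,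
      (((trivializationAt F V x).continuousLinearMapAt ℝ y).comp (frameMap F s y)).comp
        ((frameCoord hs y).comp ((trivializationAt F V x).symmL ℝ y)) =
          ContinuousLinearMap.id ℝ F ∧
      ((frameCoord hs y).comp ((trivializationAt F V x).symmL ℝ y)).comp
        (((trivializationAt F V x).continuousLinearMapAt ℝ y).comp (frameMap F s y)) =
          ContinuousLinearMap.id ℝ (ι → ℝ) := by
    intro y hy
    constructor
    · refine ContinuousLinearMap.ext fun v ↦ ?_
      simp only [ContinuousLinearMap.comp_apply]
      rw [frameMap_frameCoord hs hy.1, Trivialization.continuousLinearMapAt_symmL _ hy.2]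
      rfl
    · refine ContinuousLinearMap.ext fun c ↦ ?_
      simp only [ContinuousLinearMap.comp_apply]
      rw [Trivialization.symmL_continuousLinearMapAt _ hy.2, frameCoord_frameMap hs hy.1]
      rfl
  have hx' : x ∈ u ∩ (trivializationAt F V x).baseSet := ⟨hx, mem_baseSet_trivializationAt F V x⟩
  let e : (ι → ℝ) ≃L[ℝ] F := ContinuousLinearEquiv.equivOfInverse
    (((trivializationAt F V x).continuousLinearMapAt ℝ x).comp (frameMap F s x))
    ((frameCoord hs x).comp ((trivializationAt F V x).symmL ℝ x))
    (DFunLike.congr_fun (key x hx').2) (DFunLike.congr_fun (key x hx').1)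
  have h2 : ContDiffAt ℝ ∞ ContinuousLinearMap.inverse
      (((trivializationAt F V x).continuousLinearMapAt ℝ x).comp (frameMap F s x)) :=
    contDiffAt_map_inverse e
  refine (h2.contMDiffAt.comp x h1).congr_of_eventuallyEq ?_
  filter_upwards [hu.mem_nhds hx, eventually_mem_baseSet hx'.2] with y hy hy'
  exact (ContinuousLinearMap.inverse_eq (key y ⟨hy, hy'⟩).1 (key y ⟨hy, hy'⟩).2).symm

/-- A local frame gives smooth linear fibre coordinates. -/
theorem isFiberCoordAt_frameCoord (hs : IsLocalFrameOn 𝓘(ℝ, E) F ∞ s u) (hu : IsOpen u) {x : M}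
    (hx : x ∈ u) : IsFiberCoordAt E F (frameCoord hs) (frameMap F s) x where
  smooth_to := by
    filter_upwards [hu.mem_nhds hx] with y hy using smoothToModelAt_frameCoord hs hu hy
  smooth_from := by
    filter_upwards [hu.mem_nhds hx] with y hy using smoothFromModelAt_frameMap hs hu hy
  from_to := by
    filter_upwards [hu.mem_nhds hx] with y hy using frameMap_frameCoord hs hy
  to_from := by
    filter_upwards [hu.mem_nhds hx] with y hy using frameCoord_frameMap hs hy

end FrameCoordinates

/-! ### Components with respect to a chart, a basis and a local frame -/

noncomputable section Components

variable {E : Type*} [NormedAddCommGroup E] [NormedSpace ℝ E]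
  {M : Type*} [TopologicalSpace M] [ChartedSpace E M] [IsManifold 𝓘(ℝ, E) ∞ M]
  {F : Type*} [NormedAddCommGroup F] [NormedSpace ℝ F]
  {V : M → Type*} [TopologicalSpace (TotalSpace F V)]
  [∀ x, AddCommGroup (V x)] [∀ x, Module ℝ (V x)] [∀ x, TopologicalSpace (V x)]
  [FiberBundle F V] [VectorBundle ℝ F V] [ContMDiffVectorBundle ∞ F V 𝓘(ℝ, E)]
  {F' : Type*} [NormedAddCommGroup F'] [NormedSpace ℝ F']
  {W : M → Type*} [TopologicalSpace (TotalSpace F' W)]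
  [∀ x, AddCommGroup (W x)] [∀ x, Module ℝ (W x)] [∀ x, TopologicalSpace (W x)]
  [FiberBundle F' W] [VectorBundle ℝ F' W] [ContMDiffVectorBundle ∞ F' W 𝓘(ℝ, E)]
  {G : Type*} [NormedAddCommGroup G] [NormedSpace ℝ G]
  {G' : Type*} [NormedAddCommGroup G'] [NormedSpace ℝ G']

/-- A coordinate function that is a fixed functional of `L` near `x` commutes with differentiation
along the representative, so its jet coordinate is that functional of the derivative slot. -/
theorem jetCoord_eq {φ : OpenPartialHomeomorph M E}
    (hφ : φ ∈ IsManifold.maximalAtlas 𝓘(ℝ, E) ∞ M) {L : ∀ y, V y →L[ℝ] G} {x : M}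
    (hx : x ∈ φ.source) (h : SmoothToModelAt E F L x) {f : ∀ y, V y → ℝ} {l : G →L[ℝ] ℝ}
    (hf : ∀ᶠ y in 𝓝 x, ∀ v, f y v = l (L y v)) (w : E) (j : JetSpace E F V x) :
    jetCoord φ w f j = l ((jetFiberMap F φ L x j).2 w) := by
  have h1 := l.hasFDerivAt.comp (φ x) (hasFDerivAt_rep hφ hx h j)
  have h2 : (fun z ↦ f (φ.symm z) (j.rep (φ.symm z))) =ᶠ[𝓝 (φ x)]
      (l ∘ fun z ↦ L (φ.symm z) (j.rep (φ.symm z))) := by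
    filter_upwards [eventually_symm hx hf] with z hz using hz _
  exact DFunLike.congr_fun (h1.congr_of_eventuallyEq h2).fderiv w

theorem tangentConnCoeff_eq {φ : OpenPartialHomeomorph M E}
    (hφ : φ ∈ IsManifold.maximalAtlas 𝓘(ℝ, E) ∞ M) [FiniteDimensional ℝ E] {β : Type*}
    (e : Module.Basis β ℝ E)
    (Γ : ∀ x : M, TangentSpace 𝓘(ℝ, E) x →L[ℝ] JetSpace E E (TangentSpace 𝓘(ℝ, E) : M → Type _) x)
    {x : M} (hx : x ∈ φ.source) (a b c : β) :
    tangentConnCoeff φ e Γ a c b x =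
      e.repr (connectionCoeff E φ (chartDiff φ) (chartDiffInv φ) Γ x (e b) (e a)) c :=
  jetCoord_eq hφ hx (isFiberCoordAt_chartDiff hφ hx).smooth_to.self_of_nhds
    (l := LinearMap.toContinuousLinearMap (e.coord c)) (Eventually.of_forall fun _ _ ↦ rfl) (e a) _

variable [FiniteDimensional ℝ F] {ι : Type*} [Fintype ι] {s : ι → ∀ y, V y} {u : Set M}

section

variable [DecidableEq ι]

theorem connCoord_eq {φ : OpenPartialHomeomorph M E}
    (hφ : φ ∈ IsManifold.maximalAtlas 𝓘(ℝ, E) ∞ M) (hs : IsLocalFrameOn 𝓘(ℝ, E) F ∞ s u)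
    (hu : IsOpen u) {x : M} (hx : x ∈ φ.source ∩ u) (w : E) (i j : ι)
    (A : V x →L[ℝ] JetSpace E F V x) :
    connCoord φ w hs i j A =
      (homCoord (jetFiberMap F φ (frameCoord hs)) (frameMap F s) x A (Pi.single j 1)).2 w i := by
  rw [connCoord, jetCoord_eq hφ hx.1 (smoothToModelAt_frameCoord hs hu hx.2)
    (l := ContinuousLinearMap.proj i)
    (Eventually.of_forall fun y v ↦ (frameCoord_apply hs y v i).symm)]
  simp only [homCoord_apply, ContinuousLinearMap.comp_apply, frameMap_single]
  rfl

theorem connCoord_connection {φ : OpenPartialHomeomorph M E}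
    (hφ : φ ∈ IsManifold.maximalAtlas 𝓘(ℝ, E) ∞ M) (hs : IsLocalFrameOn 𝓘(ℝ, E) F ∞ s u)
    (hu : IsOpen u) {x : M} (hx : x ∈ φ.source ∩ u) (w : E) (i j : ι)
    (κ : ∀ x, V x →L[ℝ] JetSpace E F V x) :
    connCoord φ w hs i j (κ x) =
      connectionCoeff F φ (frameCoord hs) (frameMap F s) κ x (Pi.single j 1) w i :=
  connCoord_eq hφ hs hu hx w i j (κ x)

theorem coordDeriv_connCoord {κ : ∀ x, V x →L[ℝ] JetSpace E F V x}
    (hκ : IsConnection (fun x v ↦ κ x v)) {φ : OpenPartialHomeomorph M E}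
    (hφ : φ ∈ IsManifold.maximalAtlas 𝓘(ℝ, E) ∞ M) (hs : IsLocalFrameOn 𝓘(ℝ, E) F ∞ s u)
    (hu : IsOpen u) {x : M} (hx : x ∈ φ.source ∩ u) (w b : E) (i j : ι) :
    coordDeriv φ b (fun y ↦ connCoord φ w hs i j (κ y)) x =
      fderiv ℝ (fun z ↦ connectionCoeff F φ (frameCoord hs) (frameMap F s) κ (φ.symm z)) (φ x) b
        (Pi.single j 1) w i := by
  have hK := ((contDiffAt_connectionCoeff hφ hκ hx.1
    (isFiberCoordAt_frameCoord hs hu hx.2)).differentiableAt (by simp)).hasFDerivAt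
  have h1 := (ContinuousLinearMap.proj (R := ℝ) (φ := fun _ : ι ↦ ℝ) i).hasFDerivAt.comp (φ x)
    ((hK.clm_apply (hasFDerivAt_const (Pi.single j (1 : ℝ)) _)).clm_apply (hasFDerivAt_const w _))
  have h2 : (fun z ↦ connCoord φ w hs i j (κ (φ.symm z))) =ᶠ[𝓝 (φ x)]
      (ContinuousLinearMap.proj (R := ℝ) (φ := fun _ : ι ↦ ℝ) i) ∘ fun z ↦
        connectionCoeff F φ (frameCoord hs) (frameMap F s) κ (φ.symm z) (Pi.single j 1) w := by
    filter_upwards [eventually_symm hx.1 ((φ.open_source.inter hu).mem_nhds hx)] with z hz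
    exact connCoord_connection hφ hs hu hz w i j κ
  refine (DFunLike.congr_fun (h1.congr_of_eventuallyEq h2).fderiv b).trans ?_
  simp

/-- Turns compositions of coefficient operators into sums over the frame index. -/
theorem map_eq_sum_single {H : Type*} [NormedAddCommGroup H] [NormedSpace ℝ H]
    (T : (ι → ℝ) →L[ℝ] H) (c : ι → ℝ) : T c = ∑ h, c h • T (Pi.single h 1) := by
  conv_lhs => rw [pi_eq_sum_univ' c, map_sum]
  simp_rw [map_smul]

/-- The compositions of coefficients in components. -/
theorem coeff_comp_apply (K K' : (ι → ℝ) →L[ℝ] E →L[ℝ] ι → ℝ) (a b : E) (i j : ι) :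
    K (K' (Pi.single j 1) b) a i =
      ∑ h, K' (Pi.single j 1) b h * K (Pi.single h 1) a i := by
  rw [map_eq_sum_single K, sum_apply, Finset.sum_apply]
  rfl

theorem curvCoeff_apply (K : (ι → ℝ) →L[ℝ] E →L[ℝ] ι → ℝ)
    (D : E →L[ℝ] (ι → ℝ) →L[ℝ] E →L[ℝ] ι → ℝ) (a b : E) (i j : ι) :
    curvCoeff K D a b (Pi.single j 1) i =
      D a (Pi.single j 1) b i - D b (Pi.single j 1) a i +
      ∑ h, K (Pi.single h 1) b i * K (Pi.single j 1) a h -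
      ∑ h, K (Pi.single h 1) a i * K (Pi.single j 1) b h := by
  rw [curvCoeff, Pi.add_apply, Pi.sub_apply, Pi.sub_apply, coeff_comp_apply, coeff_comp_apply]
  simp only [mul_comm]
  ring

end

variable [FiniteDimensional ℝ E] {κ : ∀ x, V x →L[ℝ] JetSpace E F V x}
  {Γ : ∀ x : M, TangentSpace 𝓘(ℝ, E) x →L[ℝ] JetSpace E E (TangentSpace 𝓘(ℝ, E) : M → Type _) x}

/-- The components of the covariant derivative of `κ`. -/
theorem coeff_vert_covDeriv_overconnection (hκ : IsConnection (fun x v ↦ κ x v))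
    (hΓ : IsConnection (fun x v ↦ Γ x v)) {φ : OpenPartialHomeomorph M E}
    (hφ : φ ∈ IsManifold.maximalAtlas 𝓘(ℝ, E) ∞ M) (hs : IsLocalFrameOn 𝓘(ℝ, E) F ∞ s u)
    (hu : IsOpen u) {x : M} (hx : x ∈ φ.source ∩ u) (a b : E) (i j : ι) :
    hs.coeff i x ((covDeriv (overconnection Γ κ) κ x (coordVector φ a x) (s j x)).vert
        (coordVector φ b x)) =
      coordDeriv φ a (fun y ↦ connCoord φ b hs i j (κ y)) x
        - coordDeriv φ b (fun y ↦ connCoord φ a hs i j (κ y)) x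
        + ∑ h, connCoord φ b hs i h (κ x) * connCoord φ a hs h j (κ x)
        - ∑ h, connCoord φ a hs i h (κ x) * connCoord φ b hs h j (κ x) := by
  classical
  have hcoord := isFiberCoordAt_frameCoord hs hu hx.2
  have h1 := coord_vert_covDeriv_overconnection hκ hΓ hφ hx.1 hcoord (coordVector φ a x)
    (coordVector φ b x) (s j x)
  have ha : chartDiff φ x (coordVector φ a x) = a := chartDiff_chartDiffInv hφ hx.1 a
  have hb : chartDiff φ x (coordVector φ b x) = b := chartDiff_chartDiffInv hφ hx.1 b
  have hj : frameCoord hs x (s j x) = Pi.single j 1 := by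
    rw [← frameMap_single (F := F) s x j, frameCoord_frameMap hs hx.2]
  rw [ha, hb, hj] at h1
  rw [← frameCoord_apply, h1, curvCoeff_apply, coordDeriv_connCoord hκ hφ hs hu hx,
    coordDeriv_connCoord hκ hφ hs hu hx]
  simp only [connCoord_connection hφ hs hu hx]

/-- The components of the curvature of `κ`. -/
theorem coeff_curvature (hκ : IsConnection (fun x v ↦ κ x v))
    (hΓ : IsConnection (fun x v ↦ Γ x v)) {φ : OpenPartialHomeomorph M E}
    (hφ : φ ∈ IsManifold.maximalAtlas 𝓘(ℝ, E) ∞ M) (hs : IsLocalFrameOn 𝓘(ℝ, E) F ∞ s u)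
    (hu : IsOpen u) {x : M} (hx : x ∈ φ.source ∩ u) (a b : E) (i j : ι) :
    hs.coeff i x (curvature (fun y v ↦ κ y v) (coordVector φ a) (coordVector φ b) (s j) x) =
      coordDeriv φ b (fun y ↦ connCoord φ a hs i j (κ y)) x
        - coordDeriv φ a (fun y ↦ connCoord φ b hs i j (κ y)) x
        + ∑ h, connCoord φ a hs i h (κ x) * connCoord φ b hs h j (κ x)
        - ∑ h, connCoord φ b hs i h (κ x) * connCoord φ a hs h j (κ x) := by
  have h1 := vert_covDeriv_overconnection hκ hΓ (contMDiffAt_coordVector hφ hx.1 a)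
    (contMDiffAt_coordVector hφ hx.1 b) (hs.contMDiffAt hu hx.2 j)
  -- The curvature is obtained from the components of ∇κ by the invariant identity between the two,
  -- so no second computation in the frame is needed.
  rw [← neg_neg (curvature _ _ _ _ _), ← h1, map_neg,
    coeff_vert_covDeriv_overconnection hκ hΓ hφ hs hu hx]
  ring

/-- The coordinate formula of the reduced connection as pure algebra. The hypothesis `hT` says that
T represents an element of C, so κ' is evaluated at (u, S u) with u a basis vector. The first sum is
the term T K from κ*, the second is K applied to S, and the last expands the C term in the basis
`e`. -/
theorem tensorCoeff_prolongCoeff_single [DecidableEq ι] {β : Type*} [Fintype β]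
    (e : Module.Basis β ℝ E) (K : (ι → ℝ) →L[ℝ] E →L[ℝ] ι → ℝ)
    (D : E →L[ℝ] (ι → ℝ) →L[ℝ] E →L[ℝ] ι → ℝ) (C : E →L[ℝ] E →L[ℝ] E)
    {Λ : (ι → ℝ) × (E →L[ℝ] ι → ℝ) →L[ℝ] E →L[ℝ] (ι → ℝ) × (E →L[ℝ] ι → ℝ)}
    (hΛ : ∀ p, Λ p = prolongCoeff K D C p)
    {T : (ι → ℝ) →L[ℝ] (ι → ℝ) × (E →L[ℝ] ι → ℝ)} (hT : ∀ c, (T c).1 = c) (a b : E) (i j : ι) :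
    (tensorCoeff Λ K T a (Pi.single j 1)).2 b i =
      D b (Pi.single j 1) a i
        - ∑ h, K (Pi.single j 1) a h * (T (Pi.single h 1)).2 b i
        + ∑ h, (T (Pi.single j 1)).2 b h * K (Pi.single h 1) a i
        + ∑ c, e.repr (C b a) c * (K (Pi.single j 1) (e c) i - (T (Pi.single j 1)).2 (e c) i) := by
  set S : (ι → ℝ) →L[ℝ] E →L[ℝ] ι → ℝ := (ContinuousLinearMap.snd ℝ _ _).comp T with hS
  have hS' : ∀ c, (T c).2 = S c := fun _ ↦ rfl
  have h7 := prolongCoeff_apply K D C (T (Pi.single j 1)) a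
  have h8 : ∀ Q : E →L[ℝ] ι → ℝ, Q (C b a) i = ∑ c, e.repr (C b a) c * Q (e c) i := by
    intro Q
    conv_lhs => rw [← e.sum_repr (C b a), map_sum, Finset.sum_apply]
    simp_rw [map_smul]
    rfl
  rw [tensorCoeff_apply, hΛ, Prod.snd_sub, sub_apply, Pi.sub_apply, h7.2]
  simp only [hT, hS', Pi.add_apply, Pi.sub_apply, h8, coeff_comp_apply, mul_sub,
    Finset.sum_sub_distrib]
  ring

/-- A component of a linear map to the model fibre of a jet bundle. -/
def modelComponent [DecidableEq ι] (w : E) (i j : ι) :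
    ((ι → ℝ) →L[ℝ] (ι → ℝ) × (E →L[ℝ] ι → ℝ)) →L[ℝ] ℝ :=
  (ContinuousLinearMap.proj i).comp
    ((ContinuousLinearMap.apply ℝ (ι → ℝ) w).comp
      ((ContinuousLinearMap.snd ℝ (ι → ℝ) (E →L[ℝ] ι → ℝ)).comp
        (ContinuousLinearMap.apply ℝ ((ι → ℝ) × (E →L[ℝ] ι → ℝ)) (Pi.single j (1 : ℝ) : ι → ℝ))))

theorem modelComponent_apply [DecidableEq ι] (w : E) (i j : ι)
    (T : (ι → ℝ) →L[ℝ] (ι → ℝ) × (E →L[ℝ] ι → ℝ)) :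
    modelComponent w i j T = (T (Pi.single j 1)).2 w i := rfl

/-- Near `x` the coordinate y^i_bj is one fixed functional of the induced coordinates of Hom (V,
JV). -/
theorem jetCoord_connCoord [DecidableEq ι] {φ : OpenPartialHomeomorph M E}
    (hφ : φ ∈ IsManifold.maximalAtlas 𝓘(ℝ, E) ∞ M) (hs : IsLocalFrameOn 𝓘(ℝ, E) F ∞ s u)
    (hu : IsOpen u) {x : M} (hx : x ∈ φ.source ∩ u) (a b : E) (i j : ι)
    (k : JetSpace E (F →L[ℝ] F × (E →L[ℝ] F)) (fun y ↦ V y →L[ℝ] JetSpace E F V y) x) :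
    jetCoord φ a (fun _ B ↦ connCoord φ b hs i j B) k =
      modelComponent b i j ((jetFiberMap (F →L[ℝ] F × (E →L[ℝ] F)) φ
        (homCoord (jetFiberMap F φ (frameCoord hs)) (frameMap F s)) x k).2 a) := by
  have hcoord := isFiberCoordAt_frameCoord hs hu hx.2
  have hhom := (smoothToModelAt_jetFiberMap hφ hx.1 hcoord.smooth_to).self_of_nhds.homCoord
    hcoord.smooth_from.self_of_nhds
  refine jetCoord_eq hφ hx.1 hhom ?_ a k
  filter_upwards [(φ.open_source.inter hu).mem_nhds hx] with y hy B
  rw [modelComponent_apply, connCoord_eq hφ hs hu hy]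

/-- The coefficients of the connection `κ' ⊗ κ*` of the bundle of connections. -/
theorem jetCoord_overconnection (hκ : IsConnection (fun x v ↦ κ x v))
    (hΓ : IsConnection (fun x v ↦ Γ x v)) {φ : OpenPartialHomeomorph M E}
    (hφ : φ ∈ IsManifold.maximalAtlas 𝓘(ℝ, E) ∞ M) {β : Type*} [Fintype β]
    (e : Module.Basis β ℝ E) (hs : IsLocalFrameOn 𝓘(ℝ, E) F ∞ s u) (hu : IsOpen u) {x : M}
    (hx : x ∈ φ.source ∩ u) {A : V x →L[ℝ] JetSpace E F V x} (hA : A ∈ connectionBundle E F V x)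
    (a b : β) (i j : ι) :
    jetCoord φ (e a) (fun _ B ↦ connCoord φ (e b) hs i j B) (overconnection Γ κ x A) =
      coordDeriv φ (e b) (fun y ↦ connCoord φ (e a) hs i j (κ y)) x
        - ∑ h, connCoord φ (e a) hs h j (κ x) * connCoord φ (e b) hs i h A
        + ∑ h, connCoord φ (e b) hs h j A * connCoord φ (e a) hs i h (κ x)
        + ∑ c, tangentConnCoeff φ e Γ a c b x *
            (connCoord φ (e c) hs i j (κ x) - connCoord φ (e c) hs i j A) := by
  classical
  have hcoord := isFiberCoordAt_frameCoord hs hu hx.2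
  rw [jetCoord_connCoord hφ hs hu hx, jetFiberMap_overconnection hκ hΓ.proj hφ hx.1 hcoord,
    modelComponent_apply]
  refine (tensorCoeff_prolongCoeff_single e _ _ _ (fun _ ↦ rfl)
    (homCoord_jetFiberMap_fst hx.1 (frameCoord_frameMap hs hx.2) hA) (e a) (e b) i j).trans ?_
  simp only [coordDeriv_connCoord hκ hφ hs hu hx, connCoord_connection hφ hs hu hx,
    connCoord_eq hφ hs hu hx _ _ _ A, tangentConnCoeff_eq hφ e Γ hx.1]

end Components

end

/-! ### The theorem -/

theorem mainTheorem2
    {E : Type*} [NormedAddCommGroup E] [NormedSpace ℝ E] [FiniteDimensional ℝ E]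
    {M : Type*} [TopologicalSpace M] [ChartedSpace E M] [IsManifold 𝓘(ℝ, E) ∞ M]
    {F : Type*} [NormedAddCommGroup F] [NormedSpace ℝ F] [FiniteDimensional ℝ F]
    {V : M → Type*} [TopologicalSpace (TotalSpace F V)]
    [∀ x, AddCommGroup (V x)] [∀ x, Module ℝ (V x)] [∀ x, TopologicalSpace (V x)]
    [FiberBundle F V] [VectorBundle ℝ F V] [ContMDiffVectorBundle ∞ F V 𝓘(ℝ, E)]
    (κ : ∀ x, V x →L[ℝ] JetSpace E F V x) (hκ : IsLinearConnection (fun x v ↦ κ x v))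
    (Γ : ∀ x : M, TangentSpace 𝓘(ℝ, E) x →L[ℝ] JetSpace E E (TangentSpace 𝓘(ℝ, E) : M → Type _) x)
    (hΓ : IsLinearConnection (fun x v ↦ Γ x v)) :
    -- `κ'`, `κ*` and `κ' ⊗ κ*` are linear connections of `JV`, `V*` and `JV ⊗ V*`
    IsLinearConnection (prolongConnection Γ (fun x v ↦ κ x v)) ∧
    IsLinearConnection (dualConnection κ) ∧
    IsLinearConnection (overconnection Γ κ) ∧
    (∀ (x : M) (t : JetSpace E F V x) (α : V x →L[ℝ] Trivial M ℝ x),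
      overconnection Γ κ x (α.smulRight t) =
        jetTensor (prolongConnection Γ (fun y v ↦ κ y v) x t) (dualConnection κ x α)) ∧
    -- `κ' ⊗ κ*` is reducible to an affine connection of `C`
    IsReducibleToAffineConnection (connectionBundle E F V) (overconnection Γ κ) ∧
    -- the coefficients of the reduced connection, in arbitrary linear fibred coordinates
    (∀ (φ : OpenPartialHomeomorph M E), φ ∈ IsManifold.maximalAtlas 𝓘(ℝ, E) ∞ M →
      ∀ {β : Type} [Fintype β] (e : Module.Basis β ℝ E) {ι : Type} [Fintype ι]
        {s : ι → ∀ y, V y} {u : Set M} (hs : IsLocalFrameOn 𝓘(ℝ, E) F ∞ s u), IsOpen u →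
      ∀ x ∈ φ.source ∩ u, ∀ A ∈ connectionBundle E F V x, ∀ (a b : β) (i j : ι),
        jetCoord φ (e a) (fun _ B ↦ connCoord φ (e b) hs i j B) (overconnection Γ κ x A) =
          coordDeriv φ (e b) (fun y ↦ connCoord φ (e a) hs i j (κ y)) x
            - ∑ h, connCoord φ (e a) hs h j (κ x) * connCoord φ (e b) hs i h A
            + ∑ h, connCoord φ (e b) hs h j A * connCoord φ (e a) hs i h (κ x)
            + ∑ c, tangentConnCoeff φ e Γ a c b x *
                (connCoord φ (e c) hs i j (κ x) - connCoord φ (e c) hs i j A)) ∧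
    -- `∇κ` is a section of `T*M ⊗ DC = T*M ⊗ T*M ⊗ End V`, and `∇κ` is minus the curvature of `κ`
    (∀ (x : M) (X : TangentSpace 𝓘(ℝ, E) x) (v : V x),
      (covDeriv (overconnection Γ κ) κ x X v).proj = 0) ∧
    (∀ (x : M) (X Y : ∀ y : M, TangentSpace 𝓘(ℝ, E) y) (s : ∀ y, V y),
      CMDiffAt ∞ (T% X) x → CMDiffAt ∞ (T% Y) x → CMDiffAt ∞ (T% s) x →
      (covDeriv (overconnection Γ κ) κ x (X x) (s x)).vert (Y x) =
        -curvature (fun y v ↦ κ y v) X Y s x) ∧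
    -- the components of `∇κ` and of the curvature
    (∀ (φ : OpenPartialHomeomorph M E), φ ∈ IsManifold.maximalAtlas 𝓘(ℝ, E) ∞ M →
      ∀ {β : Type} [Fintype β] (e : Module.Basis β ℝ E) {ι : Type} [Fintype ι]
        {s : ι → ∀ y, V y} {u : Set M} (hs : IsLocalFrameOn 𝓘(ℝ, E) F ∞ s u), IsOpen u →
      ∀ x ∈ φ.source ∩ u, ∀ (a b : β) (i j : ι),
        hs.coeff i x ((covDeriv (overconnection Γ κ) κ x (coordVector φ (e a) x) (s j x)).vert
            (coordVector φ (e b) x)) =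
          coordDeriv φ (e a) (fun y ↦ connCoord φ (e b) hs i j (κ y)) x
            - coordDeriv φ (e b) (fun y ↦ connCoord φ (e a) hs i j (κ y)) x
            + ∑ h, connCoord φ (e b) hs i h (κ x) * connCoord φ (e a) hs h j (κ x)
            - ∑ h, connCoord φ (e a) hs i h (κ x) * connCoord φ (e b) hs h j (κ x) ∧
        hs.coeff i x (curvature (fun y v ↦ κ y v) (coordVector φ (e a)) (coordVector φ (e b))
            (s j) x) =
          coordDeriv φ (e b) (fun y ↦ connCoord φ (e a) hs i j (κ y)) x
            - coordDeriv φ (e a) (fun y ↦ connCoord φ (e b) hs i j (κ y)) x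
            + ∑ h, connCoord φ (e a) hs i h (κ x) * connCoord φ (e b) hs h j (κ x)
            - ∑ h, connCoord φ (e b) hs i h (κ x) * connCoord φ (e a) hs h j (κ x)) ∧
    -- `∇κ` does not depend on `Γ`
    (∀ Γ₁ : ∀ x : M, TangentSpace 𝓘(ℝ, E) x →L[ℝ]
        JetSpace E E (TangentSpace 𝓘(ℝ, E) : M → Type _) x,
      IsLinearConnection (fun x v ↦ Γ₁ x v) →
      ∀ x : M, covDeriv (overconnection Γ₁ κ) κ x = covDeriv (overconnection Γ κ) κ x) := by
  have h1 := hκ.toIsConnection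
  have h2 := hΓ.toIsConnection
  exact ⟨isLinearConnection_prolongConnection h1 h2, isLinearConnection_dualConnection h1,
    isLinearConnection_overconnection h1 h2, overconnection_smulRight h1 h2.proj,
    isReducibleToAffineConnection_overconnection h1 h2,
    fun φ hφ _ _ e _ _ _ _ hs hu x hx A hA a b i j ↦
      jetCoord_overconnection h1 h2 hφ e hs hu hx hA a b i j,
    proj_covDeriv_overconnection h1 h2,
    fun x X Y s hX hY hs ↦ vert_covDeriv_overconnection h1 h2 hX hY hs,
    fun φ hφ _ _ e _ _ _ _ hs hu x hx a b i j ↦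
      ⟨coeff_vert_covDeriv_overconnection h1 h2 hφ hs hu hx (e a) (e b) i j,
        coeff_curvature h1 h2 hφ hs hu hx (e a) (e b) i j⟩,
    fun _ h3 ↦ covDeriv_overconnection_eq h1 h2 h3.toIsConnection⟩
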